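/- Let $d\ge 1$ and write $v_s(z)=(1+|z|^2)^{s/2}$. For $z=(z_1,z_2)\in\mathbb R^{2d}$ let $\pi(z)f(t)=e^{2\pi i z_2\cdot t}f(t-z_1)$, and let $V_\varphi f(z)=\langle f,\pi(z)\varphi\rangle$ be the short-time Fourier transform. Fix a non-zero $\varphi\in\mathcal S(\mathbb R^d)$; for $0<p\le\infty$ and $s\in\mathbb R$ the modulation space $M^p_{v_s}(\mathbb R^d)$ consists of all $f\in\mathcal S'(\mathbb R^d)$ with $\|f\|_{M^p_{v_s}}=\|V_\varphi f\,v_s\|_{L^p(\mathbb R^{2d})}<\infty$. For $\mathcal A\in Sp(2d,\mathbb R)$ let $\mu(\mathcal A)$ be a metaplectic operator on $\mathbb R^{2d}$ associated with $\mathcal A$ (determined up to a phase factor), extended by duality to $\mathcal S'(\mathbb R^{2d})$, and let $W_{\mathcal A}(f,g)=\mu(\mathcal A)(f\otimes\bar g)$. A tempered distribution on $\mathbb R^{2d}$ is said to be in $L^p_{v_s}(\mathbb R^{2d})$ if it is given by a locally integrable function $F$ with $\|F\|_{L^p_{v_s}}=\|F v_s\|_{L^p}<\infty$. Fix $g\in\mathcal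 S(\mathbb R^d)$ and $\mathcal A\in Sp(2d,\mathbb R)$, and let $f$ denote a tempered distribution on $\mathbb R^d$. (i) Let $0<p<2$ and $s\ge 0$. If $f\in M^p_{v_s}(\mathbb R^d)$, then $W_{\mathcal A}(f,g)\in L^p_{v_s}(\mathbb R^{2d})$. (ii) Suppose that $g\ne 0$ and that $W_{\mathcal A}$ is shift-invertible, i.e. there is $E\in GL(2d,\mathbb R)$ such that $|W_{\mathcal A}(\pi(w)h,k)(z)|=|W_{\mathcal A}(h,k)(z-Ew)|$ for all $w\in\mathbb R^{2d}$, all $h,k\in L^2(\mathbb R^d)$ and almost all $z\in\mathbb R^{2d}$ (equivalently, for all $h,k\in\mathcal S(\mathbb R^d)$ and all $w,z\in\mathbb R^{2d}$). Then: (iia) For $1\le p\le 2$ and $s\ge 0$, $$f\in M^p_{v_s}(\mathbb R^d)\iff W_{\mathcal A}(f,g)\in L^p_{v_s}(\mathbb R^{2d}),$$ with equivalence of norms: there is $C>0$, independent of $f$, such that $C^{-1}\|f\|_{M^p_{v_s}}\le\|W_{\mathcal A}(f,g)\|_{L^p_{v_s}}\le C\|f\|_{M^p_{v_s}}$ (where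 the norms are $\infty$ outside of the spaces). (iib) For $1\le p\le\infty$ and $s\in\mathbb R$, if $W_{\mathcal A}(f,g)\in L^p_{v_s}(\mathbb R^{2d})$, then $f\in M^p_{v_s}(\mathbb R^d)$. (iic) Let $0<p<1$ and $s\in\mathbb R$. Suppose that $W_{\mathcal A}(f,g)\in L^p_{v_s}(\mathbb R^{2d})$ and that there are $\gamma\in\mathcal S(\mathbb R^d)$ and a set $\Lambda\subset\mathbb R^{2d}$ (for example a lattice) such that $\{\pi(\lambda)\gamma\}_{\lambda\in\Lambda}$ is a (Gabor) frame for $L^2(\mathbb R^d)$, the distribution $W_{\mathcal A}(f,\gamma)$ is a continuous function, and the sequence $(W_{\mathcal A}(f,\gamma)(\lambda))_{\lambda\in\Lambda}$ is in $\ell^p_{v_s}(\Lambda)$, that is, $\sum_{\lambda\in\Lambda}|W_{\mathcal A}(f,\gamma)(\lambda)|^p v_s(\lambda)^p<\infty$. Then $f\in M^p_{v_s}(\mathbb R^d)$. -/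

import Mathlib

open scoped SchwartzMap FourierTransform ENNReal NNReal ComplexConjugate ContDiff
open MeasureTheory

namespace AWigner

noncomputable section

/-! ## Euclidean space and the splitting of `ℝ^{2d}` into two copies of `ℝ^d` -/

/-- `ℝ^ι` with its Euclidean norm. With `ι = Fin d` this is `ℝ^d`, with `ι = Fin d ⊕ Fin d` it is
`ℝ^{2d}`. -/
abbrev Eu (ι : Type*) [Fintype ι] : Type _ := EuclideanSpace ℝ ι

section Basic

variable {ι : Type*} [Fintype ι]

/-- The first half `x` of `(x, y) ∈ ℝ^{2d}`. -/
def fstPart : Eu (ι ⊕ ι) →L[ℝ] Eu ι :=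
  ContinuousLinearMap.fst ℝ (Eu ι) (Eu ι) ∘L
    (EuclideanSpace.sumEquivProd (𝕜 := ℝ) (ι := ι) (κ := ι)).toContinuousLinearMap

/-- The second half `y` of `(x, y) ∈ ℝ^{2d}`. -/
def sndPart : Eu (ι ⊕ ι) →L[ℝ] Eu ι :=
  ContinuousLinearMap.snd ℝ (Eu ι) (Eu ι) ∘L
    (EuclideanSpace.sumEquivProd (𝕜 := ℝ) (ι := ι) (κ := ι)).toContinuousLinearMap

/-- The vector `(x, y) ∈ ℝ^{2d}`. -/
def joinPair (x y : Eu ι) : Eu (ι ⊕ ι) :=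
  (EuclideanSpace.sumEquivProd (𝕜 := ℝ) (ι := ι) (κ := ι)).symm (x, y)

@[simp] theorem fstPart_apply (z : Eu (ι ⊕ ι)) (i : ι) : fstPart z i = z (Sum.inl i) := by
  simp [fstPart]

@[simp] theorem sndPart_apply (z : Eu (ι ⊕ ι)) (i : ι) : sndPart z i = z (Sum.inr i) := by
  simp [sndPart]

@[simp] theorem joinPair_inl (x y : Eu ι) (i : ι) : joinPair x y (Sum.inl i) = x i := by
  simp [joinPair]

@[simp] theorem joinPair_inr (x y : Eu ι) (i : ι) : joinPair x y (Sum.inr i) = y i := by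
  simp [joinPair]

@[simp] theorem fstPart_joinPair (x y : Eu ι) : fstPart (joinPair x y) = x := by
  ext i; simp

@[simp] theorem sndPart_joinPair (x y : Eu ι) : sndPart (joinPair x y) = y := by
  ext i; simp

theorem norm_sq_eq_parts (z : Eu (ι ⊕ ι)) : ‖z‖ ^ 2 = ‖fstPart z‖ ^ 2 + ‖sndPart z‖ ^ 2 := by
  simp [EuclideanSpace.norm_sq_eq]

theorem inner_eq_parts (z w : Eu (ι ⊕ ι)) :
    inner ℝ z w = inner ℝ (fstPart z) (fstPart w) + inner ℝ (sndPart z) (sndPart w) := by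
  simp [PiLp.inner_apply]

theorem norm_fstPart_le (z : Eu (ι ⊕ ι)) : ‖fstPart z‖ ≤ ‖z‖ := by
  have := norm_sq_eq_parts z
  nlinarith [norm_nonneg z, norm_nonneg (fstPart z), sq_nonneg ‖sndPart z‖]

theorem norm_sndPart_le (z : Eu (ι ⊕ ι)) : ‖sndPart z‖ ≤ ‖z‖ := by
  have := norm_sq_eq_parts z
  nlinarith [norm_nonneg z, norm_nonneg (sndPart z), sq_nonneg ‖fstPart z‖]

theorem norm_le_parts (z : Eu (ι ⊕ ι)) : ‖z‖ ≤ ‖fstPart z‖ + ‖sndPart z‖ := by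
  have := norm_sq_eq_parts z
  nlinarith [norm_nonneg z, norm_nonneg (sndPart z), norm_nonneg (fstPart z)]

theorem measurePreserving_joinPair :
    MeasurePreserving (fun p : Eu ι × Eu ι => joinPair p.1 p.2)
      ((volume : Measure (Eu ι)).prod volume) volume := by
  have h1 := (PiLp.volume_preserving_ofLp ι).prod (PiLp.volume_preserving_ofLp ι)
  have h2 := volume_measurePreserving_sumPiEquivProdPi_symm (fun _ : ι ⊕ ι => ℝ)
  have h3 := PiLp.volume_preserving_toLp (ι ⊕ ι)
  have h := h3.comp (h2.comp h1)
  have he : (fun p : Eu ι × Eu ι => joinPair p.1 p.2) =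
      (WithLp.toLp 2 ∘ ⇑(MeasurableEquiv.sumPiEquivProdPi fun _ : ι ⊕ ι => ℝ).symm ∘
        Prod.map WithLp.ofLp WithLp.ofLp) := by
    funext p
    ext i
    cases i <;> simp [MeasurableEquiv.sumPiEquivProdPi]
  rw [he]
  exact h

/-- Complex conjugation of Schwartz functions. -/
def conjS {V : Type*} [NormedAddCommGroup V] [NormedSpace ℝ V] : 𝓢(V, ℂ) →L[ℝ] 𝓢(V, ℂ) :=
  SchwartzMap.postcompCLM (𝕜 := ℝ) (Complex.conjCLE : ℂ →L[ℝ] ℂ)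

@[simp] theorem conjS_apply {V : Type*} [NormedAddCommGroup V] [NormedSpace ℝ V]
    (f : 𝓢(V, ℂ)) (x : V) : conjS f x = conj (f x) := rfl

theorem hasTemperateGrowth_cexp_I {V : Type*} [NormedAddCommGroup V] [NormedSpace ℝ V]
    {q : V → ℝ} (hq : q.HasTemperateGrowth) :
    (fun x => Complex.exp (Complex.I * (q x : ℂ))).HasTemperateGrowth := by
  have h1 : ∀ n : ℕ, iteratedDeriv n (fun t : ℝ => Complex.exp (Complex.I * (t : ℂ)))
      = fun t : ℝ => Complex.I ^ n * Complex.exp (Complex.I * (t : ℂ)) := by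
    intro n
    induction n with
    | zero => simp
    | succ n ih =>
      rw [iteratedDeriv_succ, ih]
      funext t
      have h2 : HasDerivAt (fun t : ℝ => Complex.I * (t : ℂ)) (Complex.I * 1) t :=
        (Complex.ofRealCLM.hasDerivAt (x := t)).const_mul Complex.I
      have h3 := (h2.cexp.const_mul (Complex.I ^ n)).deriv
      rw [h3]; ring
  have h : (fun t : ℝ => Complex.exp (Complex.I * (t : ℂ))).HasTemperateGrowth := by
    refine ⟨?_, fun n => ⟨0, 1, fun x => ?_⟩⟩
    · exact (contDiff_const.mul Complex.ofRealCLM.contDiff).cexp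
    · rw [norm_iteratedFDeriv_eq_norm_iteratedDeriv, h1]
      simp [Complex.norm_exp]
  exact h.comp hq

/-! ## Time-frequency shifts and the short-time Fourier transform -/

/-- The time-frequency shift `π(z) = M_{z₂} T_{z₁}`, where `z = (z₁, z₂)`. -/
def tfShift (z : Eu (ι ⊕ ι)) : 𝓢(Eu ι, ℂ) →L[ℂ] 𝓢(Eu ι, ℂ) :=
  SchwartzMap.smulLeftCLM ℂ
      (fun t : Eu ι => Complex.exp (Complex.I * ((2 * Real.pi * inner ℝ (sndPart z) t : ℝ) : ℂ)))
    ∘L SchwartzMap.compSubConstCLM ℂ (fstPart z)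

theorem tfShift_apply (z : Eu (ι ⊕ ι)) (f : 𝓢(Eu ι, ℂ)) (t : Eu ι) :
    tfShift z f t =
      Complex.exp (Complex.I * ((2 * Real.pi * inner ℝ (sndPart z) t : ℝ) : ℂ)) *
        f (t - fstPart z) := by
  have hq : (fun t : Eu ι => 2 * Real.pi * inner ℝ (sndPart z) t).HasTemperateGrowth := by
    fun_prop
  simp only [tfShift, ContinuousLinearMap.comp_apply]
  rw [SchwartzMap.smulLeftCLM_apply_apply (hasTemperateGrowth_cexp_I hq)]
  simp

/-- The short-time Fourier transform `V_φ f (z) = ⟨f, π(z) φ⟩` of a tempered distribution, with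
the pairing conjugate-linear in the second slot. -/
def stft (φ : 𝓢(Eu ι, ℂ)) (f : 𝓢'(Eu ι, ℂ)) (z : Eu (ι ⊕ ι)) : ℂ :=
  f (conjS (tfShift z φ))

/-! ## Weighted Lebesgue norms and modulation spaces -/

/-- The weight `v_s(z) = (1 + |z|²)^{s/2}`. -/
def weight (s : ℝ) (z : Eu ι) : ℝ := (1 + ‖z‖ ^ 2) ^ (s / 2)

/-- The `L^p_{v_s}` (quasi-)norm of a function. -/
def weightedNorm (p : ℝ≥0∞) (s : ℝ) (F : Eu ι → ℂ) : ℝ≥0∞ :=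
  eLpNorm (fun z => (weight s z : ℂ) * F z) p volume

/-- The modulation space (quasi-)norm `‖V_φ f‖_{L^p_{v_s}}` computed with the window `φ`. -/
def modulationNorm (φ : 𝓢(Eu ι, ℂ)) (p : ℝ≥0∞) (s : ℝ) (f : 𝓢'(Eu ι, ℂ)) : ℝ≥0∞ :=
  weightedNorm p s (stft φ f)

/-- `f ∈ M^p_{v_s}`, the modulation space being defined with the window `φ`. -/
def MemModulation (φ : 𝓢(Eu ι, ℂ)) (p : ℝ≥0∞) (s : ℝ) (f : 𝓢'(Eu ι, ℂ)) : Prop :=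
  modulationNorm φ p s f < ⊤

/-- The tempered distribution `T` is (the regular distribution given by) the locally integrable
function `F`. -/
def IsGivenBy (T : 𝓢'(Eu ι, ℂ)) (F : Eu ι → ℂ) : Prop :=
  LocallyIntegrable F volume ∧
    ∀ Φ : 𝓢(Eu ι, ℂ), HasCompactSupport Φ → T Φ = ∫ z, F z * Φ z

/-- The `L^p_{v_s}` (quasi-)norm of a tempered distribution: the norm of the locally integrable
function, unique up to null sets, which gives the distribution, and `∞` if there is none. -/
def distNorm (p : ℝ≥0∞) (s : ℝ) (T : 𝓢'(Eu ι, ℂ)) : ℝ≥0∞ :=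
  ⨅ (F : Eu ι → ℂ) (_ : IsGivenBy T F), weightedNorm p s F

/-- `T ∈ L^p_{v_s}`: the tempered distribution `T` is a locally integrable function with finite
`L^p_{v_s}` (quasi-)norm. -/
def MemWeightedLp (p : ℝ≥0∞) (s : ℝ) (T : 𝓢'(Eu ι, ℂ)) : Prop :=
  ∃ F : Eu ι → ℂ, IsGivenBy T F ∧ weightedNorm p s F < ⊤

/-! ## Gabor frames -/

/-- `{π(λ) γ : λ ∈ Λ}` is a (Gabor) frame for `L²(ℝ^d)`. -/
def IsGaborFrame (γ : 𝓢(Eu ι, ℂ)) (Λ : Set (Eu (ι ⊕ ι))) : Prop :=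
  ∃ a b : ℝ≥0, 0 < a ∧ ∀ h : Lp ℂ 2 (volume : Measure (Eu ι)),
    a * ‖h‖ₑ ^ 2 ≤ ∑' l : Λ, ‖inner ℂ ((tfShift (l : Eu (ι ⊕ ι)) γ).toLp 2 volume) h‖ₑ ^ 2 ∧
    ∑' l : Λ, ‖inner ℂ ((tfShift (l : Eu (ι ⊕ ι)) γ).toLp 2 volume) h‖ₑ ^ 2 ≤ b * ‖h‖ₑ ^ 2

/-- The samples on `Λ` of the tempered distribution `T` form a sequence in `ℓ^p_{v_s}(Λ)`,
`0 < p < ∞`; for the point values to make sense, `T` has to be a continuous function. -/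
def SamplesMemWeightedLp (p : ℝ) (s : ℝ) (Λ : Set (Eu ι)) (T : 𝓢'(Eu ι, ℂ)) : Prop :=
  ∃ G : Eu ι → ℂ, Continuous G ∧ IsGivenBy T G ∧
    ∑' l : Λ, ENNReal.ofReal ((weight s (l : Eu ι) * ‖G l‖) ^ p) < ⊤

/-! ## Tensor products -/

theorem norm_joinPair_zero (x : Eu ι) : ‖joinPair x 0‖ = ‖x‖ := by
  have := norm_sq_eq_parts (joinPair x 0)
  simp only [fstPart_joinPair, sndPart_joinPair, norm_zero] at this
  exact (sq_eq_sq₀ (norm_nonneg _) (norm_nonneg _)).1 (by simpa using this)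

/-- `x ↦ (x, 0)`. -/
def inlCLM : Eu ι →L[ℝ] Eu (ι ⊕ ι) :=
  (EuclideanSpace.sumEquivProd (𝕜 := ℝ) (ι := ι) (κ := ι)).symm.toContinuousLinearMap ∘L
    ContinuousLinearMap.inl ℝ (Eu ι) (Eu ι)

theorem inlCLM_apply (x : Eu ι) : inlCLM x = joinPair x 0 := rfl

/-- Auxiliary: partial integration against `conj g`, computed on the Fourier side. -/
def partialPairAux (g : 𝓢(Eu ι, ℂ)) : 𝓢(Eu (ι ⊕ ι), ℂ) →L[ℂ] 𝓢(Eu ι, ℂ) :=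
  FourierTransform.fourierInvCLM ℂ 𝓢(Eu ι, ℂ) ∘L
    SchwartzMap.compCLM ℂ (g := (inlCLM : Eu ι → Eu (ι ⊕ ι))) (inlCLM (ι := ι)).hasTemperateGrowth
      ⟨1, 1, fun x => by rw [inlCLM_apply, norm_joinPair_zero]; linarith⟩ ∘L
    FourierTransform.fourierCLM ℂ 𝓢(Eu (ι ⊕ ι), ℂ) ∘L
    SchwartzMap.smulLeftCLM ℂ (fun z : Eu (ι ⊕ ι) => conj (g (sndPart z)))

theorem partialPairAux_apply (g : 𝓢(Eu ι, ℂ)) (Φ : 𝓢(Eu (ι ⊕ ι), ℂ)) (x : Eu ι) :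
    partialPairAux g Φ x = ∫ y, Φ (joinPair x y) * conj (g y) := by
  have hg : (fun z : Eu (ι ⊕ ι) => conj (g (sndPart z))).HasTemperateGrowth :=
    (conjS g).hasTemperateGrowth.comp (sndPart (ι := ι)).hasTemperateGrowth
  set H : 𝓢(Eu (ι ⊕ ι), ℂ) :=
    SchwartzMap.smulLeftCLM ℂ (fun z : Eu (ι ⊕ ι) => conj (g (sndPart z))) Φ with hH
  have hHa : ∀ x y, H (joinPair x y) = Φ (joinPair x y) * conj (g y) := by
    intro x y
    rw [hH, SchwartzMap.smulLeftCLM_apply_apply hg]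
    simp [mul_comm]
  set R : 𝓢(Eu ι, ℂ) :=
    SchwartzMap.compCLM ℂ (g := (inlCLM : Eu ι → Eu (ι ⊕ ι))) (inlCLM (ι := ι)).hasTemperateGrowth
      ⟨1, 1, fun x => by rw [inlCLM_apply, norm_joinPair_zero]; linarith⟩ (𝓕 H) with hR
  have hRa : ∀ ξ, R ξ = 𝓕 (H : Eu (ι ⊕ ι) → ℂ) (joinPair ξ 0) := by
    intro ξ
    rw [hR, SchwartzMap.compCLM_apply, Function.comp_apply, inlCLM_apply, SchwartzMap.fourier_coe]
  have hmp := measurePreserving_joinPair (ι := ι)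
  have hint : Integrable (fun p : Eu ι × Eu ι => H (joinPair p.1 p.2))
      ((volume : Measure (Eu ι)).prod volume) :=
    hmp.integrable_comp_of_integrable H.integrable
  set h : Eu ι → ℂ := fun x => ∫ y, H (joinPair x y) with hh
  have hhint : Integrable h := hint.integral_prod_left
  have hcont : Continuous h := by
    obtain ⟨C, hC⟩ : ∃ C, ∀ z, ‖Φ z‖ ≤ C :=
      ⟨_, fun z => SchwartzMap.norm_le_seminorm ℝ Φ z⟩
    refine continuous_of_dominated (bound := fun y => C * ‖g y‖) ?_ ?_ ?_ ?_
    · intro x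
      refine Continuous.aestronglyMeasurable ?_
      refine H.continuous.comp ?_
      unfold joinPair
      fun_prop
    · intro x
      refine Filter.Eventually.of_forall fun y => ?_
      rw [hHa, norm_mul, RCLike.norm_conj]
      exact mul_le_mul_of_nonneg_right (hC _) (norm_nonneg _)
    · exact g.integrable.norm.const_mul C
    · refine Filter.Eventually.of_forall fun y => ?_
      refine H.continuous.comp ?_
      unfold joinPair
      fun_prop
  have hF : 𝓕 h = (R : Eu ι → ℂ) := by
    funext ξ
    have hI : Integrable (fun z : Eu (ι ⊕ ι) =>
        𝐞 (-inner ℝ z (joinPair ξ 0)) • H z) volume :=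
      (Real.fourierIntegral_convergent_iff _).2 H.integrable
    have hI2 := integral_prod _ (hmp.integrable_comp_of_integrable hI)
    simp only [Function.comp_apply] at hI2
    rw [hRa, Real.fourier_eq, Real.fourier_eq, ← hmp.map_eq,
      integral_map hmp.measurable.aemeasurable (by rw [hmp.map_eq]; exact hI.aestronglyMeasurable),
      hI2]
    refine integral_congr_ae (Filter.Eventually.of_forall fun x => ?_)
    simp only [inner_eq_parts, fstPart_joinPair, sndPart_joinPair, inner_zero_right, add_zero,
      hh, Circle.smul_def]
    rw [integral_smul]
  have : (𝓕⁻ R) x = h x := by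
    rw [SchwartzMap.fourierInv_coe, ← hF, hcont.fourierInv_fourier_eq hhint]
    rw [hF]; exact R.integrable
  calc partialPairAux g Φ x = (𝓕⁻ R) x := rfl
    _ = h x := this
    _ = _ := by simp only [hh, hHa]


/-- The partial pairing `Φ ↦ (x ↦ ∫ Φ(x, y) conj (g y) dy)`. -/
def partialPair (g : 𝓢(Eu ι, ℂ)) : 𝓢(Eu (ι ⊕ ι), ℂ) →L[ℂ] 𝓢(Eu ι, ℂ) :=
  (partialPairAux g).copy
    (fun Φ =>
      { toFun := fun x => ∫ y, Φ (joinPair x y) * conj (g y)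
        smooth' := by
          have h : (fun x => ∫ y, Φ (joinPair x y) * conj (g y)) = partialPairAux g Φ :=
            funext fun x => (partialPairAux_apply g Φ x).symm
          rw [h]; exact (partialPairAux g Φ).smooth'
        decay' := by
          have h : (fun x => ∫ y, Φ (joinPair x y) * conj (g y)) = partialPairAux g Φ :=
            funext fun x => (partialPairAux_apply g Φ x).symm
          rw [h]; exact (partialPairAux g Φ).decay' })
    (by
      funext Φ
      ext x
      exact (partialPairAux_apply g Φ x).symm)

theorem partialPair_apply (g : 𝓢(Eu ι, ℂ)) (Φ : 𝓢(Eu (ι ⊕ ι), ℂ)) (x : Eu ι) :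
    partialPair g Φ x = ∫ y, Φ (joinPair x y) * conj (g y) := rfl

/-- The tensor product `f ⊗ conj g` of a tempered distribution `f` and the complex conjugate of a
Schwartz function `g`: `Φ ↦ f (x ↦ ∫ Φ(x, y) conj (g y) dy)`. -/
def tensorConj (f : 𝓢'(Eu ι, ℂ)) (g : 𝓢(Eu ι, ℂ)) : 𝓢'(Eu (ι ⊕ ι), ℂ) :=
  PointwiseConvergenceCLM.precomp ℂ (partialPair g) f

theorem tensorConj_apply (f : 𝓢'(Eu ι, ℂ)) (g : 𝓢(Eu ι, ℂ)) (Φ : 𝓢(Eu (ι ⊕ ι), ℂ)) :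
    tensorConj f g Φ = f (partialPair g Φ) := rfl

theorem contDiff_comp_fstPart (f : 𝓢(Eu ι, ℂ)) :
    ContDiff ℝ ∞ (fun z : Eu (ι ⊕ ι) => f (fstPart z)) :=
  ContDiff.comp (g := (f : Eu ι → ℂ)) (f.smooth ⊤) (fstPart (ι := ι)).contDiff

theorem contDiff_conj_comp_sndPart (g : 𝓢(Eu ι, ℂ)) :
    ContDiff ℝ ∞ (fun z : Eu (ι ⊕ ι) => conj (g (sndPart z))) :=
  ContDiff.comp (g := (conjS g : Eu ι → ℂ)) ((conjS g).smooth ⊤) (sndPart (ι := ι)).contDiff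

/-- The tensor product `(f ⊗ conj g)(x, y) = f x * conj (g y)` of Schwartz functions. -/
def tensorConjS (f g : 𝓢(Eu ι, ℂ)) : 𝓢(Eu (ι ⊕ ι), ℂ) where
  toFun z := f (fstPart z) * conj (g (sndPart z))
  smooth' := (contDiff_comp_fstPart f).mul (contDiff_conj_comp_sndPart g)
  decay' := by
    intro k n
    have hf := contDiff_comp_fstPart f
    have hg := contDiff_conj_comp_sndPart g
    have hn1 : ‖(fstPart : Eu (ι ⊕ ι) →L[ℝ] Eu ι)‖ ≤ 1 :=
      ContinuousLinearMap.opNorm_le_bound _ zero_le_one fun z => by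
        simpa using norm_fstPart_le z
    have hn2 : ‖(sndPart : Eu (ι ⊕ ι) →L[ℝ] Eu ι)‖ ≤ 1 :=
      ContinuousLinearMap.opNorm_le_bound _ zero_le_one fun z => by
        simpa using norm_sndPart_le z
    have hcomp : ∀ (L : Eu (ι ⊕ ι) →L[ℝ] Eu ι) (_ : ‖L‖ ≤ 1) (u : 𝓢(Eu ι, ℂ)) (j : ℕ)
        (z : Eu (ι ⊕ ι)), ‖iteratedFDeriv ℝ j (fun z => u (L z)) z‖ ≤
          ‖iteratedFDeriv ℝ j u (L z)‖ := by
      intro L hL u j z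
      have h := L.iteratedFDeriv_comp_right (u.smooth ⊤) z (i := j) (mod_cast le_top)
      have h' : iteratedFDeriv ℝ j (fun z => u (L z)) z =
        (iteratedFDeriv ℝ j u (L z)).compContinuousLinearMap fun _ => L := h
      rw [h']
      refine (ContinuousMultilinearMap.norm_compContinuousLinearMap_le _ _).trans ?_
      refine mul_le_of_le_one_right (norm_nonneg _) ?_
      exact Finset.prod_le_one (fun _ _ => norm_nonneg _) fun _ _ => hL
    have hS : ∀ (u : 𝓢(Eu ι, ℂ)) (k j : ℕ), ∃ M : ℝ, 0 ≤ M ∧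
        ∀ x, ‖x‖ ^ k * ‖iteratedFDeriv ℝ j u x‖ ≤ M := fun u k j => by
      obtain ⟨M, hM⟩ := u.decay' k j
      exact ⟨M, le_trans (by positivity) (hM 0), hM⟩
    choose Mf hMf0 hMf using hS f
    choose Mg hMg0 hMg using hS (conjS g)
    refine ⟨∑ j ∈ Finset.range (n + 1), (n.choose j : ℝ) *
      (2 ^ k * (Mf k j * Mg 0 (n - j) + Mf 0 j * Mg k (n - j))), fun z => ?_⟩
    have hmul := norm_iteratedFDeriv_mul_le hf hg z (n := n) (mod_cast le_top)
    calc ‖z‖ ^ k * ‖iteratedFDeriv ℝ n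
            (fun z : Eu (ι ⊕ ι) => f (fstPart z) * conj (g (sndPart z))) z‖
        ≤ ‖z‖ ^ k * ∑ j ∈ Finset.range (n + 1), (n.choose j : ℝ) *
            ‖iteratedFDeriv ℝ j (fun z : Eu (ι ⊕ ι) => f (fstPart z)) z‖ *
            ‖iteratedFDeriv ℝ (n - j) (fun z : Eu (ι ⊕ ι) => conj (g (sndPart z))) z‖ := by
          gcongr
      _ = ∑ j ∈ Finset.range (n + 1), ‖z‖ ^ k * ((n.choose j : ℝ) *
            ‖iteratedFDeriv ℝ j (fun z : Eu (ι ⊕ ι) => f (fstPart z)) z‖ *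
            ‖iteratedFDeriv ℝ (n - j) (fun z : Eu (ι ⊕ ι) => conj (g (sndPart z))) z‖) := by
          rw [Finset.mul_sum]
      _ ≤ _ := by
          refine Finset.sum_le_sum fun j _ => ?_
          have h1 := hcomp fstPart hn1 f j z
          have h2 := hcomp sndPart hn2 (conjS g) (n - j) z
          simp only [conjS_apply] at h2
          have hk : ‖z‖ ^ k ≤ 2 ^ k * (‖fstPart z‖ ^ k + ‖sndPart z‖ ^ k) := by
            have ha : ‖z‖ ≤ 2 * max ‖fstPart z‖ ‖sndPart z‖ := by
              have := norm_le_parts z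
              have := le_max_left ‖fstPart z‖ ‖sndPart z‖
              have := le_max_right ‖fstPart z‖ ‖sndPart z‖
              linarith
            calc ‖z‖ ^ k ≤ (2 * max ‖fstPart z‖ ‖sndPart z‖) ^ k := by gcongr
              _ = 2 ^ k * max ‖fstPart z‖ ‖sndPart z‖ ^ k := mul_pow _ _ _
              _ ≤ _ := by
                gcongr
                rcases max_cases ‖fstPart z‖ ‖sndPart z‖ with h | h
                · rw [h.1]; linarith [pow_nonneg (norm_nonneg (sndPart z)) k]
                · rw [h.1]; linarith [pow_nonneg (norm_nonneg (fstPart z)) k]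
          set a := ‖iteratedFDeriv ℝ j f (fstPart z)‖
          set b := ‖iteratedFDeriv ℝ (n - j) (conjS g) (sndPart z)‖
          have ha1 := hMf k j (fstPart z)
          have ha0 := hMf 0 j (fstPart z)
          have hb1 := hMg k (n - j) (sndPart z)
          have hb0 := hMg 0 (n - j) (sndPart z)
          rw [pow_zero, one_mul] at ha0 hb0
          calc _ ≤ (2 ^ k * (‖fstPart z‖ ^ k + ‖sndPart z‖ ^ k)) * ((n.choose j : ℝ) * a * b) := by
                gcongr
            _ = (n.choose j : ℝ) * (2 ^ k * ((‖fstPart z‖ ^ k * a) * b +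
                  a * (‖sndPart z‖ ^ k * b))) := by ring
            _ ≤ _ := by
                have := hMf0 k j
                have := hMf0 0 j
                gcongr

@[simp] theorem tensorConjS_apply (f g : 𝓢(Eu ι, ℂ)) (z : Eu (ι ⊕ ι)) :
    tensorConjS f g z = f (fstPart z) * conj (g (sndPart z)) := rfl

end Basic

/-! ## Metaplectic operators -/

section Metaplectic

variable {ι : Type*} [Fintype ι] [DecidableEq ι]

/-- `IsMetaplectic A U`: the operator `U` (on the Schwartz space) is a metaplectic operator `μ(A)`
of the symplectic matrix `A`. The operator `μ(A)` is determined by `A` up to a phase factor; the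
metaplectic operators are generated by

* the Fourier transform, which is `μ(J)` for `J = (0, I; -I, 0)`,
* the multiplications by `e^{iπ Cx·x}` with `C` symmetric, which is `μ` of `(I, 0; C, I)`,
* the rescalings `f ↦ |det L|^{1/2} f(L·)` with `L` invertible, which is `μ` of `(L⁻¹, 0; 0, Lᵀ)`.

With this normalization `μ(A) π(z) = c π(A z) μ(A)`, `|c| = 1`. -/
inductive IsMetaplectic :
    Matrix (ι ⊕ ι) (ι ⊕ ι) ℝ → (𝓢(Eu ι, ℂ) ≃L[ℂ] 𝓢(Eu ι, ℂ)) → Prop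
  | fourier (U : 𝓢(Eu ι, ℂ) ≃L[ℂ] 𝓢(Eu ι, ℂ)) (hU : ∀ f, U f = 𝓕 f) :
      IsMetaplectic (Matrix.fromBlocks 0 1 (-1) 0) U
  | chirp (C : Matrix ι ι ℝ) (hC : C.IsSymm) (U : 𝓢(Eu ι, ℂ) ≃L[ℂ] 𝓢(Eu ι, ℂ))
      (hU : ∀ f x, U f x = Complex.exp (Complex.I *
        ((Real.pi * inner ℝ (Matrix.toEuclideanCLM (𝕜 := ℝ) C x) x : ℝ) : ℂ)) * f x) :
      IsMetaplectic (Matrix.fromBlocks 1 0 C 1) U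
  | rescale (L : Matrix ι ι ℝ) (hL : IsUnit L.det) (U : 𝓢(Eu ι, ℂ) ≃L[ℂ] 𝓢(Eu ι, ℂ))
      (hU : ∀ f x, U f x = (√|L.det| : ℂ) * f (Matrix.toEuclideanCLM (𝕜 := ℝ) L x)) :
      IsMetaplectic (Matrix.fromBlocks L⁻¹ 0 0 L.transpose) U
  | phase (c : ℂ) (hc : ‖c‖ = 1) (A : Matrix (ι ⊕ ι) (ι ⊕ ι) ℝ)
      (U V : 𝓢(Eu ι, ℂ) ≃L[ℂ] 𝓢(Eu ι, ℂ)) (hA : IsMetaplectic A U) (hV : ∀ f, V f = c • U f) :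
      IsMetaplectic A V
  | comp (A B : Matrix (ι ⊕ ι) (ι ⊕ ι) ℝ) (U V : 𝓢(Eu ι, ℂ) ≃L[ℂ] 𝓢(Eu ι, ℂ))
      (hA : IsMetaplectic A U) (hB : IsMetaplectic B V) :
      IsMetaplectic (A * B) (V.trans U)

/-- Multiplication by `e^{iπ Cx·x}`. -/
def chirpCLM (C : Matrix ι ι ℝ) : 𝓢(Eu ι, ℂ) →L[ℂ] 𝓢(Eu ι, ℂ) :=
  SchwartzMap.smulLeftCLM ℂ (fun x => Complex.exp (Complex.I *
    ((Real.pi * inner ℝ (Matrix.toEuclideanCLM (𝕜 := ℝ) C x) x : ℝ) : ℂ)))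

theorem chirpCLM_apply (C : Matrix ι ι ℝ) (f : 𝓢(Eu ι, ℂ)) (x : Eu ι) :
    chirpCLM C f x = Complex.exp (Complex.I *
      ((Real.pi * inner ℝ (Matrix.toEuclideanCLM (𝕜 := ℝ) C x) x : ℝ) : ℂ)) * f x := by
  have hq : (fun x : Eu ι =>
      Real.pi * inner ℝ (Matrix.toEuclideanCLM (𝕜 := ℝ) C x) x).HasTemperateGrowth := by
    have h := ((innerSL ℝ (E := Eu ι)).bilinear_hasTemperateGrowth
      (f := fun x : Eu ι => Matrix.toEuclideanCLM (𝕜 := ℝ) C x) (g := fun x => x)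
      (by fun_prop) (by fun_prop))
    exact (Function.HasTemperateGrowth.const Real.pi).mul h
  rw [chirpCLM, SchwartzMap.smulLeftCLM_apply_apply (hasTemperateGrowth_cexp_I hq)]
  rfl

theorem exists_chirp (C : Matrix ι ι ℝ) (hC : C.IsSymm) :
    ∃ U : 𝓢(Eu ι, ℂ) ≃L[ℂ] 𝓢(Eu ι, ℂ), IsMetaplectic (Matrix.fromBlocks 1 0 C 1) U := by
  refine ⟨ContinuousLinearEquiv.equivOfInverse (chirpCLM C) (chirpCLM (-C)) ?_ ?_,
    IsMetaplectic.chirp C hC _ fun f x => chirpCLM_apply C f x⟩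
  · intro f
    ext x
    rw [chirpCLM_apply, chirpCLM_apply, ← mul_assoc, ← Complex.exp_add]
    simp
  · intro f
    ext x
    rw [chirpCLM_apply, chirpCLM_apply, ← mul_assoc, ← Complex.exp_add]
    simp

theorem exists_rescale (L : Matrix ι ι ℝ) (hL : IsUnit L.det) :
    ∃ U : 𝓢(Eu ι, ℂ) ≃L[ℂ] 𝓢(Eu ι, ℂ),
      IsMetaplectic (Matrix.fromBlocks L⁻¹ 0 0 L.transpose) U := by
  have h1 : ∀ x, Matrix.toEuclideanCLM (𝕜 := ℝ) L⁻¹ (Matrix.toEuclideanCLM (𝕜 := ℝ) L x) = x := by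
    intro x
    rw [← mul_apply_eq_comp, ← map_mul, Matrix.nonsing_inv_mul L hL, map_one]
    rfl
  have h2 : ∀ x, Matrix.toEuclideanCLM (𝕜 := ℝ) L (Matrix.toEuclideanCLM (𝕜 := ℝ) L⁻¹ x) = x := by
    intro x
    rw [← mul_apply_eq_comp, ← map_mul, Matrix.mul_nonsing_inv L hL, map_one]
    rfl
  let e : Eu ι ≃L[ℝ] Eu ι := ContinuousLinearEquiv.equivOfInverse
    (Matrix.toEuclideanCLM (𝕜 := ℝ) L) (Matrix.toEuclideanCLM (𝕜 := ℝ) L⁻¹) h1 h2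
  have hc : (√|L.det| : ℂ) ≠ 0 := by
    rw [Ne, Complex.ofReal_eq_zero]
    exact (Real.sqrt_pos.2 (abs_pos.2 hL.ne_zero)).ne'
  refine ⟨ContinuousLinearEquiv.equivOfInverse
    ((√|L.det| : ℂ) • SchwartzMap.compCLMOfContinuousLinearEquiv ℂ e)
    ((√|L.det| : ℂ)⁻¹ • SchwartzMap.compCLMOfContinuousLinearEquiv ℂ e.symm) ?_ ?_,
    IsMetaplectic.rescale L hL _ fun f x => rfl⟩
  · intro f
    ext x
    simp [hc]
  · intro f
    ext x
    simp [hc]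

theorem exists_fourier :
    ∃ U : 𝓢(Eu ι, ℂ) ≃L[ℂ] 𝓢(Eu ι, ℂ),
      IsMetaplectic (Matrix.fromBlocks 0 1 (-1) 0) U :=
  ⟨FourierTransform.fourierCLE ℂ 𝓢(Eu ι, ℂ), IsMetaplectic.fourier _ fun _ => rfl⟩

/-- Every metaplectic operator belongs to a symplectic matrix. -/
theorem IsMetaplectic.mem_symplecticGroup {A : Matrix (ι ⊕ ι) (ι ⊕ ι) ℝ}
    {U : 𝓢(Eu ι, ℂ) ≃L[ℂ] 𝓢(Eu ι, ℂ)} (h : IsMetaplectic A U) :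
    A ∈ Matrix.symplecticGroup ι ℝ := by
  induction h with
  | fourier U hU => simp [SymplecticGroup.fromBlocks_mem_iff]
  | chirp C hC U hU => simp [SymplecticGroup.fromBlocks_mem_iff, hC.eq]
  | rescale L hL U hU =>
    simp [SymplecticGroup.fromBlocks_mem_iff, ← Matrix.transpose_mul, Matrix.mul_nonsing_inv L hL]
  | phase c hc A U V hA hV ih => exact ih
  | comp A B U V hA hB ihA ihB => exact mul_mem ihA ihB

/-- For a symplectic matrix with upper blocks `A`, `B`, the matrix `A + t B` is invertible for
some real `t`. -/
theorem exists_isUnit_det_add_smul {A B C D : Matrix ι ι ℝ}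
    (h : Matrix.fromBlocks A B C D ∈ Matrix.symplecticGroup ι ℝ) :
    ∃ t : ℝ, IsUnit (A + t • B).det := by
  by_contra hcon
  have hz : ∀ t : ℝ, (A + t • B).det = 0 := fun t => by
    by_contra h0
    exact hcon ⟨t, isUnit_iff_ne_zero.2 h0⟩
  set P : Matrix ι ι (Polynomial ℝ) :=
    A.map Polynomial.C + (Polynomial.X : Polynomial ℝ) • B.map Polynomial.C with hP
  have hp : P.det = 0 := by
    refine Polynomial.funext fun t => ?_
    rw [Polynomial.eval_zero, ← Polynomial.coe_evalRingHom, RingHom.map_det, ← hz t]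
    congr 1
    ext i j
    simp [hP]
    ring
  have hI : (A.map Complex.ofReal + Complex.I • B.map Complex.ofReal).det = 0 := by
    have := congrArg (Polynomial.eval₂RingHom Complex.ofRealHom Complex.I) hp
    rw [RingHom.map_det, map_zero] at this
    rw [← this]
    congr 1
    ext i j
    simp [hP]
    ring
  have ht := SymplecticGroup.transpose_mem h
  rw [Matrix.fromBlocks_transpose, SymplecticGroup.fromBlocks_mem_iff] at ht
  simp only [Matrix.transpose_transpose] at ht
  obtain ⟨hAB, -, hAD⟩ := ht
  set f : Matrix ι ι ℝ →+* Matrix ι ι ℂ := Complex.ofRealHom.mapMatrix with hf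
  have hprod : (A.map Complex.ofReal + Complex.I • B.map Complex.ofReal) *
      (f A.transpose - Complex.I • f B.transpose) =
      f (A * A.transpose + B * B.transpose) := by
    have h1 : A.map Complex.ofReal = f A := rfl
    have h2 : B.map Complex.ofReal = f B := rfl
    rw [h1, h2, map_add, map_mul, map_mul, add_mul, mul_sub, mul_sub, smul_mul_assoc,
      smul_mul_assoc, mul_smul_comm, mul_smul_comm, smul_smul, Complex.I_mul_I, ← map_mul f A,
      ← map_mul f B, ← map_mul f A, ← map_mul f B, hAB]
    module
  have hdet : (A * A.transpose + B * B.transpose).det = 0 := by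
    have h1 := congrArg Matrix.det hprod
    rw [Matrix.det_mul, hI, zero_mul, hf, ← RingHom.map_det] at h1
    simpa using h1.symm
  obtain ⟨v, hv0, hv⟩ := Matrix.exists_mulVec_eq_zero_iff.2 hdet
  have h1 : A.transpose.mulVec v ⬝ᵥ A.transpose.mulVec v +
      B.transpose.mulVec v ⬝ᵥ B.transpose.mulVec v = 0 := by
    have h2 : v ⬝ᵥ (A * A.transpose + B * B.transpose).mulVec v = 0 := by
      rw [hv, dotProduct_zero]
    have key : ∀ M : Matrix ι ι ℝ, v ⬝ᵥ M.mulVec (M.transpose.mulVec v) =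
        M.transpose.mulVec v ⬝ᵥ M.transpose.mulVec v := fun M => by
      rw [Matrix.dotProduct_mulVec, Matrix.mulVec_transpose]
    rwa [Matrix.add_mulVec, dotProduct_add, ← Matrix.mulVec_mulVec, ← Matrix.mulVec_mulVec,
      key, key] at h2
  have h2 : 0 ≤ A.transpose.mulVec v ⬝ᵥ A.transpose.mulVec v :=
    Finset.sum_nonneg fun i _ => mul_self_nonneg _
  have h3 : 0 ≤ B.transpose.mulVec v ⬝ᵥ B.transpose.mulVec v :=
    Finset.sum_nonneg fun i _ => mul_self_nonneg _
  have h4 : A.transpose.mulVec v = 0 := dotProduct_self_eq_zero.1 (by linarith)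
  have h5 : B.transpose.mulVec v = 0 := dotProduct_self_eq_zero.1 (by linarith)
  have h6 : D * A.transpose - C * B.transpose = 1 := by
    have := congrArg Matrix.transpose hAD
    simpa [Matrix.transpose_sub, Matrix.transpose_mul] using this
  apply hv0
  have h7 := congrArg (fun M : Matrix ι ι ℝ => M.mulVec v) h6
  simp only [Matrix.sub_mulVec, ← Matrix.mulVec_mulVec, h4, h5, Matrix.mulVec_zero, sub_zero,
    Matrix.one_mulVec] at h7
  exact h7.symm

/-- Every symplectic matrix has a metaplectic operator. -/
theorem exists_isMetaplectic {S : Matrix (ι ⊕ ι) (ι ⊕ ι) ℝ}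
    (hS : S ∈ Matrix.symplecticGroup ι ℝ) :
    ∃ U : 𝓢(Eu ι, ℂ) ≃L[ℂ] 𝓢(Eu ι, ℂ), IsMetaplectic S U := by
  have hmul : ∀ {M N : Matrix (ι ⊕ ι) (ι ⊕ ι) ℝ},
      (∃ U : 𝓢(Eu ι, ℂ) ≃L[ℂ] 𝓢(Eu ι, ℂ), IsMetaplectic M U) →
      (∃ U : 𝓢(Eu ι, ℂ) ≃L[ℂ] 𝓢(Eu ι, ℂ), IsMetaplectic N U) →
      ∃ U : 𝓢(Eu ι, ℂ) ≃L[ℂ] 𝓢(Eu ι, ℂ), IsMetaplectic (M * N) U := by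
    rintro M N ⟨U, hU⟩ ⟨V, hV⟩
    exact ⟨_, IsMetaplectic.comp M N U V hU hV⟩
  have hupper : ∀ P : Matrix ι ι ℝ, P.IsSymm →
      ∃ U : 𝓢(Eu ι, ℂ) ≃L[ℂ] 𝓢(Eu ι, ℂ), IsMetaplectic (Matrix.fromBlocks 1 P 0 1) U := by
    intro P hP
    have hJ := exists_fourier (ι := ι)
    have h := hmul (hmul hJ (exists_chirp (-P) (by simpa using hP))) (hmul hJ (hmul hJ hJ))
    simpa [Matrix.fromBlocks_multiply] using h
  obtain ⟨A, B, C, D, rfl⟩ : ∃ A B C D, S = Matrix.fromBlocks A B C D :=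
    ⟨_, _, _, _, (Matrix.fromBlocks_toBlocks S).symm⟩
  obtain ⟨t, ht⟩ := exists_isUnit_det_add_smul hS
  have hsymm : ∀ r : ℝ, (r • (1 : Matrix ι ι ℝ)).IsSymm := fun r => by
    simp [Matrix.IsSymm]
  set X := A + t • B with hX
  set Y := C + t • D with hY
  have hS' : Matrix.fromBlocks X B Y D ∈ Matrix.symplecticGroup ι ℝ := by
    obtain ⟨U, hU⟩ := exists_chirp (t • (1 : Matrix ι ι ℝ)) (hsymm t)
    have h := mul_mem hS hU.mem_symplecticGroup
    simpa [Matrix.fromBlocks_multiply, hX, hY] using h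
  have h1 := SymplecticGroup.fromBlocks_mem_iff.1 hS'
  have h2 := SymplecticGroup.transpose_mem hS'
  rw [Matrix.fromBlocks_transpose, SymplecticGroup.fromBlocks_mem_iff] at h2
  simp only [Matrix.transpose_transpose] at h2
  have hXt : IsUnit X.transpose.det := by rwa [Matrix.det_transpose]
  have hYs : (Y * X⁻¹).IsSymm := by
    rw [Matrix.IsSymm, Matrix.transpose_mul, Matrix.transpose_nonsing_inv]
    calc X.transpose⁻¹ * Y.transpose = X.transpose⁻¹ * (Y.transpose * X) * X⁻¹ := by
          rw [mul_assoc, mul_assoc, Matrix.mul_nonsing_inv X ht, mul_one]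
      _ = Y * X⁻¹ := by
          rw [← h1.1, ← mul_assoc, Matrix.nonsing_inv_mul _ hXt, one_mul]
  have hBs : (X⁻¹ * B).IsSymm := by
    rw [Matrix.IsSymm, Matrix.transpose_mul, Matrix.transpose_nonsing_inv]
    calc B.transpose * X.transpose⁻¹ = X⁻¹ * (X * B.transpose) * X.transpose⁻¹ := by
          rw [← mul_assoc, Matrix.nonsing_inv_mul X ht, one_mul]
      _ = X⁻¹ * B := by
          rw [h2.1, mul_assoc, mul_assoc, Matrix.mul_nonsing_inv _ hXt, mul_one]
  have hD : D = Y * X⁻¹ * B + X.transpose⁻¹ := by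
    have h3 : X.transpose⁻¹ * (X.transpose * D - Y.transpose * B) = X.transpose⁻¹ := by
      rw [h1.2.2, mul_one]
    rw [mul_sub, ← mul_assoc, Matrix.nonsing_inv_mul _ hXt, one_mul, ← mul_assoc] at h3
    have h4 : X.transpose⁻¹ * Y.transpose = Y * X⁻¹ := by
      rw [← Matrix.transpose_nonsing_inv, ← Matrix.transpose_mul]
      exact hYs
    rw [h4] at h3
    rw [← h3]; abel
  have hXi : IsUnit (X⁻¹).det := by
    rw [Matrix.det_nonsing_inv]
    exact ht.ringInverse
  have hfac : Matrix.fromBlocks A B C D =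
      Matrix.fromBlocks 1 0 (Y * X⁻¹) 1 *
        (Matrix.fromBlocks X⁻¹⁻¹ 0 0 (X⁻¹).transpose *
          (Matrix.fromBlocks 1 (X⁻¹ * B) 0 1 * Matrix.fromBlocks 1 0 ((-t) • 1) 1)) := by
    have h5 : X * (X⁻¹ * B) = B := by
      rw [← mul_assoc, Matrix.mul_nonsing_inv X ht, one_mul]
    have h6 : Y * X⁻¹ * X = Y := by
      rw [mul_assoc, Matrix.nonsing_inv_mul X ht, mul_one]
    have h7 : Matrix.fromBlocks 1 0 (Y * X⁻¹) 1 *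
        (Matrix.fromBlocks X⁻¹⁻¹ 0 0 (X⁻¹).transpose * Matrix.fromBlocks 1 (X⁻¹ * B) 0 1) =
        Matrix.fromBlocks X B Y D := by
      rw [Matrix.nonsing_inv_nonsing_inv X ht, Matrix.transpose_nonsing_inv]
      simp only [Matrix.fromBlocks_multiply, mul_one, mul_zero, zero_mul, one_mul, add_zero,
        zero_add, h5, h6]
      rw [← hD]
    rw [← mul_assoc (Matrix.fromBlocks X⁻¹⁻¹ 0 0 (X⁻¹).transpose), ← mul_assoc, h7,
      Matrix.fromBlocks_multiply]
    simp [hX, hY]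
  rw [hfac]
  exact hmul (exists_chirp _ hYs) (hmul (exists_rescale _ hXi)
    (hmul (hupper _ hBs) (exists_chirp _ (hsymm _))))

end Metaplectic

/-! ## The `𝒜`-Wigner distribution -/

section Wigner

variable {ι : Type*} [Fintype ι]

/-- The map `Φ ↦ conj (U⁻¹ (conj Φ))`. -/
def conjInv (U : 𝓢(Eu ι, ℂ) ≃L[ℂ] 𝓢(Eu ι, ℂ)) : 𝓢(Eu ι, ℂ) →L[ℂ] 𝓢(Eu ι, ℂ) where
  toFun Φ := conjS (U.symm (conjS Φ))
  map_add' Φ Ψ := by simp only [map_add]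
  map_smul' c Φ := by
    have h : conjS (c • Φ) = conj c • conjS Φ := by ext x; simp
    rw [h, map_smul]
    ext x
    simp
  cont := conjS.continuous.comp (U.symm.continuous.comp conjS.continuous)

/-- The extension of a metaplectic operator to tempered distributions, by duality:
`⟨μ(A) T, Φ⟩ = ⟨T, μ(A)⁻¹ Φ⟩` for the pairing which is conjugate-linear in the second slot
(`μ(A)` is unitary). -/
def extendDist (U : 𝓢(Eu ι, ℂ) ≃L[ℂ] 𝓢(Eu ι, ℂ)) (T : 𝓢'(Eu ι, ℂ)) : 𝓢'(Eu ι, ℂ) :=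
  PointwiseConvergenceCLM.precomp ℂ (conjInv U) T

theorem extendDist_apply (U : 𝓢(Eu ι, ℂ) ≃L[ℂ] 𝓢(Eu ι, ℂ)) (T : 𝓢'(Eu ι, ℂ)) (Φ : 𝓢(Eu ι, ℂ)) :
    extendDist U T Φ = T (conjS (U.symm (conjS Φ))) := rfl

/-- The `𝒜`-Wigner distribution `W_𝒜(f, g) = μ(𝒜)(f ⊗ conj g)` of a tempered distribution `f` and
a Schwartz function `g`, where `U = μ(𝒜)`. -/
def wigner (U : 𝓢(Eu (ι ⊕ ι), ℂ) ≃L[ℂ] 𝓢(Eu (ι ⊕ ι), ℂ)) (f : 𝓢'(Eu ι, ℂ)) (g : 𝓢(Eu ι, ℂ)) :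
    𝓢'(Eu (ι ⊕ ι), ℂ) :=
  extendDist U (tensorConj f g)

/-- The `𝒜`-Wigner distribution `W_𝒜(f, g) = μ(𝒜)(f ⊗ conj g)` of two Schwartz functions, as a
Schwartz function, where `U = μ(𝒜)`. -/
def wignerS (U : 𝓢(Eu (ι ⊕ ι), ℂ) ≃L[ℂ] 𝓢(Eu (ι ⊕ ι), ℂ)) (f g : 𝓢(Eu ι, ℂ)) :
    𝓢(Eu (ι ⊕ ι), ℂ) :=
  U (tensorConjS f g)

/-- `W_𝒜` is shift-invertible: there is `E ∈ GL(2d, ℝ)` such that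
`|W_𝒜(π(w) f, g)(z)| = |W_𝒜(f, g)(z - E w)|` for all `w`, `z` and all `f`, `g`. By density of the
Schwartz space in `L²` and continuity of `W_𝒜 : L² × L² → L²` it does not matter whether `f`, `g`
range over Schwartz functions or (with equality for almost every `z`) over `L²`. -/
def IsShiftInvertible [DecidableEq ι]
    (U : 𝓢(Eu (ι ⊕ ι), ℂ) ≃L[ℂ] 𝓢(Eu (ι ⊕ ι), ℂ)) : Prop :=
  ∃ E : Matrix (ι ⊕ ι) (ι ⊕ ι) ℝ, IsUnit E.det ∧
    ∀ (f g : 𝓢(Eu ι, ℂ)) (w z : Eu (ι ⊕ ι)),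
      ‖wignerS U (tfShift w f) g z‖ = ‖wignerS U f g (z - Matrix.toEuclideanCLM (𝕜 := ℝ) E w)‖

end Wigner

end

end AWigner

/-!
# `A`-Wigner distributions and modulation spaces

Write `V = V_φ f` for the short-time Fourier transform and `W = W_A(f, g)`. Three identities carry
the proof. The inversion formula `‖φ‖² f = ∫ V(u) π(u) φ du`, tested against Schwartz functions
(`apply_conjS_mul_sPair_self`), turns into `‖φ‖² W = ∫ V(u) W_A(π(u) φ, g) du`
(`wigner_conjS_mul_sPair_self`). Conversely, since a metaplectic operator is unitary
(`IsMetaplectic.sPair_eq`), testing `W` against `W_A(π(w) φ, g)` gives `‖g‖² V(w)`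
(`wigner_conjS_wignerS`). To apply a tempered distribution under an integral sign, it is factored
through a Banach space of weighted jets (`functional_integral`).

If `W_A` is shift-invertible with matrix `E`, then `|W_A(π(u) φ, g)(z)| = |W_A(φ, g)(z - E u)|`,
and `W_A(φ, g)` is a Schwartz function. Hence `W` is a function of polynomial growth, and `V` and
`W` dominate each other up to a convolution with a rapidly decaying kernel and the linear change of
variables `E` (`exists_enorm_wignerFun_le`, `exists_enorm_stft_le_wignerFun`). For `p ≥ 1` and
weights of any order, the equivalence of the norms is then Young's inequality
(`exists_weightedNorm_le`).

For `p < 1` Young's inequality is not available. However, `V` and `W` are both dominated by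
averages of themselves with kernels of arbitrarily fast decay. For a function `a` of polynomial
growth with this property, Peetre's maximal function `sup_w a(w) (1 + |z - w|)^{-M}` shows that
every power `a^p`, `p > 0`, is dominated by its averages as well (`exists_rpow_le_lintegral`).
Therefore averages of `a^q` with `q ≥ p` are bounded by the power `q / p` of averages of `a^p`
(`exists_lintegral_rpow_le`). With `q = 1` this proves that `W` in the weighted `L^p` implies
`f ∈ M^p`.

Without shift-invertibility, and for `p ≤ 2`, take `q = 2`. First, `V ∈ L²`, so that `W` is
bounded for the `L²` norm by Moyal's identity, and `W` is a function `F ∈ L²` by Riesz'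
representation theorem (`exists_eq_integral_of_sq_le`). By the covariance of metaplectic operators
(`IsMetaplectic.exists_tfShift`), the short-time Fourier transform of `F` is dominated by averages
of `V` about the points `L u`, where `L` is a linear embedding of `ℝ^{2d}` into `ℝ^{4d}`. By
Plancherel's theorem, the `L²` norm of `F` near `x` is bounded by averages of `|V|²` over those
`u` for which the first half of `L u` is close to `x`, hence by the power `2 / p` of such averages
of `|V|^p`. Hölder's inequality passes from the local `L²` norm to the local `L^p` norm, which again
uses `p ≤ 2`, and integration in `x` gives the weighted `L^p` norm. As the first half of `L` may
fail to be injective, the weight can only be transported for `s ≥ 0`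
(`memWeightedLp_wigner`).
-/

namespace AWigner

/-! ### Tempered distributions and parameter integrals -/

section Exchange

open scoped LineDeriv

variable {E Y : Type*} [NormedAddCommGroup E] [NormedSpace ℝ E]
  [TopologicalSpace Y] [MeasurableSpace Y] [OpensMeasurableSpace Y]

/-- `x ↦ ‖x‖ ^ k • D^n Φ x` as a bounded continuous function. -/
noncomputable def weightedDeriv (k n : ℕ) (Φ : 𝓢(E, ℂ)) :
    BoundedContinuousFunction E (E [×n]→L[ℝ] ℂ) :=
  BoundedContinuousFunction.ofNormedAddCommGroup
    (fun x => ‖x‖ ^ k • iteratedFDeriv ℝ n Φ x)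
    ((continuous_norm.pow k).smul ((Φ.smooth ⊤).continuous_iteratedFDeriv (mod_cast le_top)))
    (SchwartzMap.seminorm ℂ k n Φ)
    (fun x => by
      rw [norm_smul, norm_pow, norm_norm]
      exact Φ.le_seminorm ℂ k n x)

theorem norm_weightedDeriv_le (k n : ℕ) (Φ : 𝓢(E, ℂ)) :
    ‖weightedDeriv k n Φ‖ ≤ SchwartzMap.seminorm ℂ k n Φ :=
  BoundedContinuousFunction.norm_ofNormedAddCommGroup_le _ (apply_nonneg _ _) _

/-- `Φ ↦ (x ↦ ‖x‖ ^ k • D^n Φ x)`, with values in the Banach space of bounded continuous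
functions; its norm is the Schwartz seminorm of index `(k, n)`. -/
noncomputable def weightedDerivBCF (k n : ℕ) :
    𝓢(E, ℂ) →L[ℂ] BoundedContinuousFunction E (E [×n]→L[ℝ] ℂ) :=
  SchwartzMap.mkCLMtoNormedSpace (𝕜 := ℂ) (σ := RingHom.id ℂ) (D := E) (E := ℂ)
    (G := BoundedContinuousFunction E (E [×n]→L[ℝ] ℂ)) (weightedDeriv k n)
    (fun Φ Ψ => by
      ext1 x
      have h := iteratedFDeriv_add_apply (i := n) (x := x) ((Φ.smooth n).contDiffAt)
        ((Ψ.smooth n).contDiffAt)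
      simp only [weightedDeriv, BoundedContinuousFunction.coe_ofNormedAddCommGroup,
        BoundedContinuousFunction.coe_add, Pi.add_apply, ← smul_add]
      rw [← h]; rfl)
    (fun c Φ => by
      ext1 x
      have h := iteratedFDeriv_const_smul_apply (i := n) (x := x) (a := c) ((Φ.smooth n).contDiffAt)
      simp only [weightedDeriv, BoundedContinuousFunction.coe_ofNormedAddCommGroup,
        RingHom.id_apply, BoundedContinuousFunction.coe_smul]
      rw [smul_comm, ← h]; rfl)
    ⟨{(k, n)}, 1, zero_le_one, fun Φ => by
      rw [one_mul, Finset.sup_singleton]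
      exact norm_weightedDeriv_le k n Φ⟩

theorem weightedDerivBCF_apply (k n : ℕ) (Φ : 𝓢(E, ℂ)) (x : E) :
    weightedDerivBCF k n Φ x = ‖x‖ ^ k • iteratedFDeriv ℝ n Φ x := rfl

theorem norm_weightedDerivBCF (k n : ℕ) (Φ : 𝓢(E, ℂ)) :
    ‖weightedDerivBCF k n Φ‖ = SchwartzMap.seminorm ℂ k n Φ := by
  refine le_antisymm (norm_weightedDeriv_le k n Φ) ?_
  refine Φ.seminorm_le_bound ℂ k n (norm_nonneg (weightedDerivBCF k n Φ)) fun x => ?_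
  have h := (weightedDerivBCF k n Φ).norm_coe_le_norm x
  rwa [weightedDerivBCF_apply, norm_smul, norm_pow, norm_norm] at h

theorem exists_bound_of_continuous_seminorm (q : Seminorm ℂ 𝓢(E, ℂ)) (hq : Continuous q) :
    ∃ (s : Finset (ℕ × ℕ)) (C : ℝ), 0 ≤ C ∧
      ∀ Φ, q Φ ≤ C * ∑ i ∈ s, SchwartzMap.seminorm ℂ i.1 i.2 Φ := by
  obtain ⟨s, C, -, h⟩ := Seminorm.bound_of_continuous (schwartz_withSeminorms ℂ E ℂ) q hq
  refine ⟨s, C, C.2, fun Φ => (h Φ).trans ?_⟩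
  change (C : ℝ) * s.sup (schwartzSeminormFamily ℂ E ℂ) Φ ≤ _
  refine mul_le_mul_of_nonneg_left ?_ C.2
  have h2 := Seminorm.finset_sup_le_sum (schwartzSeminormFamily ℂ E ℂ) s Φ
  refine h2.trans (le_of_eq ?_)
  rw [← FunLike.coeAddMonoidHom_apply, map_sum, Finset.sum_apply]
  rfl

/-- A continuous functional on the Schwartz space is bounded by finitely many seminorms. -/
theorem exists_bound_of_functional (f : 𝓢(E, ℂ) →L[ℂ] ℂ) :
    ∃ (s : Finset (ℕ × ℕ)) (C : ℝ), 0 ≤ C ∧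
      ∀ Φ, ‖f Φ‖ ≤ C * ∑ i ∈ s, SchwartzMap.seminorm ℂ i.1 i.2 Φ :=
  exists_bound_of_continuous_seminorm
    ((normSeminorm ℂ ℂ).comp (f : 𝓢(E, ℂ) →ₗ[ℂ] ℂ)) f.continuous.norm

theorem continuous_seminorm (k n : ℕ) :
    Continuous fun Φ : 𝓢(E, ℂ) => SchwartzMap.seminorm ℂ k n Φ :=
  (schwartz_withSeminorms ℂ E ℂ).continuous_seminorm (k, n)

theorem exists_seminorm_clm_le {E' : Type*} [NormedAddCommGroup E'] [NormedSpace ℝ E']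
    (A : 𝓢(E, ℂ) →L[ℂ] 𝓢(E', ℂ)) (k n : ℕ) :
    ∃ (s : Finset (ℕ × ℕ)) (C : ℝ), 0 ≤ C ∧
      ∀ Φ, SchwartzMap.seminorm ℂ k n (A Φ) ≤
        C * ∑ i ∈ s, SchwartzMap.seminorm ℂ i.1 i.2 Φ :=
  exists_bound_of_continuous_seminorm
    ((SchwartzMap.seminorm ℂ k n : Seminorm ℂ 𝓢(E', ℂ)).comp (A : 𝓢(E, ℂ) →ₗ[ℂ] 𝓢(E', ℂ)))
    ((continuous_seminorm k n).comp A.continuous)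

/-- Hahn–Banach: a functional bounded by `‖L ·‖` factors through `L`. -/
theorem exists_factor_of_bound {X : Type*} [NormedAddCommGroup X] [NormedSpace ℂ X]
    (f : 𝓢(E, ℂ) →L[ℂ] ℂ) (L : 𝓢(E, ℂ) →L[ℂ] X) (hL : Function.Injective L) (C : ℝ)
    (h : ∀ Φ, ‖f Φ‖ ≤ C * ‖L Φ‖) : ∃ ℓ : X →L[ℂ] ℂ, ∀ Φ, f Φ = ℓ (L Φ) := by
  let e := LinearEquiv.ofInjective L.toLinearMap hL
  have hbound : ∀ b, ‖(f.toLinearMap ∘ₗ e.symm.toLinearMap) b‖ ≤ C * ‖b‖ := by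
    intro b
    obtain ⟨Φ, rfl⟩ := e.surjective b
    simp only [LinearMap.comp_apply, LinearEquiv.coe_coe, LinearEquiv.symm_apply_apply]
    exact h Φ
  obtain ⟨ℓ, hℓ, -⟩ := exists_extension_norm_eq (𝕜 := ℂ) _
    (LinearMap.mkContinuous _ _ hbound)
  refine ⟨ℓ, fun Φ => ?_⟩
  have h1 := hℓ (e Φ)
  have h2 : ((e Φ : LinearMap.range L.toLinearMap) : X) = L Φ := rfl
  rw [h2] at h1
  rw [h1]
  simp

variable {μ : Measure Y}

/-- A directional derivative of a Schwartz function which is pointwise an integral of Schwartz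
functions may be computed under the integral sign. -/
theorem lineDerivOp_integral {Φ : Y → 𝓢(E, ℂ)} (hc : Continuous Φ)
    (hint : ∀ k n, Integrable (fun y => SchwartzMap.seminorm ℂ k n (Φ y)) μ) {Θ : 𝓢(E, ℂ)}
    (hΘ : ∀ t, Θ t = ∫ y, Φ y t ∂μ) (m t : E) :
    (∂_{m} Θ) t = ∫ y, (∂_{m} (Φ y)) t ∂μ := by
  have heval : ∀ t : E, Continuous fun Ψ : 𝓢(E, ℂ) => Ψ t := fun t =>
    (BoundedContinuousFunction.evalCLM ℂ t).continuous.comp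
      (SchwartzMap.toBoundedContinuousFunctionCLM ℂ E ℂ).continuous
  have hmeas : ∀ t, AEStronglyMeasurable (fun y => Φ y t) μ := fun t =>
    ((heval t).comp hc).aestronglyMeasurable
  have hi : ∀ t, Integrable (fun y => Φ y t) μ := fun t =>
    (hint 0 0).mono' (hmeas t) (Filter.Eventually.of_forall fun y => (Φ y).norm_le_seminorm ℂ t)
  have hd : HasDerivAt (fun r : ℝ => ∫ y, Φ y (t + r • m) ∂μ) (∫ y, (∂_{m} (Φ y)) t ∂μ) 0 := by
    have hbound : ∀ y x, ‖(∂_{m} (Φ y)) x‖ ≤ SchwartzMap.seminorm ℂ 0 1 (Φ y) * ‖m‖ := by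
      intro y x
      rw [SchwartzMap.lineDerivOp_apply_eq_fderiv]
      refine ((fderiv ℝ (Φ y) x).le_opNorm m).trans ?_
      gcongr
      rw [← norm_iteratedFDeriv_one]
      exact (Φ y).norm_iteratedFDeriv_le_seminorm ℂ 1 x
    have h := hasDerivAt_integral_of_dominated_loc_of_deriv_le (𝕜 := ℝ) (s := Set.univ) (μ := μ)
      (F := fun r y => Φ y (t + r • m)) (x₀ := (0 : ℝ))
      (bound := fun y => SchwartzMap.seminorm ℂ 0 1 (Φ y) * ‖m‖)
      (F' := fun r y => (∂_{m} (Φ y)) (t + r • m))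
      Filter.univ_mem (Filter.Eventually.of_forall fun r => hmeas _) (hi _)
      (((heval _).comp ((LineDeriv.lineDerivOpCLM ℂ 𝓢(E, ℂ) m).continuous.comp
        hc)).aestronglyMeasurable)
      (Filter.Eventually.of_forall fun y x _ => hbound y _) ((hint 0 1).mul_const _)
      (Filter.Eventually.of_forall fun y r _ => by
        rw [SchwartzMap.lineDerivOp_apply_eq_fderiv]
        have h1 : HasDerivAt (fun r : ℝ => t + r • m) m r := by
          simpa using ((hasDerivAt_id r).smul_const m).const_add t
        exact ((Φ y).differentiableAt.hasFDerivAt.comp_hasDerivAt r h1))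
    simpa using h.2
  have hd2 : HasDerivAt (fun r : ℝ => Θ (t + r • m)) ((∂_{m} Θ) t) 0 := by
    rw [SchwartzMap.lineDerivOp_apply_eq_fderiv]
    have h1 : HasDerivAt (fun r : ℝ => t + r • m) m 0 := by
      simpa using ((hasDerivAt_id (0 : ℝ)).smul_const m).const_add t
    have h2 := (Θ.differentiableAt (x := t + (0 : ℝ) • m)).hasFDerivAt.comp_hasDerivAt 0 h1
    simpa [Function.comp_def] using h2
  simp only [hΘ] at hd2
  exact hd2.unique hd

theorem integrable_seminorm_clm {Φ : Y → 𝓢(E, ℂ)} (hc : Continuous Φ)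
    (hint : ∀ k n, Integrable (fun y => SchwartzMap.seminorm ℂ k n (Φ y)) μ)
    (A : 𝓢(E, ℂ) →L[ℂ] 𝓢(E, ℂ)) (k n : ℕ) :
    Integrable (fun y => SchwartzMap.seminorm ℂ k n (A (Φ y))) μ := by
  obtain ⟨s, C, hC, hb⟩ := exists_seminorm_clm_le A k n
  refine Integrable.mono' ((integrable_finsetSum s fun i _ => hint i.1 i.2).const_mul C)
    ((continuous_seminorm k n).comp (A.continuous.comp hc)).aestronglyMeasurable
    (Filter.Eventually.of_forall fun y => ?_)
  rw [Real.norm_of_nonneg (apply_nonneg _ _)]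
  exact hb _

theorem iteratedFDeriv_integral {Φ : Y → 𝓢(E, ℂ)} (hc : Continuous Φ)
    (hint : ∀ k n, Integrable (fun y => SchwartzMap.seminorm ℂ k n (Φ y)) μ) {Θ : 𝓢(E, ℂ)}
    (hΘ : ∀ t, Θ t = ∫ y, Φ y t ∂μ) (n : ℕ) (t : E) (m : Fin n → E) :
    iteratedFDeriv ℝ n Θ t m = ∫ y, iteratedFDeriv ℝ n (Φ y) t m ∂μ := by
  simp_rw [← SchwartzMap.iteratedLineDerivOp_eq_iteratedFDeriv]
  induction n generalizing t with
  | zero => simpa using hΘ t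
  | succ n ih =>
    simp_rw [LineDeriv.iteratedLineDerivOp_succ_left]
    exact lineDerivOp_integral
      ((LineDeriv.iteratedLineDerivOpCLM ℂ 𝓢(E, ℂ) (Fin.tail m)).continuous.comp hc)
      (integrable_seminorm_clm hc hint (LineDeriv.iteratedLineDerivOpCLM ℂ 𝓢(E, ℂ) (Fin.tail m)))
      (fun t => ih t (Fin.tail m)) (m 0) t

/-- Finite families of weighted jets: a Banach space carrying finitely many Schwartz seminorms. -/
def JetSpace (E : Type*) [NormedAddCommGroup E] [NormedSpace ℝ E] (s : Finset (ℕ × ℕ)) : Type _ :=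
  ∀ i : s, BoundedContinuousFunction E (E [×i.1.2]→L[ℝ] ℂ)

noncomputable instance (s : Finset (ℕ × ℕ)) : NormedAddCommGroup (JetSpace E s) :=
  inferInstanceAs (NormedAddCommGroup (∀ i : s, BoundedContinuousFunction E (E [×i.1.2]→L[ℝ] ℂ)))

noncomputable instance (s : Finset (ℕ × ℕ)) : NormedSpace ℂ (JetSpace E s) :=
  inferInstanceAs (NormedSpace ℂ (∀ i : s, BoundedContinuousFunction E (E [×i.1.2]→L[ℝ] ℂ)))

instance (s : Finset (ℕ × ℕ)) : CompleteSpace (JetSpace E s) :=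
  inferInstanceAs (CompleteSpace (∀ i : s, BoundedContinuousFunction E (E [×i.1.2]→L[ℝ] ℂ)))

/-- The value at `x` and `m` of the component of index `i`. -/
noncomputable def JetSpace.eval (s : Finset (ℕ × ℕ)) (i : s) (x : E) (m : Fin i.1.2 → E) :
    JetSpace E s →L[ℂ] ℂ :=
  LinearMap.mkContinuous
    { toFun := fun b => b i x m
      map_add' := fun _ _ => rfl
      map_smul' := fun _ _ => rfl } (∏ j, ‖m j‖) fun b => by
    rw [mul_comm]
    refine ((b i x).le_opNorm m).trans ?_
    gcongr
    exact ((b i).norm_coe_le_norm x).trans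
      (norm_le_pi_norm (show ∀ i : s, BoundedContinuousFunction E (E [×i.1.2]→L[ℝ] ℂ) from b) i)

theorem JetSpace.ext {s : Finset (ℕ × ℕ)} {b c : JetSpace E s}
    (h : ∀ i x m, JetSpace.eval s i x m b = JetSpace.eval s i x m c) : b = c :=
  funext fun i => BoundedContinuousFunction.ext fun x =>
    ContinuousMultilinearMap.ext fun m => h i x m

/-- The weighted jets of a Schwartz function. -/
noncomputable def jetCLM (s : Finset (ℕ × ℕ)) : 𝓢(E, ℂ) →L[ℂ] JetSpace E s :=
  ContinuousLinearMap.pi fun i : s => weightedDerivBCF i.1.1 i.1.2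

theorem eval_jetCLM (s : Finset (ℕ × ℕ)) (i : s) (x : E) (m : Fin i.1.2 → E) (Φ : 𝓢(E, ℂ)) :
    JetSpace.eval s i x m (jetCLM s Φ) = ‖x‖ ^ i.1.1 • iteratedFDeriv ℝ i.1.2 Φ x m := rfl

theorem seminorm_le_norm_jetCLM (s : Finset (ℕ × ℕ)) (i : s) (Φ : 𝓢(E, ℂ)) :
    SchwartzMap.seminorm ℂ i.1.1 i.1.2 Φ ≤ ‖jetCLM s Φ‖ := by
  rw [← norm_weightedDerivBCF]
  exact norm_le_pi_norm (fun i : s => weightedDerivBCF i.1.1 i.1.2 Φ) i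

theorem norm_jetCLM_le (s : Finset (ℕ × ℕ)) (Φ : 𝓢(E, ℂ)) :
    ‖jetCLM s Φ‖ ≤ ∑ i ∈ s, SchwartzMap.seminorm ℂ i.1 i.2 Φ := by
  refine (pi_norm_le_iff_of_nonneg (Finset.sum_nonneg fun _ _ => apply_nonneg _ _)).2 fun i => ?_
  refine (norm_weightedDeriv_le i.1.1 i.1.2 Φ).trans ?_
  exact Finset.single_le_sum (f := fun i : ℕ × ℕ => SchwartzMap.seminorm ℂ i.1 i.2 Φ)
    (fun _ _ => apply_nonneg _ _) i.2

/-- A tempered distribution may be applied under the integral sign to a continuous family of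
Schwartz functions whose seminorms are integrable. The functional factors through a Banach space
of bounded continuous functions, where the Bochner integral is available. -/
theorem functional_integral [SecondCountableTopology Y] (f : 𝓢(E, ℂ) →L[ℂ] ℂ)
    {Φ : Y → 𝓢(E, ℂ)} (hc : Continuous Φ)
    (hint : ∀ k n, Integrable (fun y => SchwartzMap.seminorm ℂ k n (Φ y)) μ) {Θ : 𝓢(E, ℂ)}
    (hΘ : ∀ t, Θ t = ∫ y, Φ y t ∂μ) :
    f Θ = ∫ y, f (Φ y) ∂μ := by
  obtain ⟨s₀, C, hC, hb₀⟩ := exists_bound_of_functional f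
  -- the seminorm of index `(0, 0)` makes the map into the jet space injective
  let s := insert (0, 0) s₀
  have hb : ∀ Φ, ‖f Φ‖ ≤ C * ∑ i ∈ s, SchwartzMap.seminorm ℂ i.1 i.2 Φ := fun Φ =>
    (hb₀ Φ).trans (mul_le_mul_of_nonneg_left (Finset.sum_le_sum_of_subset_of_nonneg
      (Finset.subset_insert _ _) fun _ _ _ => apply_nonneg _ _) hC)
  have hLi : Function.Injective (jetCLM (E := E) s) := by
    intro Φ Ψ h
    ext x
    have h0 := congrArg (JetSpace.eval s ⟨(0, 0), Finset.mem_insert_self _ _⟩ x 0) h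
    rw [eval_jetCLM, eval_jetCLM] at h0
    simpa using h0
  obtain ⟨ℓ, hfac⟩ := exists_factor_of_bound f (jetCLM s) hLi (C * s.card) fun Φ => by
    refine (hb Φ).trans ?_
    rw [mul_assoc]
    refine mul_le_mul_of_nonneg_left ?_ hC
    rw [← nsmul_eq_mul]
    exact Finset.sum_le_card_nsmul _ _ _ fun i hi => seminorm_le_norm_jetCLM s ⟨i, hi⟩ Φ
  have hLint : Integrable (fun y => jetCLM s (Φ y)) μ :=
    Integrable.mono' (g := fun y => ∑ i ∈ s, SchwartzMap.seminorm ℂ i.1 i.2 (Φ y))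
      (integrable_finsetSum _ fun i _ => hint i.1 i.2)
      ((jetCLM s).continuous.comp hc).aestronglyMeasurable
      (Filter.Eventually.of_forall fun y => norm_jetCLM_le s (Φ y))
  have hL : jetCLM s Θ = ∫ y, jetCLM s (Φ y) ∂μ := by
    refine JetSpace.ext fun i x m => ?_
    rw [← (JetSpace.eval s i x m).integral_comp_comm hLint]
    simp only [eval_jetCLM]
    rw [integral_smul, iteratedFDeriv_integral hc hint hΘ i.1.2 x]
  rw [hfac, hL, ← ℓ.integral_comp_comm hLint]
  simp only [hfac]

end Exchange

open Filter Topology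

/-! ### Translations of Schwartz functions -/

section Translation

variable {E : Type*} [NormedAddCommGroup E] [NormedSpace ℝ E]

theorem pow_norm_mul_iteratedFDeriv_le (ψ : 𝓢(E, ℂ)) (k n : ℕ) (x y : E) :
    ‖x‖ ^ k * ‖iteratedFDeriv ℝ n ψ y‖ ≤
      2 ^ k * (SchwartzMap.seminorm ℂ k n ψ + ‖x - y‖ ^ k * SchwartzMap.seminorm ℂ 0 n ψ) := by
  have h1 : ‖x‖ ^ k ≤ 2 ^ k * (‖y‖ ^ k + ‖x - y‖ ^ k) := by
    have h2 : ‖x‖ ≤ 2 * max ‖y‖ ‖x - y‖ := by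
      have := norm_add_le y (x - y)
      rw [add_sub_cancel] at this
      have := le_max_left ‖y‖ ‖x - y‖
      have := le_max_right ‖y‖ ‖x - y‖
      linarith
    calc ‖x‖ ^ k ≤ (2 * max ‖y‖ ‖x - y‖) ^ k := by gcongr
      _ = 2 ^ k * max ‖y‖ ‖x - y‖ ^ k := mul_pow _ _ _
      _ ≤ _ := by
        gcongr
        rcases max_cases ‖y‖ ‖x - y‖ with h | h
        · rw [h.1]; linarith [pow_nonneg (norm_nonneg (x - y)) k]
        · rw [h.1]; linarith [pow_nonneg (norm_nonneg y) k]
  have h3 := ψ.le_seminorm ℂ k n y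
  have h4 := ψ.norm_iteratedFDeriv_le_seminorm ℂ n y
  calc ‖x‖ ^ k * ‖iteratedFDeriv ℝ n ψ y‖
      ≤ 2 ^ k * (‖y‖ ^ k + ‖x - y‖ ^ k) * ‖iteratedFDeriv ℝ n ψ y‖ := by gcongr
    _ = 2 ^ k * (‖y‖ ^ k * ‖iteratedFDeriv ℝ n ψ y‖ +
        ‖x - y‖ ^ k * ‖iteratedFDeriv ℝ n ψ y‖) := by ring
    _ ≤ _ := by gcongr

theorem iteratedFDeriv_compSubConstCLM (a : E) (ψ : 𝓢(E, ℂ)) (n : ℕ) (x : E) :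
    iteratedFDeriv ℝ n (SchwartzMap.compSubConstCLM ℂ a ψ) x = iteratedFDeriv ℝ n ψ (x - a) := by
  have h : (SchwartzMap.compSubConstCLM ℂ a ψ : E → ℂ) = fun x => ψ (x - a) := by
    ext x; simp
  rw [h, iteratedFDeriv_comp_sub]

theorem seminorm_compSubConstCLM_le (a : E) (ψ : 𝓢(E, ℂ)) (k n : ℕ) :
    SchwartzMap.seminorm ℂ k n (SchwartzMap.compSubConstCLM ℂ a ψ) ≤
      2 ^ k * (SchwartzMap.seminorm ℂ k n ψ + ‖a‖ ^ k * SchwartzMap.seminorm ℂ 0 n ψ) := by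
  refine SchwartzMap.seminorm_le_bound ℂ k n _ (by positivity) fun x => ?_
  rw [iteratedFDeriv_compSubConstCLM]
  simpa using pow_norm_mul_iteratedFDeriv_le ψ k n x (x - a)

theorem seminorm_compSubConstCLM_sub_le (a : E) (ψ : 𝓢(E, ℂ)) (k n : ℕ) :
    SchwartzMap.seminorm ℂ k n (SchwartzMap.compSubConstCLM ℂ a ψ - ψ) ≤
      2 ^ k * (SchwartzMap.seminorm ℂ k (n + 1) ψ +
        ‖a‖ ^ k * SchwartzMap.seminorm ℂ 0 (n + 1) ψ) * ‖a‖ := by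
  refine SchwartzMap.seminorm_le_bound ℂ k n _ (by positivity) fun x => ?_
  have h0 : iteratedFDeriv ℝ n (SchwartzMap.compSubConstCLM ℂ a ψ - ψ) x =
      iteratedFDeriv ℝ n ψ (x - a) - iteratedFDeriv ℝ n ψ x := by
    rw [← iteratedFDeriv_compSubConstCLM]
    exact iteratedFDeriv_sub_apply ((SchwartzMap.compSubConstCLM ℂ a ψ).smooth n).contDiffAt
      (ψ.smooth n).contDiffAt
  rw [h0]
  set B := 2 ^ k * (SchwartzMap.seminorm ℂ k (n + 1) ψ +
    ‖a‖ ^ k * SchwartzMap.seminorm ℂ 0 (n + 1) ψ) with hB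
  rcases (pow_nonneg (norm_nonneg x) k).eq_or_lt with hx | hx
  · rw [← hx, zero_mul]; positivity
  have hd : ∀ y ∈ segment ℝ x (x - a), DifferentiableAt ℝ (fun y => iteratedFDeriv ℝ n ψ y) y :=
    fun y _ => ((ψ.smooth ⊤).differentiable_iteratedFDeriv (mod_cast ENat.natCast_lt_top n)) y
  have hb : ∀ y ∈ segment ℝ x (x - a),
      ‖fderiv ℝ (fun y => iteratedFDeriv ℝ n ψ y) y‖ ≤ B / ‖x‖ ^ k := by
    intro y hy
    rw [le_div_iff₀' hx, norm_fderiv_iteratedFDeriv]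
    refine (pow_norm_mul_iteratedFDeriv_le ψ k (n + 1) x y).trans ?_
    have : ‖x - y‖ ≤ ‖a‖ := by
      rw [segment_eq_image'] at hy
      obtain ⟨θ, hθ, rfl⟩ := hy
      have h1 : x - (x + θ • (x - a - x)) = θ • a := by module
      rw [h1, norm_smul, Real.norm_of_nonneg hθ.1]
      exact mul_le_of_le_one_left (norm_nonneg _) hθ.2
    rw [hB]
    gcongr
  have h := Convex.norm_image_sub_le_of_norm_fderiv_le (𝕜 := ℝ) hd hb (convex_segment x (x - a))
    (left_mem_segment ℝ _ _) (right_mem_segment ℝ _ _)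
  rw [sub_sub_cancel_left, norm_neg, div_mul_eq_mul_div, le_div_iff₀' hx] at h
  exact h

/-- Translation is jointly continuous on `E × 𝓢(E)`. -/
theorem continuous_translation :
    Continuous fun p : E × 𝓢(E, ℂ) => SchwartzMap.compSubConstCLM ℂ p.1 p.2 := by
  rw [continuous_iff_continuousAt]
  rintro ⟨a, ψ⟩
  refine ((schwartz_withSeminorms ℂ E ℂ).tendsto_nhds _ _).2 ?_
  rintro ⟨k, n⟩ ε hε
  -- the difference splits into a translate of `p.2 - ψ` and a translate of `T_{p.1 - a} ψ - ψ`
  have hsplit : ∀ p : E × 𝓢(E, ℂ), SchwartzMap.compSubConstCLM ℂ p.1 p.2 -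
      SchwartzMap.compSubConstCLM ℂ a ψ = SchwartzMap.compSubConstCLM ℂ p.1 (p.2 - ψ) +
        (SchwartzMap.compSubConstCLM ℂ (p.1 - a) (SchwartzMap.compSubConstCLM ℂ a ψ) -
          SchwartzMap.compSubConstCLM ℂ a ψ) := by
    intro p
    ext x
    simp
  set χ := SchwartzMap.compSubConstCLM ℂ a ψ with hχ
  let B : E × 𝓢(E, ℂ) → ℝ := fun p =>
    2 ^ k * (SchwartzMap.seminorm ℂ k n (p.2 - ψ) +
      ‖p.1‖ ^ k * SchwartzMap.seminorm ℂ 0 n (p.2 - ψ)) +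
    2 ^ k * (SchwartzMap.seminorm ℂ k (n + 1) χ +
        ‖p.1 - a‖ ^ k * SchwartzMap.seminorm ℂ 0 (n + 1) χ) * ‖p.1 - a‖
  have hB : Continuous B := by
    have h1 : ∀ k n, Continuous fun p : E × 𝓢(E, ℂ) => SchwartzMap.seminorm ℂ k n (p.2 - ψ) :=
      fun k n => (continuous_seminorm k n).comp (continuous_snd.sub continuous_const)
    have := h1 k n
    have := h1 0 n
    fun_prop
  have hB0 : B (a, ψ) = 0 := by simp [B]
  have hev : ∀ᶠ p in 𝓝 (a, ψ), B p < ε := by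
    have := hB.continuousAt (x := (a, ψ))
    rw [ContinuousAt, hB0] at this
    exact this.eventually_lt_const hε
  filter_upwards [hev] with p hp
  refine lt_of_le_of_lt ?_ hp
  change SchwartzMap.seminorm ℂ k n _ ≤ _
  rw [hsplit]
  exact (map_add_le_add _ _ _).trans
    (add_le_add (seminorm_compSubConstCLM_le _ _ k n) (seminorm_compSubConstCLM_sub_le _ _ k n))

end Translation

/-! ### Time-frequency shifts of Schwartz functions -/

section TimeFrequency

variable {ι : Type*} [Fintype ι]

theorem cexp_I_two_pi (r : ℝ) :
    Complex.exp (Complex.I * ((2 * Real.pi * r : ℝ) : ℂ)) = (𝐞 r : ℂ) := by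
  rw [Real.fourierChar_apply]
  congr 1
  ring

theorem tfShift_apply' (z : Eu (ι ⊕ ι)) (f : 𝓢(Eu ι, ℂ)) (t : Eu ι) :
    tfShift z f t = (𝐞 (inner ℝ (sndPart z) t) : ℂ) * f (t - fstPart z) := by
  rw [tfShift_apply, cexp_I_two_pi]

theorem norm_tfShift_apply (z : Eu (ι ⊕ ι)) (f : 𝓢(Eu ι, ℂ)) (t : Eu ι) :
    ‖tfShift z f t‖ = ‖f (t - fstPart z)‖ := by
  rw [tfShift_apply', norm_mul, Circle.norm_coe, one_mul]

theorem fourier_tfShift_apply (z : Eu (ι ⊕ ι)) (f : 𝓢(Eu ι, ℂ)) (ξ : Eu ι) :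
    𝓕 (tfShift z f) ξ = (𝐞 (inner ℝ (fstPart z) (sndPart z - ξ)) : ℂ) *
      𝓕 f (ξ - sndPart z) := by
  rw [SchwartzMap.fourier_coe, SchwartzMap.fourier_coe, Real.fourier_eq, Real.fourier_eq]
  rw [← integral_const_mul]
  refine Eq.trans ?_ (integral_sub_right_eq_self _ (fstPart z))
  congr 1
  ext t
  rw [tfShift_apply', Circle.smul_def, Circle.smul_def, smul_eq_mul, smul_eq_mul, ← mul_assoc,
    ← mul_assoc, ← Circle.coe_mul, ← Circle.coe_mul, ← AddChar.map_add_eq_mul,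
    ← AddChar.map_add_eq_mul]
  congr 3
  simp only [inner_sub_left, inner_sub_right]
  rw [real_inner_comm t (sndPart z)]
  have := real_inner_comm (fstPart z) (sndPart z)
  linarith

/-- A modulation is a translation on the Fourier side. -/
theorem tfShift_eq_fourierInv (z : Eu (ι ⊕ ι)) (f : 𝓢(Eu ι, ℂ)) :
    tfShift z f = 𝓕⁻ (SchwartzMap.compSubConstCLM ℂ (sndPart z)
      (𝓕 (SchwartzMap.compSubConstCLM ℂ (fstPart z) f))) := by
  have h : 𝓕 (tfShift z f) = SchwartzMap.compSubConstCLM ℂ (sndPart z)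
      (𝓕 (SchwartzMap.compSubConstCLM ℂ (fstPart z) f)) := by
    have h0 : SchwartzMap.compSubConstCLM ℂ (fstPart z) f = tfShift (joinPair (fstPart z) 0) f := by
      ext t
      simp [tfShift_apply']
    ext ξ
    rw [h0, SchwartzMap.compSubConstCLM_apply, fourier_tfShift_apply, fourier_tfShift_apply]
    simp
  rw [← h, FourierTransform.fourierInv_fourier_eq]

theorem continuous_tfShift (φ : 𝓢(Eu ι, ℂ)) :
    Continuous fun z : Eu (ι ⊕ ι) => tfShift z φ := by
  simp_rw [tfShift_eq_fourierInv]
  have h1 : Continuous fun ψ : 𝓢(Eu ι, ℂ) => 𝓕 ψ :=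
    (FourierTransform.fourierCLM ℂ 𝓢(Eu ι, ℂ)).continuous
  have h2 : Continuous fun ψ : 𝓢(Eu ι, ℂ) => 𝓕⁻ ψ :=
    (FourierTransform.fourierInvCLM ℂ 𝓢(Eu ι, ℂ)).continuous
  have h3 : Continuous fun z : Eu (ι ⊕ ι) => SchwartzMap.compSubConstCLM ℂ (fstPart z) φ :=
    Continuous.comp (f := fun z : Eu (ι ⊕ ι) => (fstPart z, φ)) continuous_translation
      (Continuous.prodMk (by fun_prop) continuous_const)
  have h4 : Continuous fun z : Eu (ι ⊕ ι) => 𝓕 (SchwartzMap.compSubConstCLM ℂ (fstPart z) φ) :=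
    h1.comp h3
  have h5 : Continuous fun z : Eu (ι ⊕ ι) => SchwartzMap.compSubConstCLM ℂ (sndPart z)
      (𝓕 (SchwartzMap.compSubConstCLM ℂ (fstPart z) φ)) :=
    Continuous.comp (f := fun z : Eu (ι ⊕ ι) => (sndPart z,
      𝓕 (SchwartzMap.compSubConstCLM ℂ (fstPart z) φ))) continuous_translation
      (Continuous.prodMk (by fun_prop) h4)
  exact h2.comp h5

theorem exists_seminorm_clm_compSubConstCLM_le (A : 𝓢(Eu ι, ℂ) →L[ℂ] 𝓢(Eu ι, ℂ)) (k n : ℕ) :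
    ∃ (s : Finset (ℕ × ℕ)) (C : ℝ) (m : ℕ), 0 ≤ C ∧
      ∀ a φ, SchwartzMap.seminorm ℂ k n (A (SchwartzMap.compSubConstCLM ℂ a φ)) ≤
        C * (1 + ‖a‖) ^ m * ∑ i ∈ s, SchwartzMap.seminorm ℂ i.1 i.2 φ := by
  obtain ⟨s, C, hC, hb⟩ := exists_seminorm_clm_le A k n
  let m := s.sup fun i => i.1
  let s' := s ∪ s.image fun i => (0, i.2)
  have hs' : ∀ j ∈ s', ∀ φ : 𝓢(Eu ι, ℂ), SchwartzMap.seminorm ℂ j.1 j.2 φ ≤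
      ∑ i ∈ s', SchwartzMap.seminorm ℂ i.1 i.2 φ := fun j hj φ =>
    Finset.single_le_sum (f := fun i : ℕ × ℕ => SchwartzMap.seminorm ℂ i.1 i.2 φ)
      (fun _ _ => apply_nonneg _ _) hj
  refine ⟨s', C * (s.card * (2 ^ m * 2)), m, by positivity, fun a φ => (hb _).trans ?_⟩
  set S := ∑ i ∈ s', SchwartzMap.seminorm ℂ i.1 i.2 φ
  have hS : 0 ≤ S := Finset.sum_nonneg fun _ _ => apply_nonneg _ _
  have hterm : ∀ i ∈ s, SchwartzMap.seminorm ℂ i.1 i.2 (SchwartzMap.compSubConstCLM ℂ a φ) ≤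
      2 ^ m * 2 * (1 + ‖a‖) ^ m * S := by
    intro i hi
    have him : i.1 ≤ m := Finset.le_sup (f := fun i : ℕ × ℕ => i.1) hi
    refine (seminorm_compSubConstCLM_le a φ i.1 i.2).trans ?_
    have h1 := hs' i (Finset.mem_union_left _ hi) φ
    have h2 := hs' (0, i.2) (Finset.mem_union_right _ (Finset.mem_image_of_mem _ hi)) φ
    have h3 : (2 : ℝ) ^ i.1 ≤ 2 ^ m := pow_le_pow_right₀ one_le_two him
    have ha : 1 ≤ 1 + ‖a‖ := by linarith [norm_nonneg a]
    have h4 : ‖a‖ ^ i.1 ≤ (1 + ‖a‖) ^ m :=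
      (pow_le_pow_left₀ (norm_nonneg a) (by linarith) _).trans (pow_le_pow_right₀ ha him)
    have h5 : 1 ≤ (1 + ‖a‖) ^ m := one_le_pow₀ ha
    calc _ ≤ 2 ^ m * (1 * S + (1 + ‖a‖) ^ m * S) := by rw [one_mul]; gcongr
      _ ≤ 2 ^ m * ((1 + ‖a‖) ^ m * S + (1 + ‖a‖) ^ m * S) := by gcongr
      _ = _ := by ring
  have := Finset.sum_le_card_nsmul s _ _ hterm
  rw [nsmul_eq_mul] at this
  calc _ ≤ C * (s.card * (2 ^ m * 2 * (1 + ‖a‖) ^ m * S)) := by gcongr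
    _ = _ := by ring

/-- The seminorms of a time-frequency shift grow polynomially in the shift. -/
theorem exists_seminorm_tfShift_le (φ : 𝓢(Eu ι, ℂ)) (k n : ℕ) :
    ∃ (C : ℝ) (m : ℕ), 0 ≤ C ∧
      ∀ z, SchwartzMap.seminorm ℂ k n (tfShift z φ) ≤ C * (1 + ‖z‖) ^ m := by
  obtain ⟨s, C, m, hC, hb⟩ := exists_seminorm_clm_compSubConstCLM_le
    (FourierTransform.fourierInvCLM ℂ 𝓢(Eu ι, ℂ)) k n
  choose s' C' m' hC' hb' using fun i : ℕ × ℕ => exists_seminorm_clm_compSubConstCLM_le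
    (FourierTransform.fourierCLM ℂ 𝓢(Eu ι, ℂ)) i.1 i.2
  let M := s.sup m'
  let K : ℕ × ℕ → ℝ := fun i => C' i * ∑ j ∈ s' i, SchwartzMap.seminorm ℂ j.1 j.2 φ
  have hK : ∀ i, 0 ≤ K i := fun i =>
    mul_nonneg (hC' i) (Finset.sum_nonneg fun _ _ => apply_nonneg _ _)
  refine ⟨C * ∑ i ∈ s, K i, m + M, mul_nonneg hC (Finset.sum_nonneg fun i _ => hK i),
    fun z => ?_⟩
  rw [tfShift_eq_fourierInv]
  refine (hb (sndPart z) _).trans ?_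
  have hz1 : (1 : ℝ) ≤ 1 + ‖z‖ := by linarith [norm_nonneg z]
  have h1 : ∀ i ∈ s, SchwartzMap.seminorm ℂ i.1 i.2
      (𝓕 (SchwartzMap.compSubConstCLM ℂ (fstPart z) φ)) ≤ (1 + ‖z‖) ^ M * K i := by
    intro i hi
    refine (hb' i (fstPart z) φ).trans ?_
    rw [mul_right_comm, mul_comm]
    refine mul_le_mul_of_nonneg_right ?_ (hK i)
    have h3 : (1 + ‖fstPart z‖) ^ m' i ≤ (1 + ‖z‖) ^ m' i := by
      gcongr; exact norm_fstPart_le z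
    exact h3.trans (pow_le_pow_right₀ hz1 (Finset.le_sup hi))
  calc _ ≤ C * (1 + ‖z‖) ^ m * ∑ i ∈ s, (1 + ‖z‖) ^ M * K i := by
        have := norm_sndPart_le z
        have := Finset.sum_le_sum h1
        gcongr
    _ = _ := by rw [← Finset.mul_sum, pow_add]; ring

end TimeFrequency

/-! ### Polynomial weights -/

section Weights

variable {ι κ : Type*} [Fintype ι] [Fintype κ]

theorem weight_pos (s : ℝ) (z : Eu ι) : 0 < weight s z := by
  unfold weight; positivity

theorem weight_nonneg (s : ℝ) (z : Eu ι) : 0 ≤ weight s z := (weight_pos s z).le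

theorem weight_add (s t : ℝ) (z : Eu ι) : weight (s + t) z = weight s z * weight t z := by
  unfold weight
  rw [← Real.rpow_add (by positivity), add_div]

@[simp] theorem weight_zero (z : Eu ι) : weight 0 z = 1 := by simp [weight]

theorem weight_neg (s : ℝ) (z : Eu ι) : weight (-s) z = (weight s z)⁻¹ := by
  unfold weight
  rw [neg_div, Real.rpow_neg (by positivity)]

theorem weight_mono {s t : ℝ} (h : s ≤ t) (z : Eu ι) : weight s z ≤ weight t z := by
  unfold weight
  exact Real.rpow_le_rpow_of_exponent_le (by nlinarith [sq_nonneg ‖z‖]) (by linarith)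

theorem continuous_weight (s : ℝ) : Continuous (weight s : Eu ι → ℝ) := by
  unfold weight
  exact (by fun_prop : Continuous fun z : Eu ι => 1 + ‖z‖ ^ 2).rpow_const
    fun z => Or.inl (by positivity)

theorem weight_rpow (s p : ℝ) (z : Eu ι) : weight s z ^ p = weight (s * p) z := by
  unfold weight
  rw [← Real.rpow_mul (by positivity)]
  congr 1; ring

theorem weight_comp_neg (s : ℝ) (z : Eu ι) : weight s (-z) = weight s z := by simp [weight]

/-- A weight of non-negative order is monotone in `1 + ‖z‖²`, up to constants. -/
theorem weight_le_of_le {s : ℝ} (hs : 0 ≤ s) {C : ℝ} (hC : 0 ≤ C) {z : Eu ι} {w : Eu κ}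
    (h : 1 + ‖z‖ ^ 2 ≤ C * (1 + ‖w‖ ^ 2)) : weight s z ≤ C ^ (s / 2) * weight s w := by
  unfold weight
  rw [← Real.mul_rpow hC (by positivity)]
  exact Real.rpow_le_rpow (by positivity) h (by positivity)

theorem one_add_norm_sq_le (x y : Eu ι) :
    1 + ‖x‖ ^ 2 ≤ 2 * (1 + ‖x - y‖ ^ 2) * (1 + ‖y‖ ^ 2) := by
  have h1 : ‖x‖ ≤ ‖x - y‖ + ‖y‖ := norm_le_norm_sub_add x y
  have h2 : ‖x‖ ^ 2 ≤ (‖x - y‖ + ‖y‖) ^ 2 := by gcongr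
  nlinarith [sq_nonneg (‖x - y‖ - ‖y‖), mul_nonneg (sq_nonneg ‖x - y‖) (sq_nonneg ‖y‖)]

/-- Peetre's inequality: the weight of order `s` is moderate. -/
theorem weight_le_mul (s : ℝ) (x y : Eu ι) :
    weight s x ≤ 2 ^ (|s| / 2) * weight |s| (x - y) * weight s y := by
  have key : ∀ {s : ℝ}, 0 ≤ s → ∀ x y : Eu ι,
      weight s x ≤ 2 ^ (s / 2) * weight s (x - y) * weight s y := by
    intro s hs x y
    unfold weight
    rw [← Real.mul_rpow (by positivity) (by positivity),
      ← Real.mul_rpow (by positivity) (by positivity)]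
    exact Real.rpow_le_rpow (by positivity) (one_add_norm_sq_le x y) (by positivity)
  rcases le_total 0 s with hs | hs
  · simpa only [abs_of_nonneg hs] using key hs x y
  · have h := key (neg_nonneg.2 hs) y x
    rw [← weight_comp_neg _ (y - x), neg_sub, weight_neg s y, weight_neg s x] at h
    rw [abs_of_nonpos hs]
    have hx := weight_pos s x
    have hy := weight_pos s y
    rw [← div_eq_mul_inv, le_div_iff₀ hx] at h
    calc weight s x = (weight s y)⁻¹ * weight s x * weight s y := by field_simp
      _ ≤ _ := by gcongr

theorem exists_weight_clm_le {s : ℝ} (hs : 0 ≤ s) (L : Eu ι →L[ℝ] Eu κ) :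
    ∃ C, 0 < C ∧ ∀ z, weight s (L z) ≤ C * weight s z := by
  refine ⟨(1 + ‖L‖ ^ 2) ^ (s / 2), by positivity, fun z => weight_le_of_le hs (by positivity) ?_⟩
  have h : ‖L z‖ ^ 2 ≤ (‖L‖ * ‖z‖) ^ 2 := by gcongr; exact L.le_opNorm z
  nlinarith [sq_nonneg ‖z‖, sq_nonneg ‖L‖]

theorem integrable_weight {N : ℝ} (hN : Fintype.card ι < N) :
    Integrable (weight (-N) : Eu ι → ℝ) := by
  have := integrable_rpow_neg_one_add_norm_sq (E := Eu ι) (μ := volume) (r := N) (by simpa using hN)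
  exact this

theorem one_add_norm_pow_le_weight (m : ℕ) (z : Eu ι) :
    (1 + ‖z‖) ^ m ≤ 2 ^ ((m : ℝ) / 2) * weight m z := by
  have h : (1 + ‖z‖) ^ m = ((1 + ‖z‖) ^ 2) ^ ((m : ℝ) / 2) := by
    rw [← Real.rpow_natCast _ 2, ← Real.rpow_mul (by positivity), ← Real.rpow_natCast]
    congr 1; push_cast; ring
  rw [h]
  unfold weight
  rw [← Real.mul_rpow (by positivity) (by positivity)]
  exact Real.rpow_le_rpow (by positivity) (by nlinarith [sq_nonneg (1 - ‖z‖)]) (by positivity)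

theorem weight_natCast_le (m : ℕ) (z : Eu ι) : weight m z ≤ (1 + ‖z‖) ^ m := by
  have h : (1 + ‖z‖) ^ m = ((1 + ‖z‖) ^ 2) ^ ((m : ℝ) / 2) := by
    rw [← Real.rpow_natCast _ 2, ← Real.rpow_mul (by positivity), ← Real.rpow_natCast]
    congr 1; push_cast; ring
  rw [h]
  unfold weight
  exact Real.rpow_le_rpow (by positivity) (by nlinarith [norm_nonneg z]) (by positivity)

theorem exists_norm_le_weight (φ : 𝓢(Eu ι, ℂ)) (N : ℝ) :
    ∃ C, 0 ≤ C ∧ ∀ t, ‖φ t‖ ≤ C * weight (-N) t := by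
  obtain ⟨m, hm⟩ := exists_nat_ge N
  refine ⟨2 ^ m * (Finset.Iic (m, 0)).sup (schwartzSeminormFamily ℂ (Eu ι) ℂ) φ,
    by positivity, fun t => ?_⟩
  have h := SchwartzMap.one_add_le_sup_seminorm_apply (𝕜 := ℂ) (m := (m, 0)) (k := m) (n := 0)
    le_rfl le_rfl φ t
  rw [norm_iteratedFDeriv_zero] at h
  rw [weight_neg, ← div_eq_mul_inv, le_div_iff₀ (weight_pos _ _), mul_comm]
  refine le_trans ?_ h
  gcongr
  exact (weight_mono hm t).trans (weight_natCast_le m t)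

end Weights

/-! ### The sesquilinear pairing of Schwartz functions -/

section Pairing

variable {ι : Type*} [Fintype ι]

/-- The `L²` pairing `⟨f, g⟩` of Schwartz functions, conjugate-linear in the second slot. -/
noncomputable def sPair (f g : 𝓢(Eu ι, ℂ)) : ℂ := ∫ t, f t * conj (g t)

theorem integrable_mul_conj (f g : 𝓢(Eu ι, ℂ)) : Integrable fun t => f t * conj (g t) := by
  obtain ⟨C, hC⟩ : ∃ C, ∀ z, ‖g z‖ ≤ C := ⟨_, fun z => SchwartzMap.norm_le_seminorm ℝ g z⟩
  refine (f.integrable.norm.const_mul C).mono' (f.continuous.mul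
    (Complex.continuous_conj.comp g.continuous)).aestronglyMeasurable
    (Eventually.of_forall fun t => ?_)
  rw [norm_mul, RCLike.norm_conj, mul_comm]
  exact mul_le_mul_of_nonneg_right (hC t) (norm_nonneg _)

theorem conj_sPair (f g : 𝓢(Eu ι, ℂ)) : conj (sPair f g) = sPair g f := by
  unfold sPair
  rw [← integral_conj]
  congr 1; ext t; simp [mul_comm]

theorem norm_sPair_comm (f g : 𝓢(Eu ι, ℂ)) : ‖sPair f g‖ = ‖sPair g f‖ := by
  rw [← conj_sPair, RCLike.norm_conj]

theorem sPair_smul_right (f g : 𝓢(Eu ι, ℂ)) (c : ℂ) : sPair f (c • g) = conj c * sPair f g := by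
  unfold sPair
  rw [← integral_const_mul]
  congr 1; ext t; simp; ring

theorem sPair_smul_left (f g : 𝓢(Eu ι, ℂ)) (c : ℂ) : sPair (c • f) g = c * sPair f g := by
  unfold sPair
  rw [← integral_const_mul]
  congr 1; ext t; simp; ring

theorem sPair_fourier (f g : 𝓢(Eu ι, ℂ)) : sPair (𝓕 f) (𝓕 g) = sPair f g := by
  have h := SchwartzMap.integral_inner_fourier_fourier g f
  simpa [sPair, RCLike.inner_apply, mul_comm] using h

theorem sPair_self (f : 𝓢(Eu ι, ℂ)) : sPair f f = ((∫ t, ‖f t‖ ^ 2 : ℝ) : ℂ) := by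
  unfold sPair
  rw [← integral_complex_ofReal]
  congr 1; ext t
  rw [Complex.mul_conj, Complex.normSq_eq_norm_sq]

theorem sPair_self_ne_zero {f : 𝓢(Eu ι, ℂ)} (hf : f ≠ 0) : sPair f f ≠ 0 := by
  rw [sPair_self, Complex.ofReal_ne_zero]
  intro h
  apply hf
  ext t
  have hint : Integrable fun t => ‖f t‖ ^ 2 := by
    have := (integrable_mul_conj f f).norm
    simpa [pow_two] using this
  have hc : Continuous fun t => ‖f t‖ ^ 2 := f.continuous.norm.pow 2
  have h1 := (integral_eq_zero_iff_of_nonneg (fun t => by positivity) hint).1 h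
  have h2 := (Continuous.ae_eq_iff_eq volume hc continuous_const).1 h1
  have h3 : ‖f t‖ ^ 2 = 0 := congrFun h2 t
  simpa using h3

theorem fourier_tfShift (z : Eu (ι ⊕ ι)) (f : 𝓢(Eu ι, ℂ)) :
    𝓕 (tfShift z f) = (𝐞 (inner ℝ (fstPart z) (sndPart z)) : ℂ) •
      tfShift (joinPair (sndPart z) (-fstPart z)) (𝓕 f) := by
  ext ξ
  rw [fourier_tfShift_apply, smul_apply, smul_eq_mul, tfShift_apply', ← mul_assoc,
    ← Circle.coe_mul, ← AddChar.map_add_eq_mul]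
  congr 3
  simp [inner_add_right, sub_eq_add_neg]

theorem tfShift_add (a b : Eu (ι ⊕ ι)) (f : 𝓢(Eu ι, ℂ)) :
    tfShift (a + b) f = (𝐞 (inner ℝ (sndPart b) (fstPart a)) : ℂ) • tfShift a (tfShift b f) := by
  ext t
  rw [smul_apply, smul_eq_mul, tfShift_apply', tfShift_apply', tfShift_apply',
    ← mul_assoc, ← mul_assoc, ← Circle.coe_mul, ← Circle.coe_mul, ← AddChar.map_add_eq_mul,
    ← AddChar.map_add_eq_mul]
  congr 2
  · congr 2
    simp [inner_sub_right, inner_add_left]; ring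
  · rw [map_add, sub_add_eq_sub_sub]

theorem sPair_tfShift_tfShift (a : Eu (ι ⊕ ι)) (f g : 𝓢(Eu ι, ℂ)) :
    sPair (tfShift a f) (tfShift a g) = sPair f g := by
  unfold sPair
  refine Eq.trans ?_ (integral_sub_right_eq_self _ (fstPart a))
  congr 1; ext t
  rw [tfShift_apply', tfShift_apply', map_mul, mul_mul_mul_comm, Complex.mul_conj,
    Complex.normSq_eq_norm_sq, Circle.norm_coe]
  simp

theorem norm_sPair_tfShift (a z : Eu (ι ⊕ ι)) (f g : 𝓢(Eu ι, ℂ)) :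
    ‖sPair (tfShift a f) (tfShift z g)‖ = ‖sPair f (tfShift (z - a) g)‖ := by
  have h := tfShift_add a (z - a) g
  rw [add_sub_cancel] at h
  rw [h, sPair_smul_right, sPair_tfShift_tfShift, norm_mul, RCLike.norm_conj, Circle.norm_coe,
    one_mul]

/-- The short-time Fourier transform of a Schwartz function decays rapidly in time. -/
theorem exists_norm_sPair_tfShift_le_fst (f g : 𝓢(Eu ι, ℂ)) (N : ℝ) :
    ∃ C, 0 ≤ C ∧ ∀ z, ‖sPair f (tfShift z g)‖ ≤ C * weight (-N) (fstPart z) := by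
  obtain ⟨C₂, hC₂, h₂⟩ := exists_norm_le_weight g |N|
  obtain ⟨C₁, hC₁, h₁⟩ := exists_norm_le_weight f (|N| + (Fintype.card ι + 1))
  have hi : Integrable (weight (-(Fintype.card ι + 1 : ℝ)) : Eu ι → ℝ) :=
    integrable_weight (by linarith)
  have hI : 0 ≤ ∫ t : Eu ι, weight (-(Fintype.card ι + 1 : ℝ)) t :=
    integral_nonneg fun t => weight_nonneg _ _
  refine ⟨C₁ * C₂ * 2 ^ (|N| / 2) * ∫ t : Eu ι, weight (-(Fintype.card ι + 1 : ℝ)) t,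
    by positivity, fun z => ?_⟩
  have hb : ∀ t, ‖f t * conj (tfShift z g t)‖ ≤ (C₁ * C₂ * 2 ^ (|N| / 2) * weight (-N) (fstPart z))
      * weight (-(Fintype.card ι + 1 : ℝ)) t := by
    intro t
    rw [norm_mul, RCLike.norm_conj, norm_tfShift_apply]
    have h3 : weight (-|N|) (t - fstPart z) * weight (-|N|) t ≤
        2 ^ (|N| / 2) * weight (-N) (fstPart z) := by
      have h := weight_le_mul |N| (fstPart z) t
      rw [abs_abs, ← weight_comp_neg |N| (fstPart z - t), neg_sub] at h
      have h' : weight (-|N|) (fstPart z) ≤ weight (-N) (fstPart z) :=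
        weight_mono (neg_le_neg (le_abs_self N)) _
      refine le_trans ?_ (mul_le_mul_of_nonneg_left h' (by positivity))
      rw [weight_neg, weight_neg, weight_neg, ← mul_inv, ← div_eq_mul_inv,
        le_div_iff₀ (weight_pos _ _), mul_comm, ← div_eq_mul_inv,
        div_le_iff₀ (mul_pos (weight_pos _ _) (weight_pos _ _)), ← mul_assoc]
      exact h
    calc ‖f t‖ * ‖g (t - fstPart z)‖
        ≤ (C₁ * weight (-(|N| + (Fintype.card ι + 1))) t) *
          (C₂ * weight (-|N|) (t - fstPart z)) := by
          have := weight_nonneg (-(|N| + (Fintype.card ι + 1))) t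
          gcongr
          · exact h₁ t
          · exact h₂ _
      _ = C₁ * C₂ * (weight (-|N|) (t - fstPart z) * weight (-|N|) t) *
          weight (-(Fintype.card ι + 1 : ℝ)) t := by
          rw [neg_add, weight_add]; ring
      _ ≤ C₁ * C₂ * (2 ^ (|N| / 2) * weight (-N) (fstPart z)) *
          weight (-(Fintype.card ι + 1 : ℝ)) t := by
          have := weight_nonneg (-(Fintype.card ι + 1 : ℝ)) t
          gcongr
      _ = _ := by ring
  refine (norm_integral_le_of_norm_le (hi.const_mul _) (Eventually.of_forall hb)).trans ?_
  rw [integral_const_mul]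
  apply le_of_eq; ring

/-- The short-time Fourier transform of a Schwartz function decays rapidly; decay in frequency is
decay in time of the Fourier transforms. -/
theorem exists_norm_sPair_tfShift_le (f g : 𝓢(Eu ι, ℂ)) (N : ℝ) :
    ∃ C, 0 ≤ C ∧ ∀ z, ‖sPair f (tfShift z g)‖ ≤ C * weight (-N) z := by
  obtain ⟨C₁, hC₁, h₁⟩ := exists_norm_sPair_tfShift_le_fst f g (2 * |N|)
  obtain ⟨C₂, hC₂, h₂⟩ := exists_norm_sPair_tfShift_le_fst (𝓕 f) (𝓕 g) (2 * |N|)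
  refine ⟨√(C₁ * C₂), Real.sqrt_nonneg _, fun z => ?_⟩
  have h₃ : ‖sPair f (tfShift z g)‖ ≤ C₂ * weight (-(2 * |N|)) (sndPart z) := by
    have h := h₂ (joinPair (sndPart z) (-fstPart z))
    rw [fstPart_joinPair] at h
    rw [← sPair_fourier, fourier_tfShift, sPair_smul_right, norm_mul, RCLike.norm_conj,
      Circle.norm_coe, one_mul]
    exact h
  have hw : weight (-(2 * |N|)) (fstPart z) * weight (-(2 * |N|)) (sndPart z) ≤
      weight (-|N|) z * weight (-|N|) z := by
    have : weight |N| z * weight |N| z ≤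
        weight (2 * |N|) (fstPart z) * weight (2 * |N|) (sndPart z) := by
      rw [← weight_add, ← two_mul]
      unfold weight
      rw [← Real.mul_rpow (by positivity) (by positivity)]
      refine Real.rpow_le_rpow (by positivity) ?_ (by positivity)
      rw [norm_sq_eq_parts]
      nlinarith [mul_nonneg (sq_nonneg ‖fstPart z‖) (sq_nonneg ‖sndPart z‖)]
    simp only [weight_neg, ← mul_inv]
    exact inv_anti₀ (mul_pos (weight_pos _ _) (weight_pos _ _)) this
  have h4 : ‖sPair f (tfShift z g)‖ ≤ √(C₁ * C₂) * weight (-|N|) z := by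
    refine abs_le_of_sq_le_sq' ?_ (mul_nonneg (Real.sqrt_nonneg _) (weight_nonneg _ _)) |>.2
    rw [mul_pow, Real.sq_sqrt (by positivity)]
    calc _ = ‖sPair f (tfShift z g)‖ * ‖sPair f (tfShift z g)‖ := pow_two _
      _ ≤ (C₁ * weight (-(2 * |N|)) (fstPart z)) * (C₂ * weight (-(2 * |N|)) (sndPart z)) := by
          have := weight_nonneg (-(2 * |N|)) (fstPart z)
          exact mul_le_mul (h₁ z) h₃ (norm_nonneg _) (by positivity)
      _ = C₁ * C₂ * (weight (-(2 * |N|)) (fstPart z) * weight (-(2 * |N|)) (sndPart z)) := by ring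
      _ ≤ C₁ * C₂ * (weight (-|N|) z * weight (-|N|) z) := by gcongr
      _ = _ := by ring
  refine h4.trans (mul_le_mul_of_nonneg_left ?_ (Real.sqrt_nonneg _))
  exact weight_mono (neg_le_neg (le_abs_self N)) z

end Pairing

/-! ### Inversion of the short-time Fourier transform and Moyal's identity -/

section Inversion

variable {ι : Type*} [Fintype ι]

theorem continuous_joinPair : Continuous fun p : Eu ι × Eu ι => joinPair p.1 p.2 := by
  exact (EuclideanSpace.sumEquivProd (𝕜 := ℝ) (ι := ι) (κ := ι)).symm.continuous

theorem continuous_joinPair_right (x : Eu ι) : Continuous (joinPair x : Eu ι → Eu (ι ⊕ ι)) :=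
  Continuous.comp (f := fun y : Eu ι => (x, y)) continuous_joinPair (by fun_prop)

theorem conjS_tfShift (z : Eu (ι ⊕ ι)) (φ : 𝓢(Eu ι, ℂ)) :
    conjS (tfShift z φ) = tfShift (joinPair (fstPart z) (-sndPart z)) (conjS φ) := by
  ext t
  rw [conjS_apply, tfShift_apply', tfShift_apply', map_mul, fstPart_joinPair, sndPart_joinPair,
    inner_neg_left, AddChar.map_neg_eq_inv, Circle.coe_inv_eq_conj, conjS_apply]

theorem norm_joinPair_neg (z : Eu (ι ⊕ ι)) : ‖joinPair (fstPart z) (-sndPart z)‖ = ‖z‖ := by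
  have h1 := norm_sq_eq_parts (joinPair (fstPart z) (-sndPart z))
  rw [fstPart_joinPair, sndPart_joinPair, norm_neg, ← norm_sq_eq_parts] at h1
  exact (sq_eq_sq₀ (norm_nonneg _) (norm_nonneg _)).1 h1

theorem continuous_conjS_tfShift (φ : 𝓢(Eu ι, ℂ)) :
    Continuous fun z : Eu (ι ⊕ ι) => conjS (tfShift z φ) :=
  conjS.continuous.comp (continuous_tfShift φ)

theorem continuous_stft (φ : 𝓢(Eu ι, ℂ)) (f : 𝓢'(Eu ι, ℂ)) : Continuous (stft φ f) :=
  (f : 𝓢(Eu ι, ℂ) →L[ℂ] ℂ).continuous.comp (continuous_conjS_tfShift φ)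

theorem exists_seminorm_conjS_tfShift_le (φ : 𝓢(Eu ι, ℂ)) (k n : ℕ) :
    ∃ (C : ℝ) (m : ℕ), 0 ≤ C ∧
      ∀ z, SchwartzMap.seminorm ℂ k n (conjS (tfShift z φ)) ≤ C * weight m z := by
  obtain ⟨C, m, hC, h⟩ := exists_seminorm_tfShift_le (conjS φ) k n
  refine ⟨C * 2 ^ ((m : ℝ) / 2), m, by positivity, fun z => ?_⟩
  rw [conjS_tfShift]
  refine (h _).trans ?_
  rw [norm_joinPair_neg, mul_assoc]
  exact mul_le_mul_of_nonneg_left (one_add_norm_pow_le_weight m z) hC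

/-- The short-time Fourier transform of a tempered distribution grows at most polynomially. -/
theorem exists_norm_stft_le (φ : 𝓢(Eu ι, ℂ)) (f : 𝓢'(Eu ι, ℂ)) :
    ∃ (C : ℝ) (m : ℕ), 0 ≤ C ∧ ∀ z, ‖stft φ f z‖ ≤ C * weight m z := by
  obtain ⟨s, C, hC, hb⟩ := exists_bound_of_functional (f : 𝓢(Eu ι, ℂ) →L[ℂ] ℂ)
  choose C' m' hC' hb' using fun i : ℕ × ℕ => exists_seminorm_conjS_tfShift_le φ i.1 i.2
  refine ⟨C * ∑ i ∈ s, C' i, s.sup m', mul_nonneg hC (Finset.sum_nonneg fun i _ => hC' i),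
    fun z => (hb _).trans ?_⟩
  rw [mul_assoc, Finset.sum_mul]
  refine mul_le_mul_of_nonneg_left (Finset.sum_le_sum fun i hi => ?_) hC
  refine (hb' i z).trans (mul_le_mul_of_nonneg_left (weight_mono ?_ z) (hC' i))
  exact_mod_cast Finset.le_sup (f := m') hi

theorem integrable_of_norm_le_weight {F : Eu ι → ℂ} (hF : AEStronglyMeasurable F) {C : ℝ}
    (h : ∀ z, ‖F z‖ ≤ C * weight (-(Fintype.card ι + 1 : ℝ)) z) : Integrable F :=
  ((integrable_weight (by linarith)).const_mul C).mono' hF (Eventually.of_forall h)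

/-- The tempered distribution `Φ ↦ ∫ Φ Ψ` given by a Schwartz function `Ψ`. -/
noncomputable def schwartzDist (Ψ : 𝓢(Eu ι, ℂ)) : 𝓢'(Eu ι, ℂ) :=
  SchwartzMap.toTemperedDistributionCLM (Eu ι) ℂ volume Ψ

theorem schwartzDist_apply (Ψ Φ : 𝓢(Eu ι, ℂ)) : schwartzDist Ψ Φ = ∫ t, Φ t * Ψ t :=
  SchwartzMap.toTemperedDistributionCLM_apply_apply volume Ψ Φ

theorem sPair_eq_stft (Ψ φ : 𝓢(Eu ι, ℂ)) (u : Eu (ι ⊕ ι)) :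
    sPair Ψ (tfShift u φ) = stft φ (schwartzDist Ψ) u := by
  unfold stft
  rw [schwartzDist_apply]
  simp [sPair, mul_comm]

theorem continuous_sPair_tfShift (Ψ φ : 𝓢(Eu ι, ℂ)) :
    Continuous fun u : Eu (ι ⊕ ι) => sPair Ψ (tfShift u φ) := by
  simp_rw [sPair_eq_stft]
  exact continuous_stft _ _

theorem continuous_eval_schwartz (t : Eu ι) : Continuous fun Ψ : 𝓢(Eu ι, ℂ) => Ψ t :=
  (BoundedContinuousFunction.evalCLM ℂ t).continuous.comp
    (SchwartzMap.toBoundedContinuousFunctionCLM ℂ (Eu ι) ℂ).continuous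

theorem fstPart_sndPart_eq (z : Eu (ι ⊕ ι)) : joinPair (fstPart z) (sndPart z) = z := by
  ext i
  cases i <;> simp

theorem fourier_mul_conj_eq_sPair (Ψ φ : 𝓢(Eu ι, ℂ)) (x η : Eu ι) :
    𝓕 (fun s : Eu ι => Ψ s * conj (φ (s - x))) η = sPair Ψ (tfShift (joinPair x η) φ) := by
  rw [Real.fourier_eq, sPair]
  congr 1; ext s
  rw [tfShift_apply', map_mul, fstPart_joinPair, sndPart_joinPair, ← Circle.coe_inv_eq_conj,
    ← AddChar.map_neg_eq_inv, Circle.smul_def, smul_eq_mul, real_inner_comm η s]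
  ring

theorem weight_neg_joinPair_le {s : ℝ} (hs : 0 ≤ s) (x η : Eu ι) :
    weight (-s) (joinPair x η) ≤ weight (-s) η := by
  rw [weight_neg, weight_neg]
  refine inv_anti₀ (weight_pos _ _) ?_
  have := weight_le_of_le hs zero_le_one (z := η) (w := joinPair x η) (by
      rw [norm_sq_eq_parts (joinPair x η), fstPart_joinPair, sndPart_joinPair]
      nlinarith [sq_nonneg ‖x‖])
  simpa using this

theorem integrable_sPair_tfShift_joinPair (Ψ φ : 𝓢(Eu ι, ℂ)) (x : Eu ι) :
    Integrable fun η : Eu ι => sPair Ψ (tfShift (joinPair x η) φ) := by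
  obtain ⟨C, hC, hb⟩ := exists_norm_sPair_tfShift_le Ψ φ (Fintype.card ι + 1)
  have hm : Continuous fun η : Eu ι => sPair Ψ (tfShift (joinPair x η) φ) :=
    (continuous_sPair_tfShift Ψ φ).comp (continuous_joinPair_right x)
  exact integrable_of_norm_le_weight hm.aestronglyMeasurable (C := C) fun η =>
    (hb _).trans (mul_le_mul_of_nonneg_left (weight_neg_joinPair_le (by positivity) x η) hC)

/-- Fourier inversion for `Ψ * conj (φ (· - x))`. -/
theorem integral_sPair_tfShift_joinPair (Ψ φ : 𝓢(Eu ι, ℂ)) (x t : Eu ι) :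
    ∫ η : Eu ι, sPair Ψ (tfShift (joinPair x η) φ) * tfShift (joinPair x η) φ t =
      Ψ t * (φ (t - x) * conj (φ (t - x))) := by
  set h : Eu ι → ℂ := fun s => Ψ s * conj (φ (s - x)) with hh
  have hhc : Continuous h := by fun_prop
  have hhi : Integrable h := by
    have := integrable_mul_conj Ψ (SchwartzMap.compSubConstCLM ℂ x φ)
    simpa using this
  have hF : 𝓕 h = fun η => sPair Ψ (tfShift (joinPair x η) φ) :=
    funext fun η => fourier_mul_conj_eq_sPair Ψ φ x η
  have hinv := congrFun (hhc.fourierInv_fourier_eq hhi (by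
    rw [hF]; exact integrable_sPair_tfShift_joinPair Ψ φ x)) t
  rw [Real.fourierInv_eq, hF] at hinv
  have h2 : ∀ η : Eu ι, sPair Ψ (tfShift (joinPair x η) φ) * tfShift (joinPair x η) φ t =
      (𝐞 (inner ℝ η t) • sPair Ψ (tfShift (joinPair x η) φ)) * φ (t - x) := by
    intro η
    rw [tfShift_apply', fstPart_joinPair, sndPart_joinPair, Circle.smul_def, smul_eq_mul]
    ring
  simp_rw [h2]
  rw [integral_mul_const, hinv, hh]
  ring

/-- The inversion formula for the short-time Fourier transform of Schwartz functions. -/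
theorem mul_sPair_self_eq_integral (Ψ φ : 𝓢(Eu ι, ℂ)) (t : Eu ι) :
    Ψ t * sPair φ φ = ∫ u, sPair Ψ (tfShift u φ) * tfShift u φ t := by
  obtain ⟨Cφ, hCφ⟩ : ∃ C, ∀ z, ‖φ z‖ ≤ C := ⟨_, fun z => SchwartzMap.norm_le_seminorm ℝ φ z⟩
  have hcont : Continuous fun u : Eu (ι ⊕ ι) => sPair Ψ (tfShift u φ) * tfShift u φ t :=
    (continuous_sPair_tfShift Ψ φ).mul ((continuous_eval_schwartz t).comp (continuous_tfShift φ))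
  obtain ⟨C, hC, hb⟩ := exists_norm_sPair_tfShift_le Ψ φ (Fintype.card (ι ⊕ ι) + 1)
  have hint : Integrable fun u : Eu (ι ⊕ ι) => sPair Ψ (tfShift u φ) * tfShift u φ t := by
    refine integrable_of_norm_le_weight hcont.aestronglyMeasurable (C := C * Cφ) fun u => ?_
    rw [norm_mul, norm_tfShift_apply, mul_right_comm]
    exact mul_le_mul (hb u) (hCφ _) (norm_nonneg _) (mul_nonneg hC (weight_nonneg _ _))
  have hmp := measurePreserving_joinPair (ι := ι)
  have hprod := integral_prod _ (hmp.integrable_comp_of_integrable hint)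
  simp only [Function.comp_apply] at hprod
  rw [← hmp.map_eq, integral_map hmp.measurable.aemeasurable
    (by rw [hmp.map_eq]; exact hcont.aestronglyMeasurable), hprod]
  simp_rw [integral_sPair_tfShift_joinPair]
  rw [integral_const_mul, sPair]
  congr 1
  exact (integral_sub_left_eq_self (fun y => φ y * conj (φ y)) volume t).symm

/-- The inversion formula for the short-time Fourier transform of a tempered distribution, tested
against a Schwartz function. -/
theorem apply_conjS_mul_sPair_self (f : 𝓢'(Eu ι, ℂ)) (Ψ φ : 𝓢(Eu ι, ℂ)) :
    f (conjS Ψ) * sPair φ φ = ∫ u, stft φ f u * sPair (tfShift u φ) Ψ := by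
  have hc : Continuous fun u : Eu (ι ⊕ ι) => sPair (tfShift u φ) Ψ := by
    have := Complex.continuous_conj.comp (continuous_sPair_tfShift Ψ φ)
    simpa [Function.comp_def, conj_sPair] using this
  have h := functional_integral (μ := (volume : Measure (Eu (ι ⊕ ι))))
    (f : 𝓢(Eu ι, ℂ) →L[ℂ] ℂ)
    (Φ := fun u : Eu (ι ⊕ ι) => sPair (tfShift u φ) Ψ • conjS (tfShift u φ))
    (hc.smul (continuous_conjS_tfShift φ)) (fun k n => ?_) (Θ := sPair φ φ • conjS Ψ)
    (fun t => ?_)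
  · have h1 : (f : 𝓢(Eu ι, ℂ) →L[ℂ] ℂ) (sPair φ φ • conjS Ψ) = f (conjS Ψ) * sPair φ φ := by
      rw [map_smul, smul_eq_mul, mul_comm]
    refine h1.symm.trans (h.trans ?_)
    congr 1; ext u
    exact ((f : 𝓢(Eu ι, ℂ) →L[ℂ] ℂ).map_smul _ _).trans (mul_comm _ _)
  · obtain ⟨C, m, hC, hb⟩ := exists_seminorm_conjS_tfShift_le φ k n
    obtain ⟨C', hC', hb'⟩ := exists_norm_sPair_tfShift_le Ψ φ (Fintype.card (ι ⊕ ι) + 1 + m)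
    refine ((integrable_weight (ι := ι ⊕ ι) (N := Fintype.card (ι ⊕ ι) + 1)
      (by linarith)).const_mul (C' * C)).mono' ?_ (Eventually.of_forall fun u => ?_)
    · exact ((continuous_seminorm k n).comp
        (hc.smul (continuous_conjS_tfShift φ))).aestronglyMeasurable
    · rw [Real.norm_of_nonneg (apply_nonneg _ _), map_smul_eq_mul, norm_sPair_comm]
      calc _ ≤ (C' * weight (-(Fintype.card (ι ⊕ ι) + 1 + m)) u) * (C * weight m u) := by
            exact mul_le_mul (hb' u) (hb u) (apply_nonneg _ _)
              (mul_nonneg hC' (weight_nonneg _ _))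
        _ = C' * C * (weight (-(Fintype.card (ι ⊕ ι) + 1 + m)) u * weight m u) := by ring
        _ = _ := by
          rw [← weight_add]
          congr 2; ring
  · have h1 := congrArg conj (mul_sPair_self_eq_integral Ψ φ t)
    rw [← integral_conj] at h1
    simp only [map_mul, conj_sPair] at h1
    simpa [mul_comm] using h1

/-- Moyal's identity. -/
theorem integral_norm_sq_sPair_tfShift (Ψ φ : 𝓢(Eu ι, ℂ)) :
    ((∫ u : Eu (ι ⊕ ι), ‖sPair Ψ (tfShift u φ)‖ ^ 2 : ℝ) : ℂ) = sPair Ψ Ψ * sPair φ φ := by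
  have h := apply_conjS_mul_sPair_self (schwartzDist Ψ) Ψ φ
  have h1 : schwartzDist Ψ (conjS Ψ) = sPair Ψ Ψ := by
    rw [schwartzDist_apply]
    simp [sPair, mul_comm]
  rw [← h1, h, ← integral_complex_ofReal]
  congr 1; ext u
  rw [← sPair_eq_stft, ← conj_sPair Ψ, Complex.mul_conj, Complex.normSq_eq_norm_sq]

end Inversion

/-! ### Unitarity and covariance of metaplectic operators -/

section MetaplecticProperties

variable {ι : Type*} [Fintype ι] [DecidableEq ι]

theorem toEuclideanCLM_apply_eq (M : Matrix ι ι ℝ) (x : Eu ι) (i : ι) :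
    Matrix.toEuclideanCLM (𝕜 := ℝ) M x i = ∑ j, M i j * x j := by
  have := congrFun (Matrix.ofLp_toEuclideanCLM (𝕜 := ℝ) M x) i
  simpa only [Matrix.mulVec, dotProduct] using this

theorem fstPart_toEuclideanCLM (A B C D : Matrix ι ι ℝ) (z : Eu (ι ⊕ ι)) :
    fstPart (Matrix.toEuclideanCLM (𝕜 := ℝ) (Matrix.fromBlocks A B C D) z) =
      Matrix.toEuclideanCLM (𝕜 := ℝ) A (fstPart z) +
        Matrix.toEuclideanCLM (𝕜 := ℝ) B (sndPart z) := by
  ext i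
  simp [toEuclideanCLM_apply_eq]

theorem sndPart_toEuclideanCLM (A B C D : Matrix ι ι ℝ) (z : Eu (ι ⊕ ι)) :
    sndPart (Matrix.toEuclideanCLM (𝕜 := ℝ) (Matrix.fromBlocks A B C D) z) =
      Matrix.toEuclideanCLM (𝕜 := ℝ) C (fstPart z) +
        Matrix.toEuclideanCLM (𝕜 := ℝ) D (sndPart z) := by
  ext i
  simp [toEuclideanCLM_apply_eq]

theorem inner_toEuclideanCLM (M : Matrix ι ι ℝ) (x y : Eu ι) :
    inner ℝ (Matrix.toEuclideanCLM (𝕜 := ℝ) M x) y =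
      inner ℝ x (Matrix.toEuclideanCLM (𝕜 := ℝ) M.transpose y) := by
  simp only [PiLp.inner_apply, toEuclideanCLM_apply_eq, RCLike.inner_apply, conj_trivial,
    Matrix.transpose_apply, Finset.mul_sum, Finset.sum_mul]
  rw [Finset.sum_comm]
  refine Finset.sum_congr rfl fun i _ => Finset.sum_congr rfl fun j _ => ?_
  ring

theorem toEuclideanCLM_mul_apply (M N : Matrix ι ι ℝ) (x : Eu ι) :
    Matrix.toEuclideanCLM (𝕜 := ℝ) (M * N) x =
      Matrix.toEuclideanCLM (𝕜 := ℝ) M (Matrix.toEuclideanCLM (𝕜 := ℝ) N x) := by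
  rw [map_mul]; rfl

theorem toEuclideanCLM_one_apply (x : Eu ι) :
    Matrix.toEuclideanCLM (𝕜 := ℝ) (1 : Matrix ι ι ℝ) x = x := by
  rw [map_one]; rfl

theorem toEuclideanCLM_zero_apply (x : Eu ι) :
    Matrix.toEuclideanCLM (𝕜 := ℝ) (0 : Matrix ι ι ℝ) x = 0 := by
  rw [map_zero]; rfl

theorem norm_cexp_I_ofReal (r : ℝ) : ‖Complex.exp (Complex.I * (r : ℂ))‖ = 1 := by
  rw [mul_comm]; exact Complex.norm_exp_ofReal_mul_I r

/-- The linear automorphism of `ℝ^ι` given by an invertible matrix. -/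
noncomputable def matrixEquiv (L : Matrix ι ι ℝ) (hL : IsUnit L.det) : Eu ι ≃L[ℝ] Eu ι :=
  ContinuousLinearEquiv.equivOfInverse
    (Matrix.toEuclideanCLM (𝕜 := ℝ) L) (Matrix.toEuclideanCLM (𝕜 := ℝ) L⁻¹)
    (fun x => by
      rw [← toEuclideanCLM_mul_apply, Matrix.nonsing_inv_mul L hL, toEuclideanCLM_one_apply])
    (fun x => by
      rw [← toEuclideanCLM_mul_apply, Matrix.mul_nonsing_inv L hL, toEuclideanCLM_one_apply])

theorem integral_comp_toEuclideanCLM (L : Matrix ι ι ℝ) (hL : IsUnit L.det) (F : Eu ι → ℂ) :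
    ∫ x, F (Matrix.toEuclideanCLM (𝕜 := ℝ) L x) = (|L.det|⁻¹ : ℝ) • ∫ x, F x := by
  have hdet : LinearMap.det (Matrix.toEuclideanLin L) = L.det := by
    change LinearMap.det (Matrix.toLpLin 2 2 L) = _
    rw [Matrix.toLpLin_eq_toLin, LinearMap.det_toLin]
  have h := Measure.map_linearMap_addHaar_eq_smul_addHaar (volume : Measure (Eu ι))
    (f := Matrix.toEuclideanLin L) (by rw [hdet]; exact hL.ne_zero)
  have h1 := (matrixEquiv L hL).toHomeomorph.measurableEmbedding.integral_map (μ := volume) F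
  have h2 : ((matrixEquiv L hL).toHomeomorph : Eu ι → Eu ι) = Matrix.toEuclideanLin L := rfl
  refine h1.symm.trans ?_
  rw [h2, h, hdet, integral_smul_measure, ENNReal.toReal_ofReal (abs_nonneg _), abs_inv]

/-- Metaplectic operators are unitary. -/
theorem IsMetaplectic.sPair_eq {A : Matrix (ι ⊕ ι) (ι ⊕ ι) ℝ}
    {U : 𝓢(Eu ι, ℂ) ≃L[ℂ] 𝓢(Eu ι, ℂ)} (h : IsMetaplectic A U) (f g : 𝓢(Eu ι, ℂ)) :
    sPair (U f) (U g) = sPair f g := by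
  induction h generalizing f g with
  | fourier U hU => rw [hU, hU, sPair_fourier]
  | chirp C hC U hU =>
    unfold sPair
    congr 1; ext x
    rw [hU, hU, map_mul, mul_mul_mul_comm, Complex.mul_conj, Complex.normSq_eq_norm_sq,
      norm_cexp_I_ofReal]
    simp
  | rescale L hL U hU =>
    unfold sPair
    have h1 : ∀ x, U f x * conj (U g x) = ((|L.det| : ℝ) : ℂ) *
        (fun y => f y * conj (g y)) (Matrix.toEuclideanCLM (𝕜 := ℝ) L x) := by
      intro x
      rw [hU, hU, map_mul, mul_mul_mul_comm, Complex.conj_ofReal, ← Complex.ofReal_mul,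
        Real.mul_self_sqrt (abs_nonneg _)]
    simp_rw [h1]
    rw [integral_const_mul, integral_comp_toEuclideanCLM L hL (fun y => f y * conj (g y)), Complex.real_smul, ← mul_assoc,
      ← Complex.ofReal_mul, mul_inv_cancel₀ (abs_ne_zero.2 hL.ne_zero)]
    simp
  | phase c hc A U V hA hV ih =>
    rw [hV, hV, sPair_smul_left, sPair_smul_right, ih, ← mul_assoc, Complex.mul_conj,
      Complex.normSq_eq_norm_sq, hc]
    simp
  | comp A B U V hA hB ihA ihB =>
    simp only [ContinuousLinearEquiv.trans_apply]
    rw [ihA, ihB]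

/-- The symplectic covariance of metaplectic operators. -/
theorem IsMetaplectic.exists_tfShift {A : Matrix (ι ⊕ ι) (ι ⊕ ι) ℝ}
    {U : 𝓢(Eu ι, ℂ) ≃L[ℂ] 𝓢(Eu ι, ℂ)} (h : IsMetaplectic A U) (z : Eu (ι ⊕ ι)) :
    ∃ c : ℂ, ‖c‖ = 1 ∧ ∀ f, U (tfShift z f) =
      c • tfShift (Matrix.toEuclideanCLM (𝕜 := ℝ) A z) (U f) := by
  induction h generalizing z with
  | fourier U hU =>
    refine ⟨(𝐞 (inner ℝ (fstPart z) (sndPart z)) : ℂ), Circle.norm_coe _, fun f => ?_⟩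
    rw [hU, hU, fourier_tfShift]
    congr 3
    rw [← fstPart_sndPart_eq (Matrix.toEuclideanCLM (𝕜 := ℝ) _ z), fstPart_toEuclideanCLM,
      sndPart_toEuclideanCLM, toEuclideanCLM_zero_apply, toEuclideanCLM_zero_apply, map_neg,
      toEuclideanCLM_one_apply]
    simp
  | chirp C hC U hU =>
    refine ⟨Complex.exp (Complex.I * ((-(Real.pi *
      inner ℝ (Matrix.toEuclideanCLM (𝕜 := ℝ) C (fstPart z)) (fstPart z)) : ℝ) : ℂ)),
      norm_cexp_I_ofReal _, fun f => ?_⟩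
    ext t
    rw [smul_apply, smul_eq_mul, hU, tfShift_apply, tfShift_apply, hU, ← mul_assoc, ← mul_assoc,
      ← mul_assoc, ← Complex.exp_add, ← Complex.exp_add, ← Complex.exp_add,
      fstPart_toEuclideanCLM, sndPart_toEuclideanCLM, toEuclideanCLM_zero_apply,
      toEuclideanCLM_one_apply, toEuclideanCLM_one_apply, add_zero, ← mul_add, ← mul_add,
      ← mul_add, ← Complex.ofReal_add, ← Complex.ofReal_add, ← Complex.ofReal_add]
    congr 4
    have h1 : inner ℝ (Matrix.toEuclideanCLM (𝕜 := ℝ) C t) (fstPart z) =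
        inner ℝ (Matrix.toEuclideanCLM (𝕜 := ℝ) C (fstPart z)) t := by
      rw [inner_toEuclideanCLM, hC.eq, real_inner_comm]
    simp only [map_sub, inner_sub_left, inner_sub_right, inner_add_left, h1]
    ring
  | rescale L hL U hU =>
    refine ⟨1, norm_one, fun f => ?_⟩
    ext t
    rw [one_smul, hU, tfShift_apply, tfShift_apply, hU, fstPart_toEuclideanCLM,
      sndPart_toEuclideanCLM, toEuclideanCLM_zero_apply, toEuclideanCLM_zero_apply, add_zero,
      zero_add, (Matrix.toEuclideanCLM (𝕜 := ℝ) L).map_sub, ← toEuclideanCLM_mul_apply, Matrix.mul_nonsing_inv L hL,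
      toEuclideanCLM_one_apply, inner_toEuclideanCLM, Matrix.transpose_transpose]
    ring
  | phase c hc A U V hA hV ih =>
    obtain ⟨c', hc', h⟩ := ih z
    refine ⟨c', hc', fun f => ?_⟩
    rw [hV, hV, h, map_smul, smul_comm]
  | comp A B U V hA hB ihA ihB =>
    obtain ⟨c, hc, h⟩ := ihB z
    obtain ⟨c', hc', h'⟩ := ihA (Matrix.toEuclideanCLM (𝕜 := ℝ) B z)
    refine ⟨c * c', by rw [norm_mul, hc, hc', one_mul], fun f => ?_⟩
    simp only [ContinuousLinearEquiv.trans_apply]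
    rw [h, map_smul, h', smul_smul, toEuclideanCLM_mul_apply]

end MetaplecticProperties

/-! ### Testing `W(f, g)` against Schwartz functions -/

section WignerIdentities

variable {ι : Type*} [Fintype ι]

/-- `(x, η) ↦ ((x, 0), (η, 0))`: a time-frequency shift of the first factor of a tensor product. -/
noncomputable def liftShift : Eu (ι ⊕ ι) →L[ℝ] Eu ((ι ⊕ ι) ⊕ (ι ⊕ ι)) :=
  (EuclideanSpace.sumEquivProd (𝕜 := ℝ) (ι := ι ⊕ ι) (κ := ι ⊕ ι)).symm.toContinuousLinearMap ∘L
    (inlCLM ∘L fstPart).prod (inlCLM ∘L sndPart)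

theorem liftShift_apply (u : Eu (ι ⊕ ι)) :
    liftShift u = joinPair (joinPair (fstPart u) 0) (joinPair (sndPart u) 0) := rfl

theorem tensorConjS_tfShift (u : Eu (ι ⊕ ι)) (φ g : 𝓢(Eu ι, ℂ)) :
    tensorConjS (tfShift u φ) g = tfShift (liftShift u) (tensorConjS φ g) := by
  ext t
  rw [tensorConjS_apply, tfShift_apply', tfShift_apply', tensorConjS_apply, liftShift_apply,
    fstPart_joinPair, sndPart_joinPair, inner_eq_parts]
  simp [mul_assoc]

/-- The partial pairing with `g` is adjoint to the tensor product with `conj g`. -/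
theorem sPair_conjS_partialPair (ψ g : 𝓢(Eu ι, ℂ)) (Θ : 𝓢(Eu (ι ⊕ ι), ℂ)) :
    sPair ψ (conjS (partialPair g (conjS Θ))) = sPair (tensorConjS ψ g) Θ := by
  have hmp := measurePreserving_joinPair (ι := ι)
  have hint := integrable_mul_conj (tensorConjS ψ g) Θ
  have hprod := integral_prod _ (hmp.integrable_comp_of_integrable hint)
  simp only [Function.comp_apply] at hprod
  unfold sPair
  rw [← hmp.map_eq, integral_map hmp.measurable.aemeasurable
    (by rw [hmp.map_eq]; exact hint.aestronglyMeasurable), hprod]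
  congr 1; ext x
  rw [conjS_apply, Complex.conj_conj, partialPair_apply, ← integral_const_mul]
  congr 1; ext y
  simp
  ring

theorem partialPair_conjS_tensorConjS (ψ g : 𝓢(Eu ι, ℂ)) :
    partialPair g (conjS (tensorConjS ψ g)) = sPair g g • conjS ψ := by
  ext x
  rw [partialPair_apply, smul_apply, smul_eq_mul, sPair, ← integral_mul_const]
  congr 1; ext y
  simp
  ring

theorem sPair_tensorConjS_self (ψ g : 𝓢(Eu ι, ℂ)) :
    sPair (tensorConjS ψ g) (tensorConjS ψ g) = sPair g g * sPair ψ ψ := by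
  rw [← sPair_conjS_partialPair, partialPair_conjS_tensorConjS]
  have h : conjS (sPair g g • conjS ψ) = sPair g g • ψ := by
    ext t
    simp only [conjS_apply, smul_apply, smul_eq_mul, map_mul, Complex.conj_conj, conj_sPair]
  rw [h, sPair_smul_right, conj_sPair]

variable (U : 𝓢(Eu (ι ⊕ ι), ℂ) ≃L[ℂ] 𝓢(Eu (ι ⊕ ι), ℂ))

/-- Testing `W(f, g)` against `W(ψ, g)` recovers `f` tested against `ψ`. -/
theorem wigner_conjS_wignerS (f : 𝓢'(Eu ι, ℂ)) (g ψ : 𝓢(Eu ι, ℂ)) :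
    wigner U f g (conjS (wignerS U ψ g)) = sPair g g * f (conjS ψ) := by
  have hcc : ∀ Φ : 𝓢(Eu (ι ⊕ ι), ℂ), conjS (conjS Φ) = Φ := fun Φ => by ext; simp
  rw [wigner, extendDist_apply, hcc, wignerS, ContinuousLinearEquiv.symm_apply_apply,
    tensorConj_apply, partialPair_conjS_tensorConjS]
  exact (f : 𝓢(Eu ι, ℂ) →L[ℂ] ℂ).map_smul _ _

/-- The inversion formula for the short-time Fourier transform, carried over to `W(f, g)`. -/
theorem wigner_conjS_mul_sPair_self (hU : ∀ Φ Ψ, sPair (U Φ) (U Ψ) = sPair Φ Ψ)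
    (f : 𝓢'(Eu ι, ℂ)) (g φ : 𝓢(Eu ι, ℂ)) (Ψ : 𝓢(Eu (ι ⊕ ι), ℂ)) :
    wigner U f g (conjS Ψ) * sPair φ φ =
      ∫ u, stft φ f u * sPair (wignerS U (tfShift u φ) g) Ψ := by
  have hcc : ∀ Φ : 𝓢(Eu (ι ⊕ ι), ℂ), conjS (conjS Φ) = Φ := fun Φ => by ext; simp
  have hcc' : ∀ Φ : 𝓢(Eu ι, ℂ), conjS (conjS Φ) = Φ := fun Φ => by ext; simp
  have h := apply_conjS_mul_sPair_self f (conjS (partialPair g (conjS (U.symm Ψ)))) φ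
  rw [hcc'] at h
  rw [wigner, extendDist_apply, hcc, tensorConj_apply, h]
  congr 1; ext u
  rw [sPair_conjS_partialPair, ← hU, ContinuousLinearEquiv.apply_symm_apply, wignerS]

end WignerIdentities

/-! ### Integrals of weights against rapidly decaying kernels -/

section ExtendedWeights

variable {ι κ : Type*} [Fintype ι] [Fintype κ]

/-- The weight `v_s`, with values in `[0, ∞]`. -/
noncomputable def eweight (s : ℝ) (z : Eu ι) : ℝ≥0∞ := ENNReal.ofReal (weight s z)

theorem eweight_ne_top (s : ℝ) (z : Eu ι) : eweight s z ≠ ⊤ := ENNReal.ofReal_ne_top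

theorem eweight_ne_zero (s : ℝ) (z : Eu ι) : eweight s z ≠ 0 :=
  (ENNReal.ofReal_pos.2 (weight_pos s z)).ne'

theorem eweight_add (s t : ℝ) (z : Eu ι) : eweight (s + t) z = eweight s z * eweight t z := by
  rw [eweight, weight_add, ENNReal.ofReal_mul (weight_nonneg _ _)]; rfl

theorem eweight_rpow (s p : ℝ) (z : Eu ι) : eweight s z ^ p = eweight (s * p) z := by
  rw [eweight, ENNReal.ofReal_rpow_of_pos (weight_pos s z), weight_rpow]; rfl

theorem eweight_zero (z : Eu ι) : eweight 0 z = 1 := by simp [eweight]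

theorem eweight_mul_neg (s : ℝ) (z : Eu ι) : eweight s z * eweight (-s) z = 1 := by
  rw [← eweight_add, add_neg_cancel, eweight_zero]

theorem eweight_mono {s t : ℝ} (h : s ≤ t) (z : Eu ι) : eweight s z ≤ eweight t z :=
  ENNReal.ofReal_le_ofReal (weight_mono h z)

theorem eweight_sub_comm (s : ℝ) (z w : Eu ι) : eweight s (z - w) = eweight s (w - z) := by
  rw [eweight, ← weight_comp_neg, neg_sub]; rfl

theorem measurable_eweight (s : ℝ) : Measurable (eweight s : Eu ι → ℝ≥0∞) :=
  (continuous_weight s).measurable.ennreal_ofReal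

theorem measurable_eweight_sub (s : ℝ) (z : Eu κ) (L : Eu ι →L[ℝ] Eu κ) :
    Measurable fun u => eweight s (z - L u) :=
  (measurable_eweight s).comp (measurable_const.sub L.continuous.measurable)

theorem measurable_eweight_sub_const (s : ℝ) (w : Eu ι) : Measurable fun z => eweight s (z - w) :=
  (measurable_eweight s).comp (measurable_id.sub_const w)

theorem exists_eweight_le_mul (s : ℝ) : ∃ C : ℝ≥0∞, C ≠ ⊤ ∧ ∀ x y : Eu ι,
    eweight s x ≤ C * eweight |s| (x - y) * eweight s y := by
  refine ⟨ENNReal.ofReal (2 ^ (|s| / 2)), ENNReal.ofReal_ne_top, fun x y => ?_⟩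
  rw [eweight, eweight, eweight, ← ENNReal.ofReal_mul (by positivity), ← ENNReal.ofReal_mul
    (mul_nonneg (by positivity) (weight_nonneg _ _))]
  exact ENNReal.ofReal_le_ofReal (weight_le_mul s x y)

/-- Peetre's inequality for a rapidly decaying weight: the centre may be moved at the cost of a
growing factor. -/
theorem exists_eweight_neg_sub_le {N : ℝ} (hN : 0 ≤ N) : ∃ C : ℝ≥0∞, C ≠ ⊤ ∧ ∀ x y z : Eu ι,
    eweight (-N) (y - z) ≤ C * eweight N (x - y) * eweight (-N) (x - z) := by
  obtain ⟨C, hC, h⟩ := exists_eweight_le_mul (ι := ι) (-N)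
  refine ⟨C, hC, fun x y z => (h (y - z) (x - z)).trans_eq ?_⟩
  rw [abs_neg, abs_of_nonneg hN, sub_sub_sub_cancel_right, eweight_sub_comm]

theorem exists_eweight_clm_le {s : ℝ} (hs : 0 ≤ s) (L : Eu ι →L[ℝ] Eu κ) :
    ∃ C : ℝ≥0∞, C ≠ ⊤ ∧ ∀ z, eweight s (L z) ≤ C * eweight s z := by
  obtain ⟨C, hC, h⟩ := exists_weight_clm_le hs L
  refine ⟨ENNReal.ofReal C, ENNReal.ofReal_ne_top, fun z => ?_⟩
  rw [eweight, eweight, ← ENNReal.ofReal_mul hC.le]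
  exact ENNReal.ofReal_le_ofReal (h z)

theorem exists_eweight_neg_le_clm {N : ℝ} (hN : 0 ≤ N) (L : Eu ι →L[ℝ] Eu κ) :
    ∃ C : ℝ≥0∞, C ≠ ⊤ ∧ ∀ z, eweight (-N) z ≤ C * eweight (-N) (L z) := by
  obtain ⟨C, hC, h⟩ := exists_eweight_clm_le hN L
  refine ⟨C, hC, fun z => ?_⟩
  calc eweight (-N) z = eweight N (L z) * eweight (-N) (L z) * eweight (-N) z := by
        rw [eweight_mul_neg, one_mul]
    _ ≤ C * eweight N z * eweight (-N) (L z) * eweight (-N) z := by gcongr; exact h z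
    _ = C * eweight (-N) (L z) * (eweight N z * eweight (-N) z) := by ring
    _ = _ := by rw [eweight_mul_neg, mul_one]

theorem exists_eweight_equiv_le (s : ℝ) (E : Eu ι ≃L[ℝ] Eu κ) :
    ∃ C : ℝ≥0∞, C ≠ ⊤ ∧ ∀ z, eweight s (E z) ≤ C * eweight s z := by
  rcases le_total 0 s with hs | hs
  · exact exists_eweight_clm_le hs (E : Eu ι →L[ℝ] Eu κ)
  · obtain ⟨C, hC, h⟩ := exists_eweight_neg_le_clm (neg_nonneg.2 hs) (E.symm : Eu κ →L[ℝ] Eu ι)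
    refine ⟨C, hC, fun z => ?_⟩
    simpa using h (E z)

theorem lintegral_eweight_ne_top {N : ℝ} (hN : Fintype.card ι < N) :
    ∫⁻ z : Eu ι, eweight (-N) z ≠ ⊤ :=
  (integrable_weight hN).lintegral_lt_top.ne

theorem lintegral_eweight_sub_ne_top {N : ℝ} (hN : Fintype.card ι < N) :
    ∃ C : ℝ≥0∞, C ≠ ⊤ ∧ ∀ (E : Eu ι ≃L[ℝ] Eu ι) , ∃ D : ℝ≥0∞, D ≠ ⊤ ∧
      ∀ z, ∫⁻ u : Eu ι, eweight (-N) (z - E u) ≤ D * C := by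
  refine ⟨_, lintegral_eweight_ne_top hN, fun E => ?_⟩
  have hN0 : 0 ≤ N := (Nat.cast_nonneg _).trans hN.le
  obtain ⟨D, hD, h⟩ := exists_eweight_neg_le_clm hN0 (E.symm : Eu ι →L[ℝ] Eu ι)
  refine ⟨D, hD, fun z => ?_⟩
  calc ∫⁻ u : Eu ι, eweight (-N) (z - E u)
      ≤ ∫⁻ u, D * eweight (-N) (E.symm z - u) := by
        refine lintegral_mono fun u => (h _).trans_eq ?_
        simp
    _ = _ := by
        rw [lintegral_const_mul' _ _ hD, lintegral_sub_left_eq_self (eweight (-N))]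

/-- Averages of a weight with respect to a rapidly decaying kernel are dominated by the weight. -/
theorem exists_lintegral_eweight_mul_eweight_sub_le {m N : ℝ} (hN : |m| + Fintype.card ι < N)
    (E : Eu ι ≃L[ℝ] Eu ι) : ∃ C : ℝ≥0∞, C ≠ ⊤ ∧ ∀ z,
      ∫⁻ u, eweight m u * eweight (-N) (z - E u) ≤ C * eweight m z := by
  obtain ⟨B, hB, hBE⟩ := exists_eweight_equiv_le m E.symm
  obtain ⟨A, hA, hPe⟩ := exists_eweight_le_mul (ι := ι) m
  obtain ⟨K, hK, hKE⟩ := lintegral_eweight_sub_ne_top (N := N - |m|) (ι := ι) (by linarith)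
  obtain ⟨K', hK', hKE⟩ := hKE E
  refine ⟨B * A * (K' * K), by finiteness, fun z => ?_⟩
  calc ∫⁻ u, eweight m u * eweight (-N) (z - E u)
      ≤ ∫⁻ u, B * A * eweight m z * eweight (-(N - |m|)) (z - E u) := by
        refine lintegral_mono fun u => ?_
        calc eweight m u * eweight (-N) (z - E u)
            ≤ B * (A * eweight |m| (z - E u) * eweight m z) * eweight (-N) (z - E u) := by
              gcongr
              refine (le_of_eq_of_le (by simp) (hBE (E u))).trans ?_
              gcongr
              rw [eweight_sub_comm]
              exact hPe (E u) z
          _ = B * A * eweight m z * (eweight |m| (z - E u) * eweight (-N) (z - E u)) := by ring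
          _ = _ := by rw [← eweight_add]; congr 2; ring
    _ = B * A * eweight m z * ∫⁻ u, eweight (-(N - |m|)) (z - E u) :=
        lintegral_const_mul _ (measurable_eweight_sub _ z (E : Eu ι →L[ℝ] Eu ι))
    _ ≤ B * A * eweight m z * (K' * K) := by gcongr; exact hKE z
    _ = _ := by ring

/-- Hölder's inequality for the measure with density `k`. -/
theorem lintegral_mul_rpow_le {α : Type*} [MeasurableSpace α] {μ : Measure α} {a k : α → ℝ≥0∞}
    (ha : Measurable a) (hk : Measurable k) {p : ℝ} (hp : 1 ≤ p) :
    (∫⁻ x, a x * k x ∂μ) ^ p ≤ (∫⁻ x, k x ∂μ) ^ (p - 1) * ∫⁻ x, a x ^ p * k x ∂μ := by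
  rcases hp.eq_or_lt with rfl | hp
  · simp
  have hq := Real.HolderConjugate.conjExponent hp
  have h := ENNReal.lintegral_mul_le_Lp_mul_Lq (μ.withDensity k) hq ha.aemeasurable
    (aemeasurable_const (b := (1 : ℝ≥0∞)))
  have hd : ∀ f : α → ℝ≥0∞, Measurable f → ∫⁻ x, f x ∂(μ.withDensity k) = ∫⁻ x, f x * k x ∂μ :=
    fun f hf => by
      rw [lintegral_withDensity_eq_lintegral_mul _ hk hf]
      simp [mul_comm]
  simp only [Pi.mul_apply, mul_one, ENNReal.one_rpow] at h
  rw [hd _ ha, hd _ (ha.pow_const p), hd _ measurable_const] at h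
  have hp0 : 0 < p := by linarith
  calc (∫⁻ x, a x * k x ∂μ) ^ p ≤ _ := ENNReal.rpow_le_rpow h hp0.le
    _ = _ := by
      rw [ENNReal.mul_rpow_of_nonneg _ _ hp0.le, ← ENNReal.rpow_mul, ← ENNReal.rpow_mul,
        one_div_mul_cancel hp0.ne', ENNReal.rpow_one, mul_comm]
      simp only [one_mul]
      congr 2
      rw [Real.conjExponent]
      field_simp

/-- Tonelli's theorem for a weighted integral against a rapidly decaying kernel. -/
theorem exists_lintegral_eweight_mul_le {σ N : ℝ} (hN : |σ| + Fintype.card κ < N)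
    (L : Eu ι →L[ℝ] Eu κ) (hL : ∃ C : ℝ≥0∞, C ≠ ⊤ ∧ ∀ u, eweight σ (L u) ≤ C * eweight σ u) :
    ∃ C : ℝ≥0∞, C ≠ ⊤ ∧ ∀ a : Eu ι → ℝ≥0∞, Measurable a →
      ∫⁻ x, eweight σ x * ∫⁻ u, a u * eweight (-N) (x - L u) ≤ C * ∫⁻ u, eweight σ u * a u := by
  obtain ⟨C, hC, hL⟩ := hL
  obtain ⟨D, hD, hP⟩ := exists_eweight_le_mul (ι := κ) σ
  have hN' : (Fintype.card κ : ℝ) < N - |σ| := by linarith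
  refine ⟨C * D * ∫⁻ z : Eu κ, eweight (-(N - |σ|)) z,
    ENNReal.mul_ne_top (ENNReal.mul_ne_top hC hD) (lintegral_eweight_ne_top hN'), fun a ha => ?_⟩
  have hmeas : Measurable fun q : Eu κ × Eu ι =>
      eweight σ q.1 * (a q.2 * eweight (-N) (q.1 - L q.2)) :=
    ((measurable_eweight σ).comp measurable_fst).mul ((ha.comp measurable_snd).mul
      ((measurable_eweight (-N)).comp (measurable_fst.sub (L.continuous.measurable.comp
        measurable_snd))))
  calc ∫⁻ x, eweight σ x * ∫⁻ u, a u * eweight (-N) (x - L u)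
      = ∫⁻ x, ∫⁻ u, eweight σ x * (a u * eweight (-N) (x - L u)) := by
        refine lintegral_congr fun x => ?_
        rw [lintegral_const_mul' _ _ (eweight_ne_top _ _)]
    _ = ∫⁻ u, ∫⁻ x, eweight σ x * (a u * eweight (-N) (x - L u)) :=
        lintegral_lintegral_swap hmeas.aemeasurable
    _ ≤ ∫⁻ u, ∫⁻ x, (C * D * (eweight σ u * a u)) * eweight (-(N - |σ|)) (x - L u) := by
        refine lintegral_mono fun u => lintegral_mono fun x => ?_
        calc eweight σ x * (a u * eweight (-N) (x - L u))
            ≤ D * eweight |σ| (x - L u) * eweight σ (L u) * (a u * eweight (-N) (x - L u)) := by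
              gcongr; exact hP _ _
          _ ≤ D * eweight |σ| (x - L u) * (C * eweight σ u) * (a u * eweight (-N) (x - L u)) := by
              gcongr; exact hL u
          _ = (C * D * (eweight σ u * a u)) * (eweight |σ| (x - L u) * eweight (-N) (x - L u)) := by
              ring
          _ = _ := by rw [← eweight_add]; congr 2; ring
    _ = ∫⁻ u, (C * D * ∫⁻ z : Eu κ, eweight (-(N - |σ|)) z) * (eweight σ u * a u) := by
        refine lintegral_congr fun u => ?_
        rw [lintegral_const_mul _ (measurable_eweight_sub_const _ _),
          lintegral_sub_right_eq_self (eweight (-(N - |σ|)))]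
        ring
    _ = _ := by
        rw [lintegral_const_mul' _ _
          (ENNReal.mul_ne_top (ENNReal.mul_ne_top hC hD) (lintegral_eweight_ne_top hN'))]

end ExtendedWeights

/-! ### Functions dominated by their averages -/

section SelfImprovement

variable {ι κ : Type*} [Fintype ι] [Fintype κ]

/-- If a function of polynomial growth is dominated by its averages with respect to arbitrarily
fast decaying kernels, then so are all its positive powers. -/
theorem exists_rpow_le_lintegral {a : Eu ι → ℝ≥0∞} (ha : Measurable a)
    (hpoly : ∃ D : ℝ≥0∞, D ≠ ⊤ ∧ ∃ m : ℝ, ∀ z, a z ≤ D * eweight m z)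
    (h : ∀ N, ∃ C : ℝ≥0∞, C ≠ ⊤ ∧ ∀ z, a z ≤ C * ∫⁻ u, a u * eweight (-N) (z - u))
    {p : ℝ} (hp : 0 < p) (N : ℝ) :
    ∃ C : ℝ≥0∞, C ≠ ⊤ ∧ ∀ z, a z ^ p ≤ C * ∫⁻ u, a u ^ p * eweight (-N) (z - u) := by
  have hm : ∀ (N : ℝ) (z : Eu ι), Measurable fun u => eweight (-N) (z - u) := fun N z =>
    (measurable_eweight _).comp (measurable_const.sub measurable_id)
  rcases le_total 1 p with hp1 | hp1
  · set M := max N (Fintype.card ι + 1) with hM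
    have hMc : (Fintype.card ι : ℝ) < M := (lt_add_one _).trans_le (le_max_right _ _)
    obtain ⟨C, hC, h⟩ := h M
    refine ⟨C ^ p * (∫⁻ u : Eu ι, eweight (-M) u) ^ (p - 1),
      ENNReal.mul_ne_top (ENNReal.rpow_ne_top_of_nonneg hp.le hC)
        (ENNReal.rpow_ne_top_of_nonneg (by linarith) (lintegral_eweight_ne_top hMc)), fun z => ?_⟩
    calc a z ^ p ≤ (C * ∫⁻ u, a u * eweight (-M) (z - u)) ^ p := ENNReal.rpow_le_rpow (h z) hp.le
      _ = C ^ p * (∫⁻ u, a u * eweight (-M) (z - u)) ^ p := ENNReal.mul_rpow_of_nonneg _ _ hp.le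
      _ ≤ C ^ p * ((∫⁻ u, eweight (-M) (z - u)) ^ (p - 1) *
            ∫⁻ u, a u ^ p * eweight (-M) (z - u)) := by
          gcongr; exact lintegral_mul_rpow_le ha (hm M z) hp1
      _ = C ^ p * (∫⁻ u : Eu ι, eweight (-M) u) ^ (p - 1) *
            ∫⁻ u, a u ^ p * eweight (-M) (z - u) := by
          rw [lintegral_sub_left_eq_self (eweight (-M)), mul_assoc]
      _ ≤ _ := by
          gcongr with u
          exact eweight_mono (neg_le_neg (le_max_left _ _)) _
  · obtain ⟨D, hD, m, hpoly⟩ := hpoly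
    -- `M * p ≥ N` leaves enough decay after the `p`-th power, `M ≥ |m|` beats the growth of `a`
    set M := max (max N 0 / p) |m| with hM
    have hMm : |m| ≤ M := le_max_right _ _
    have hM0 : 0 ≤ M := (abs_nonneg _).trans hMm
    have hMN : N ≤ M * p := by
      rw [← div_le_iff₀ hp]
      exact (div_le_div_of_nonneg_right (le_max_left _ _) hp.le).trans (le_max_left _ _)
    obtain ⟨C, hC, h⟩ := h M
    obtain ⟨B, hB, hPe⟩ := exists_eweight_neg_sub_le (ι := ι) hM0
    obtain ⟨B', hB', hPm⟩ := exists_eweight_le_mul (ι := ι) m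
    refine ⟨C * B, ENNReal.mul_ne_top hC hB, fun z => ?_⟩
    -- the maximal function of Peetre, which is finite by the polynomial growth
    set S : ℝ≥0∞ := ⨆ w, a w * eweight (-M) (z - w) with hS
    have hSw : ∀ w, a w * eweight (-M) (z - w) ≤ S := fun w =>
      le_iSup (fun w => a w * eweight (-M) (z - w)) w
    have haS : a z ≤ S := by simpa [eweight, weight] using hSw z
    have hStop : S ≠ ⊤ := by
      refine ne_top_of_le_ne_top (b := D * (B' * eweight m z))
        (ENNReal.mul_ne_top hD (ENNReal.mul_ne_top hB' (eweight_ne_top _ _)))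
        (iSup_le fun w => ?_)
      calc a w * eweight (-M) (z - w)
          ≤ D * (B' * eweight |m| (w - z) * eweight m z) * eweight (-M) (z - w) := by
            gcongr
            exact (hpoly w).trans (by gcongr; exact hPm w z)
        _ = D * (B' * eweight m z) * (eweight |m| (z - w) * eweight (-M) (z - w)) := by
            rw [eweight_sub_comm |m|]; ring
        _ ≤ D * (B' * eweight m z) * (eweight M (z - w) * eweight (-M) (z - w)) := by
            gcongr; exact eweight_mono hMm _
        _ = _ := by rw [eweight_mul_neg, mul_one]
    set I : ℝ≥0∞ := ∫⁻ u, a u ^ p * eweight (-N) (z - u) with hI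
    have hSI : S ≤ C * B * (S ^ (1 - p) * I) := by
      refine iSup_le fun w => ?_
      calc a w * eweight (-M) (z - w)
          ≤ C * (∫⁻ u, a u * eweight (-M) (w - u)) * eweight (-M) (z - w) := by
            gcongr; exact h w
        _ = C * ∫⁻ u, a u * eweight (-M) (w - u) * eweight (-M) (z - w) := by
            rw [lintegral_mul_const' _ _ (eweight_ne_top _ _), mul_assoc]
        _ ≤ C * ∫⁻ u, B * S ^ (1 - p) * (a u ^ p * eweight (-N) (z - u)) := by
            refine mul_le_mul_right (lintegral_mono fun u => ?_) C
            have hsplit : ∀ x : ℝ≥0∞, x = x ^ (1 - p) * x ^ p := fun x => by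
              rw [← ENNReal.rpow_add_of_nonneg _ _ (by linarith) hp.le, sub_add_cancel,
                ENNReal.rpow_one]
            calc a u * eweight (-M) (w - u) * eweight (-M) (z - w)
                ≤ a u * (B * eweight M (z - w) * eweight (-M) (z - u)) * eweight (-M) (z - w) := by
                  gcongr; exact hPe z w u
              _ = B * (eweight M (z - w) * eweight (-M) (z - w)) *
                    (a u * eweight (-M) (z - u)) := by ring
              _ = B * ((a u * eweight (-M) (z - u)) ^ (1 - p) *
                    (a u * eweight (-M) (z - u)) ^ p) := by
                  rw [eweight_mul_neg, mul_one, ← hsplit]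
              _ ≤ B * (S ^ (1 - p) * (a u ^ p * eweight (-N) (z - u))) := by
                  gcongr
                  · exact hSw u
                  · rw [ENNReal.mul_rpow_of_nonneg _ _ hp.le, eweight_rpow]
                    gcongr
                    exact eweight_mono (by linarith) _
              _ = _ := by ring
        _ = _ := by
            rw [lintegral_const_mul' _ _ (ENNReal.mul_ne_top hB
              (ENNReal.rpow_ne_top_of_nonneg (by linarith) hStop))]
            ring
    rcases eq_or_ne S 0 with hS0 | hS0
    · have : a z = 0 := le_antisymm (haS.trans_eq hS0) bot_le
      rw [this, ENNReal.zero_rpow_of_pos hp]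
      exact bot_le
    · have hSp0 : S ^ (1 - p) ≠ 0 := (ENNReal.rpow_pos (pos_iff_ne_zero.2 hS0) hStop).ne'
      have hSpt : S ^ (1 - p) ≠ ⊤ := ENNReal.rpow_ne_top_of_nonneg (by linarith) hStop
      refine (ENNReal.rpow_le_rpow haS hp.le).trans ?_
      rw [← ENNReal.mul_le_mul_iff_right hSp0 hSpt,
        ← ENNReal.rpow_add_of_nonneg _ _ (by linarith) hp.le, sub_add_cancel, ENNReal.rpow_one]
      refine hSI.trans_eq ?_
      ring

/-- If all powers of `a` are dominated by their averages, then averages of higher powers are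
dominated by powers of averages. -/
theorem exists_lintegral_rpow_le {a : Eu ι → ℝ≥0∞} (ha : Measurable a) {p q : ℝ} (hp : 0 < p)
    (hpq : p ≤ q)
    (h : ∀ N, ∃ C : ℝ≥0∞, C ≠ ⊤ ∧ ∀ z, a z ^ p ≤ C * ∫⁻ u, a u ^ p * eweight (-N) (z - u))
    (L : Eu ι →L[ℝ] Eu κ) {N : ℝ} (hN : 0 ≤ N) :
    ∃ C : ℝ≥0∞, C ≠ ⊤ ∧ ∃ M : ℝ, ∀ x, ∫⁻ u, a u ^ q * eweight (-M) (x - L u) ≤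
      C * (∫⁻ u, a u ^ p * eweight (-N) (x - L u)) ^ (q / p) := by
  obtain ⟨C, hC, h⟩ := h N
  obtain ⟨B, hB, hB2⟩ := exists_eweight_neg_le_clm hN L
  obtain ⟨B', hB', hPe⟩ := exists_eweight_neg_sub_le (ι := κ) hN
  -- `a ^ q = (a ^ p) ^ r * a ^ p`, where the first factor is bounded by the average
  set r := (q - p) / p with hr
  have hr0 : 0 ≤ r := div_nonneg (by linarith) hp.le
  have hCt : (C * B * B') ^ r ≠ ⊤ :=
    ENNReal.rpow_ne_top_of_nonneg hr0 (ENNReal.mul_ne_top (ENNReal.mul_ne_top hC hB) hB')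
  refine ⟨(C * B * B') ^ r, hCt, N + N * r, fun x => ?_⟩
  set I := ∫⁻ u, a u ^ p * eweight (-N) (x - L u) with hI
  have hpt : ∀ u, a u ^ p ≤ C * B * B' * eweight N (x - L u) * I := by
    intro u
    calc a u ^ p ≤ C * ∫⁻ u', a u' ^ p * eweight (-N) (u - u') := h u
      _ ≤ C * ∫⁻ u', (B * B' * eweight N (x - L u)) * (a u' ^ p * eweight (-N) (x - L u')) := by
          refine mul_le_mul_right (lintegral_mono fun u' => ?_) C
          calc a u' ^ p * eweight (-N) (u - u')
              ≤ a u' ^ p * (B * (B' * eweight N (x - L u) * eweight (-N) (x - L u'))) := by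
                gcongr
                refine (hB2 _).trans ?_
                rw [map_sub]
                gcongr
                exact hPe x (L u) (L u')
            _ = _ := by ring
      _ = _ := by
          rw [lintegral_const_mul' _ _ (ENNReal.mul_ne_top (ENNReal.mul_ne_top hB hB')
            (eweight_ne_top _ _))]
          ring
  have hq : ∀ u, a u ^ q ≤ (C * B * B') ^ r * eweight (N * r) (x - L u) * I ^ r * a u ^ p := by
    intro u
    calc a u ^ q = (a u ^ p) ^ r * a u ^ p := by
          rw [← ENNReal.rpow_mul, ← ENNReal.rpow_add_of_nonneg _ _ (by positivity) hp.le]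
          congr 1
          rw [hr]; field_simp; ring
      _ ≤ (C * B * B' * eweight N (x - L u) * I) ^ r * a u ^ p := by
          gcongr; exact hpt u
      _ = _ := by
          rw [ENNReal.mul_rpow_of_nonneg _ _ hr0, ENNReal.mul_rpow_of_nonneg _ _ hr0, eweight_rpow]
  calc ∫⁻ u, a u ^ q * eweight (-(N + N * r)) (x - L u)
      ≤ ∫⁻ u, (C * B * B') ^ r * I ^ r * (a u ^ p * eweight (-N) (x - L u)) := by
        refine lintegral_mono fun u => ?_
        calc a u ^ q * eweight (-(N + N * r)) (x - L u)
            ≤ (C * B * B') ^ r * eweight (N * r) (x - L u) * I ^ r * a u ^ p *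
                (eweight (-N) (x - L u) * eweight (-(N * r)) (x - L u)) := by
              rw [neg_add, eweight_add]
              gcongr; exact hq u
          _ = (eweight (N * r) (x - L u) * eweight (-(N * r)) (x - L u)) *
                ((C * B * B') ^ r * I ^ r * (a u ^ p * eweight (-N) (x - L u))) := by ring
          _ = _ := by rw [eweight_mul_neg, one_mul]
    _ = (C * B * B') ^ r * I ^ r * I := by
        rw [lintegral_const_mul _ (show Measurable fun u => a u ^ p * eweight (-N) (x - L u) from
          (ha.pow_const p).mul (measurable_eweight_sub _ x L))]
    _ = _ := by
        rw [mul_assoc]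
        congr 1
        nth_rw 2 [← ENNReal.rpow_one I]
        rw [← ENNReal.rpow_add_of_nonneg _ _ hr0 zero_le_one]
        congr 1
        rw [hr]; field_simp; ring

end SelfImprovement

/-! ### Weighted Lebesgue norms and Young's inequality -/

section WeightedNorms

variable {ι : Type*} [Fintype ι]

theorem weightedNorm_rpow {p : ℝ≥0∞} (hp0 : p ≠ 0) (hp : p ≠ ⊤) (s : ℝ) (F : Eu ι → ℂ) :
    weightedNorm p s F ^ p.toReal = ∫⁻ z, eweight (s * p.toReal) z * ‖F z‖ₑ ^ p.toReal := by
  have h := ENNReal.toReal_pos hp0 hp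
  rw [weightedNorm, eLpNorm_eq_lintegral_rpow_enorm_toReal hp0 hp, ← ENNReal.rpow_mul,
    one_div_mul_cancel h.ne', ENNReal.rpow_one]
  refine lintegral_congr fun z => ?_
  rw [enorm_mul, ENNReal.mul_rpow_of_nonneg _ _ h.le, ← eweight_rpow, eweight]
  congr 2
  rw [← ofReal_norm, Complex.norm_real, Real.norm_of_nonneg (weight_nonneg _ _)]

theorem weightedNorm_lt_top_iff {p : ℝ≥0∞} (hp0 : p ≠ 0) (hp : p ≠ ⊤) (s : ℝ) (F : Eu ι → ℂ) :
    weightedNorm p s F < ⊤ ↔ ∫⁻ z, eweight (s * p.toReal) z * ‖F z‖ₑ ^ p.toReal < ⊤ := by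
  rw [← weightedNorm_rpow hp0 hp, ENNReal.rpow_lt_top_iff_of_pos (ENNReal.toReal_pos hp0 hp)]

theorem enorm_weight_mul (s : ℝ) (F : Eu ι → ℂ) (z : Eu ι) :
    ‖(weight s z : ℂ) * F z‖ₑ = eweight s z * ‖F z‖ₑ := by
  rw [enorm_mul, eweight, ← ofReal_norm (weight s z : ℂ), Complex.norm_real,
    Real.norm_of_nonneg (weight_nonneg _ _)]

/-- Young's inequality in weighted `L^p` spaces, `1 ≤ p ≤ ∞`, for a rapidly decaying kernel. -/
theorem exists_weightedNorm_le {p : ℝ≥0∞} (hp : 1 ≤ p) (s : ℝ) (E : Eu ι ≃L[ℝ] Eu ι) :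
    ∃ N : ℝ, ∀ D : ℝ≥0∞, D ≠ ⊤ → ∃ C : ℝ≥0, 0 < C ∧ ∀ F V : Eu ι → ℂ, Measurable V →
      (∀ z, ‖F z‖ₑ ≤ D * ∫⁻ u, ‖V u‖ₑ * eweight (-N) (z - E u)) →
      weightedNorm p s F ≤ C * weightedNorm p s V := by
  have hfin : ∀ P : ℝ≥0∞ → Prop, (∃ C : ℝ≥0∞, C ≠ ⊤ ∧ ∀ C', C ≤ C' → P C') →
      ∃ C : ℝ≥0, 0 < C ∧ P C := by
    rintro P ⟨C, hC, h⟩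
    lift C to ℝ≥0 using hC
    exact ⟨C + 1, by positivity, h _ (by exact_mod_cast le_self_add)⟩
  -- the decay has to absorb the weight of order `s p` if `p < ∞` and of order `s` if `p = ∞`,
  -- where `p.toReal = 0`
  set N := |s| * p.toReal + |s| + Fintype.card ι + 1 with hN
  have hpr : 0 ≤ |s| * p.toReal := mul_nonneg (abs_nonneg _) ENNReal.toReal_nonneg
  refine ⟨N, fun D hD => hfin (fun C => ∀ F V : Eu ι → ℂ, Measurable V →
    (∀ z, ‖F z‖ₑ ≤ D * ∫⁻ u, ‖V u‖ₑ * eweight (-N) (z - E u)) →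
    weightedNorm p s F ≤ C * weightedNorm p s V) ?_⟩
  rcases eq_or_ne p ⊤ with rfl | hpt
  · obtain ⟨A, hA, hAE⟩ := exists_lintegral_eweight_mul_eweight_sub_le (m := -s) (N := N)
      (by rw [abs_neg, hN]; linarith) E
    refine ⟨D * A, ENNReal.mul_ne_top hD hA, fun C' hC' F V hV h => ?_⟩
    refine le_trans ?_ (mul_le_mul_left hC' _)
    rw [weightedNorm, eLpNorm_exponent_top, eLpNormEssSup]
    refine essSup_le_of_ae_le _ (Eventually.of_forall fun z => ?_)
    change ‖(weight s z : ℂ) * F z‖ₑ ≤ D * A * weightedNorm ⊤ s V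
    rw [enorm_weight_mul]
    set T := weightedNorm ⊤ s V with hT
    have hVT : ∀ᵐ u, eweight s u * ‖V u‖ₑ ≤ T := by
      have := ae_le_eLpNormEssSup (f := fun z => (weight s z : ℂ) * V z)
        (μ := (volume : Measure (Eu ι)))
      simp only [enorm_weight_mul] at this
      rwa [hT, weightedNorm, eLpNorm_exponent_top]
    calc eweight s z * ‖F z‖ₑ
        ≤ eweight s z * (D * ∫⁻ u, ‖V u‖ₑ * eweight (-N) (z - E u)) := by gcongr; exact h z
      _ ≤ eweight s z * (D * ∫⁻ u, T * (eweight (-s) u * eweight (-N) (z - E u))) := by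
          refine mul_le_mul_right (mul_le_mul_right (lintegral_mono_ae ?_) _) _
          filter_upwards [hVT] with u hu
          calc ‖V u‖ₑ * eweight (-N) (z - E u)
              = (eweight s u * eweight (-s) u) * ‖V u‖ₑ * eweight (-N) (z - E u) := by
                rw [eweight_mul_neg, one_mul]
            _ = (eweight s u * ‖V u‖ₑ) * (eweight (-s) u * eweight (-N) (z - E u)) := by ring
            _ ≤ _ := by gcongr
      _ = eweight s z * (D * (T * ∫⁻ u, eweight (-s) u * eweight (-N) (z - E u))) := by
          rw [lintegral_const_mul _ (show Measurable fun u => eweight (-s) u *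
            eweight (-N) (z - E u) from (measurable_eweight _).mul
              (measurable_eweight_sub _ z (E : Eu ι →L[ℝ] Eu ι)))]
      _ ≤ eweight s z * (D * (T * (A * eweight (-s) z))) := by gcongr; exact hAE z
      _ = eweight s z * eweight (-s) z * (D * A * T) := by ring
      _ = _ := by rw [eweight_mul_neg, one_mul]
  · have hp0 : p ≠ 0 := (zero_lt_one.trans_le hp).ne'
    set r := p.toReal with hr
    have hr1 : 1 ≤ r := by
      rw [hr, ← ENNReal.toReal_one]
      exact ENNReal.toReal_mono hpt hp
    have hr0 : 0 < r := by linarith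
    have hcard : (Fintype.card ι : ℝ) < N := by rw [hN]; linarith [abs_nonneg s]
    have hNs : |s * r| + Fintype.card ι < N := by
      rw [abs_mul, abs_of_pos hr0, hN]; linarith [abs_nonneg s]
    obtain ⟨K, hK, hKE⟩ := lintegral_eweight_sub_ne_top hcard
    obtain ⟨K', hK', hKE⟩ := hKE E
    obtain ⟨T, hT, hTo⟩ := exists_lintegral_eweight_mul_le hNs (E : Eu ι →L[ℝ] Eu ι)
      (exists_eweight_equiv_le _ E)
    set Q := D ^ r * ((K' * K) ^ (r - 1) * T) with hQ
    have hQt : Q ≠ ⊤ := ENNReal.mul_ne_top (ENNReal.rpow_ne_top_of_nonneg hr0.le hD)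
      (ENNReal.mul_ne_top (ENNReal.rpow_ne_top_of_nonneg (by linarith)
        (ENNReal.mul_ne_top hK' hK)) hT)
    refine ⟨Q ^ (1 / r), ENNReal.rpow_ne_top_of_nonneg (by positivity) hQt,
      fun C' hC' F V hV h => ?_⟩
    refine le_trans ?_ (mul_le_mul_left hC' _)
    rw [← ENNReal.rpow_le_rpow_iff hr0, ENNReal.mul_rpow_of_nonneg _ _ hr0.le, ← ENNReal.rpow_mul,
      one_div_mul_cancel hr0.ne', ENNReal.rpow_one, weightedNorm_rpow hp0 hpt,
      weightedNorm_rpow hp0 hpt]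
    have hVm : Measurable fun u => ‖V u‖ₑ := hV.enorm
    calc ∫⁻ z, eweight (s * r) z * ‖F z‖ₑ ^ r
        ≤ ∫⁻ z, D ^ r * (K' * K) ^ (r - 1) *
            (eweight (s * r) z * ∫⁻ u, ‖V u‖ₑ ^ r * eweight (-N) (z - E u)) := by
          refine lintegral_mono fun z => ?_
          calc eweight (s * r) z * ‖F z‖ₑ ^ r
              ≤ eweight (s * r) z * (D * ∫⁻ u, ‖V u‖ₑ * eweight (-N) (z - E u)) ^ r := by
                gcongr; exact h z
            _ ≤ eweight (s * r) z * (D ^ r * ((K' * K) ^ (r - 1) *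
                  ∫⁻ u, ‖V u‖ₑ ^ r * eweight (-N) (z - E u))) := by
                rw [ENNReal.mul_rpow_of_nonneg _ _ hr0.le]
                gcongr
                refine (lintegral_mul_rpow_le hVm
                  (measurable_eweight_sub _ z (E : Eu ι →L[ℝ] Eu ι)) hr1).trans ?_
                gcongr
                · exact hKE z
                · exact le_rfl
            _ = _ := by ring
      _ = D ^ r * (K' * K) ^ (r - 1) *
            ∫⁻ z, (eweight (s * r) z * ∫⁻ u, ‖V u‖ₑ ^ r * eweight (-N) (z - E u)) := by
          rw [lintegral_const_mul' _ _ (ENNReal.mul_ne_top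
            (ENNReal.rpow_ne_top_of_nonneg hr0.le hD)
            (ENNReal.rpow_ne_top_of_nonneg (by linarith) (ENNReal.mul_ne_top hK' hK)))]
      _ ≤ D ^ r * (K' * K) ^ (r - 1) * (T * ∫⁻ u, eweight (s * r) u * ‖V u‖ₑ ^ r) := by
          gcongr
          exact hTo _ (hVm.pow_const r)
      _ = _ := by rw [hQ]; ring

end WeightedNorms

/-! ### Distributions given by functions -/

section RegularDistributions

variable {ι : Type*} [Fintype ι]

theorem ae_eq_of_integral_mul_schwartz_eq {F G : Eu ι → ℂ} (hF : LocallyIntegrable F)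
    (hG : LocallyIntegrable G)
    (h : ∀ Φ : 𝓢(Eu ι, ℂ), HasCompactSupport Φ → ∫ z, F z * Φ z = ∫ z, G z * Φ z) :
    F =ᵐ[volume] G := by
  refine ae_eq_of_integral_contDiff_smul_eq hF hG fun χ hχ hs => ?_
  have hc : HasCompactSupport fun x => (χ x : ℂ) := hs.comp_left Complex.ofReal_zero
  have hd : ContDiff ℝ ∞ fun x => (χ x : ℂ) := Complex.ofRealCLM.contDiff.comp hχ
  have h1 : ∀ x, hc.toSchwartzMap hd x = (χ x : ℂ) := fun x => rfl
  have h2 := h (hc.toSchwartzMap hd) hc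
  simp only [h1] at h2
  simpa only [Complex.real_smul, mul_comm (Complex.ofReal _)] using h2

/-- The function which gives a tempered distribution is unique up to null sets. -/
theorem IsGivenBy.ae_eq {T : 𝓢'(Eu ι, ℂ)} {F G : Eu ι → ℂ} (hF : IsGivenBy T F)
    (hG : IsGivenBy T G) : F =ᵐ[volume] G :=
  ae_eq_of_integral_mul_schwartz_eq hF.1 hG.1 fun Φ hΦ => (hF.2 Φ hΦ).symm.trans (hG.2 Φ hΦ)

theorem weightedNorm_congr {p : ℝ≥0∞} {s : ℝ} {F G : Eu ι → ℂ} (h : F =ᵐ[volume] G) :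
    weightedNorm p s F = weightedNorm p s G := by
  refine eLpNorm_congr_ae ?_
  filter_upwards [h] with z hz
  rw [hz]

theorem IsGivenBy.distNorm_eq {T : 𝓢'(Eu ι, ℂ)} {F : Eu ι → ℂ} (hF : IsGivenBy T F) (p : ℝ≥0∞)
    (s : ℝ) : distNorm p s T = weightedNorm p s F :=
  le_antisymm (iInf₂_le F hF) (le_iInf₂ fun _ hG => (weightedNorm_congr (hF.ae_eq hG)).le)

theorem IsGivenBy.memWeightedLp_iff {T : 𝓢'(Eu ι, ℂ)} {F : Eu ι → ℂ} (hF : IsGivenBy T F)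
    (p : ℝ≥0∞) (s : ℝ) : MemWeightedLp p s T ↔ weightedNorm p s F < ⊤ :=
  ⟨fun ⟨_, hG, h⟩ => (weightedNorm_congr (hF.ae_eq hG)).trans_lt h, fun h => ⟨F, hF, h⟩⟩

theorem conjS_conjS (Φ : 𝓢(Eu ι, ℂ)) : conjS (conjS Φ) = Φ := by ext; simp

theorem continuous_uncurry_schwartz {α : Type*} [TopologicalSpace α] {Φ : α → 𝓢(Eu ι, ℂ)}
    (hΦ : Continuous Φ) : Continuous fun q : α × Eu ι => Φ q.1 q.2 := by
  have h1 : Continuous fun a =>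
      SchwartzMap.toBoundedContinuousFunctionCLM ℂ (Eu ι) ℂ (Φ a) :=
    Continuous.comp
      (g := SchwartzMap.toBoundedContinuousFunctionCLM ℂ (Eu ι) ℂ) (f := Φ)
      (SchwartzMap.toBoundedContinuousFunctionCLM ℂ (Eu ι) ℂ).continuous hΦ
  have h2 : Continuous fun q : α × Eu ι =>
      ((SchwartzMap.toBoundedContinuousFunctionCLM ℂ (Eu ι) ℂ (Φ q.1)), q.2) :=
    (h1.comp continuous_fst).prodMk continuous_snd
  exact Continuous.comp
    (g := fun q : BoundedContinuousFunction (Eu ι) ℂ × Eu ι => q.1 q.2)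
    ContinuousEval.continuous_eval h2

theorem enorm_le_eweight {F : Eu ι → ℂ} {C s : ℝ} (hC : 0 ≤ C) {z : Eu ι}
    (h : ‖F z‖ ≤ C * weight s z) : ‖F z‖ₑ ≤ ENNReal.ofReal C * eweight s z := by
  rw [← ofReal_norm, eweight, ← ENNReal.ofReal_mul hC]
  exact ENNReal.ofReal_le_ofReal h

theorem isGivenBy_of_le_eweight {T : 𝓢'(Eu ι, ℂ)} {F : Eu ι → ℂ} (hF : Measurable F)
    {D : ℝ≥0∞} (hD : D ≠ ⊤) {m : ℝ} (h : ∀ z, ‖F z‖ₑ ≤ D * eweight m z)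
    (hT : ∀ Ψ : 𝓢(Eu ι, ℂ), T (conjS Ψ) = ∫ z, F z * conj (Ψ z)) : IsGivenBy T F := by
  refine ⟨?_, fun Φ _ => ?_⟩
  · have h1 : LocallyIntegrable (fun z : Eu ι => D.toReal * weight m z) :=
      (continuous_const.mul (continuous_weight m)).locallyIntegrable
    refine h1.mono hF.aestronglyMeasurable (Eventually.of_forall fun z => ?_)
    rw [Real.norm_of_nonneg (mul_nonneg ENNReal.toReal_nonneg (weight_nonneg _ _))]
    have h2 := ENNReal.toReal_mono (ENNReal.mul_ne_top hD (eweight_ne_top _ _)) (h z)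
    rwa [ENNReal.toReal_mul, eweight, ENNReal.toReal_ofReal (weight_nonneg _ _),
      toReal_enorm] at h2
  · rw [← conjS_conjS Φ, hT]
    simp

end RegularDistributions

/-! ### Shift-invertible Wigner distributions -/

section WignerFunction

variable {ι : Type*} [Fintype ι] (U : 𝓢(Eu (ι ⊕ ι), ℂ) ≃L[ℂ] 𝓢(Eu (ι ⊕ ι), ℂ))

theorem continuous_wignerS_tfShift (φ g : 𝓢(Eu ι, ℂ)) :
    Continuous fun u : Eu (ι ⊕ ι) => wignerS U (tfShift u φ) g := by
  simp_rw [wignerS, tensorConjS_tfShift]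
  exact Continuous.comp (g := U) (f := fun u => tfShift (liftShift u) (tensorConjS φ g))
    U.continuous (Continuous.comp (g := fun u => tfShift u (tensorConjS φ g)) (f := liftShift)
      (continuous_tfShift _) liftShift.continuous)

theorem continuous_uncurry_wignerS (φ g : 𝓢(Eu ι, ℂ)) :
    Continuous fun q : Eu (ι ⊕ ι) × Eu (ι ⊕ ι) => wignerS U (tfShift q.1 φ) g q.2 :=
  continuous_uncurry_schwartz (continuous_wignerS_tfShift U φ g)

/-- The function giving the distribution `W(f, g)` of a shift-invertible `W`: the superposition of
the `W(π(u) φ, g)` with the coefficients `V_φ f(u) / ‖φ‖²`. -/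
noncomputable def wignerFun (φ g : 𝓢(Eu ι, ℂ)) (f : 𝓢'(Eu ι, ℂ)) (z : Eu (ι ⊕ ι)) : ℂ :=
  (sPair φ φ)⁻¹ * ∫ u, stft φ f u * wignerS U (tfShift u φ) g z

theorem measurable_wignerFun (φ g : 𝓢(Eu ι, ℂ)) (f : 𝓢'(Eu ι, ℂ)) :
    Measurable (wignerFun U φ g f) := by
  have h : Continuous fun q : Eu (ι ⊕ ι) × Eu (ι ⊕ ι) =>
      stft φ f q.2 * wignerS U (tfShift q.2 φ) g q.1 :=
    ((continuous_stft φ f).comp continuous_snd).mul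
      (Continuous.comp (g := fun q : Eu (ι ⊕ ι) × Eu (ι ⊕ ι) => wignerS U (tfShift q.1 φ) g q.2)
        (f := Prod.swap) (continuous_uncurry_wignerS U φ g) continuous_swap)
  have h1 : StronglyMeasurable fun z => ∫ u, stft φ f u * wignerS U (tfShift u φ) g z :=
    StronglyMeasurable.integral_prod_right (ν := (volume : Measure (Eu (ι ⊕ ι))))
      (f := fun z u => stft φ f u * wignerS U (tfShift u φ) g z) h.stronglyMeasurable
  exact h1.measurable.const_mul _

variable {U} {E : Eu (ι ⊕ ι) ≃L[ℝ] Eu (ι ⊕ ι)}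

/-- Under shift-invertibility the `W(π(u) φ, g)` are concentrated about the points `E u`. -/
theorem exists_enorm_wignerS_le
    (hE : ∀ (h k : 𝓢(Eu ι, ℂ)) (w z : Eu (ι ⊕ ι)),
      ‖wignerS U (tfShift w h) k z‖ = ‖wignerS U h k (z - E w)‖)
    (φ g : 𝓢(Eu ι, ℂ)) (N : ℝ) :
    ∃ C : ℝ≥0∞, C ≠ ⊤ ∧ ∀ u z, ‖wignerS U (tfShift u φ) g z‖ₑ ≤ C * eweight (-N) (z - E u) := by
  obtain ⟨C, hC, h⟩ := exists_norm_le_weight (wignerS U φ g) N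
  refine ⟨ENNReal.ofReal C, ENNReal.ofReal_ne_top, fun u z => ?_⟩
  have h1 := enorm_le_eweight (F := wignerS U φ g) hC (h (z - E u))
  rwa [← ofReal_norm, ← hE, ofReal_norm] at h1

theorem exists_enorm_wignerFun_le
    (hE : ∀ (h k : 𝓢(Eu ι, ℂ)) (w z : Eu (ι ⊕ ι)),
      ‖wignerS U (tfShift w h) k z‖ = ‖wignerS U h k (z - E w)‖)
    (φ g : 𝓢(Eu ι, ℂ)) (N : ℝ) :
    ∃ C : ℝ≥0∞, C ≠ ⊤ ∧ ∀ (f : 𝓢'(Eu ι, ℂ)) z, ‖wignerFun U φ g f z‖ₑ ≤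
      C * ∫⁻ u, ‖stft φ f u‖ₑ * eweight (-N) (z - E u) := by
  obtain ⟨C, hC, h⟩ := exists_enorm_wignerS_le hE φ g N
  refine ⟨‖(sPair φ φ)⁻¹‖ₑ * C, ENNReal.mul_ne_top enorm_ne_top hC, fun f z => ?_⟩
  rw [wignerFun, enorm_mul, mul_assoc, ← lintegral_const_mul' _ _ hC]
  gcongr
  refine (enorm_integral_le_lintegral_enorm _).trans (lintegral_mono fun u => ?_)
  rw [enorm_mul]
  calc ‖stft φ f u‖ₑ * ‖wignerS U (tfShift u φ) g z‖ₑ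
      ≤ ‖stft φ f u‖ₑ * (C * eweight (-N) (z - E u)) := by gcongr; exact h u z
    _ = _ := by ring

theorem exists_enorm_stft_le (φ : 𝓢(Eu ι, ℂ)) (f : 𝓢'(Eu ι, ℂ)) :
    ∃ C : ℝ≥0∞, C ≠ ⊤ ∧ ∃ m : ℝ, ∀ u, ‖stft φ f u‖ₑ ≤ C * eweight m u := by
  obtain ⟨C, m, hC, h⟩ := exists_norm_stft_le φ f
  exact ⟨_, ENNReal.ofReal_ne_top, m, fun u => enorm_le_eweight hC (h u)⟩

theorem exists_enorm_wignerFun_le_eweight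
    (hE : ∀ (h k : 𝓢(Eu ι, ℂ)) (w z : Eu (ι ⊕ ι)),
      ‖wignerS U (tfShift w h) k z‖ = ‖wignerS U h k (z - E w)‖)
    (φ g : 𝓢(Eu ι, ℂ)) (f : 𝓢'(Eu ι, ℂ)) :
    ∃ C : ℝ≥0∞, C ≠ ⊤ ∧ ∃ m : ℝ, (∀ z, ‖wignerFun U φ g f z‖ₑ ≤ C * eweight m z) ∧
      ∀ z, ∫⁻ u, ‖stft φ f u * wignerS U (tfShift u φ) g z‖ₑ ≤ C * eweight m z := by
  obtain ⟨C, hC, m, h⟩ := exists_enorm_stft_le φ f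
  obtain ⟨B, hB, hBz⟩ := exists_enorm_wignerS_le hE φ g (|m| + Fintype.card (ι ⊕ ι) + 1)
  obtain ⟨A, hA, hAz⟩ := exists_lintegral_eweight_mul_eweight_sub_le (m := m)
    (N := |m| + Fintype.card (ι ⊕ ι) + 1) (by linarith) E
  have key : ∀ z, ∫⁻ u, ‖stft φ f u * wignerS U (tfShift u φ) g z‖ₑ ≤
      C * B * A * eweight m z := by
    intro z
    calc ∫⁻ u, ‖stft φ f u * wignerS U (tfShift u φ) g z‖ₑ
        ≤ ∫⁻ u, C * B * (eweight m u *
            eweight (-(|m| + Fintype.card (ι ⊕ ι) + 1)) (z - E u)) := by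
          refine lintegral_mono fun u => ?_
          rw [enorm_mul]
          refine (mul_le_mul' (h u) (hBz u z)).trans_eq ?_
          ring
      _ ≤ C * B * (A * eweight m z) := by
          rw [lintegral_const_mul' _ _ (ENNReal.mul_ne_top hC hB)]
          gcongr
          exact hAz z
      _ = _ := by ring
  refine ⟨(‖(sPair φ φ)⁻¹‖ₑ + 1) * (C * B * A), by finiteness, m, fun z => ?_, fun z => ?_⟩
  · rw [wignerFun, enorm_mul, mul_assoc]
    exact mul_le_mul' le_self_add ((enorm_integral_le_lintegral_enorm _).trans (key z))
  · refine (key z).trans (mul_le_mul_left ?_ _)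
    exact le_mul_of_one_le_left' le_add_self

theorem lintegral_eweight_mul_enorm_ne_top (m : ℝ) (Ψ : 𝓢(Eu ι, ℂ)) :
    ∫⁻ z, eweight m z * ‖Ψ z‖ₑ ≠ ⊤ := by
  obtain ⟨C, hC, h⟩ := exists_norm_le_weight Ψ (m + Fintype.card ι + 1)
  refine ne_top_of_le_ne_top (b := ∫⁻ z : Eu ι, ENNReal.ofReal C *
    eweight (-(Fintype.card ι + 1 : ℝ)) z) ?_ (lintegral_mono fun z => ?_)
  · rw [lintegral_const_mul' _ _ ENNReal.ofReal_ne_top]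
    exact ENNReal.mul_ne_top ENNReal.ofReal_ne_top (lintegral_eweight_ne_top (by linarith))
  · calc eweight m z * ‖Ψ z‖ₑ
        ≤ eweight m z * (ENNReal.ofReal C * eweight (-(m + Fintype.card ι + 1)) z) := by
          gcongr; exact enorm_le_eweight hC (h z)
      _ = ENNReal.ofReal C * (eweight m z * eweight (-(m + Fintype.card ι + 1)) z) := by ring
      _ = _ := by rw [← eweight_add]; congr 2; ring

/-- The distribution `W(f, g)` is the function `wignerFun`: Fubini's theorem in the inversion
formula, which applies since the `W(π(u) φ, g)` are concentrated about the points `E u`. -/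
theorem wigner_conjS_eq_integral (hU : ∀ Φ Ψ, sPair (U Φ) (U Ψ) = sPair Φ Ψ)
    (hE : ∀ (h k : 𝓢(Eu ι, ℂ)) (w z : Eu (ι ⊕ ι)),
      ‖wignerS U (tfShift w h) k z‖ = ‖wignerS U h k (z - E w)‖)
    {φ : 𝓢(Eu ι, ℂ)} (hφ : φ ≠ 0) (g : 𝓢(Eu ι, ℂ)) (f : 𝓢'(Eu ι, ℂ))
    (Ψ : 𝓢(Eu (ι ⊕ ι), ℂ)) :
    wigner U f g (conjS Ψ) = ∫ z, wignerFun U φ g f z * conj (Ψ z) := by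
  obtain ⟨C, hC, m, -, hm⟩ := exists_enorm_wignerFun_le_eweight hE φ g f
  have hcont : Continuous fun q : Eu (ι ⊕ ι) × Eu (ι ⊕ ι) =>
      stft φ f q.2 * wignerS U (tfShift q.2 φ) g q.1 * conj (Ψ q.1) :=
    (((continuous_stft φ f).comp continuous_snd).mul
      ((continuous_uncurry_wignerS U φ g).comp continuous_swap)).mul
      (Complex.continuous_conj.comp (Ψ.continuous.comp continuous_fst))
  have hint : Integrable (fun q : Eu (ι ⊕ ι) × Eu (ι ⊕ ι) =>
      stft φ f q.2 * wignerS U (tfShift q.2 φ) g q.1 * conj (Ψ q.1))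
      ((volume : Measure (Eu (ι ⊕ ι))).prod volume) := by
    refine ⟨hcont.aestronglyMeasurable, ?_⟩
    rw [HasFiniteIntegral, lintegral_prod _ hcont.enorm.measurable.aemeasurable]
    refine lt_of_le_of_lt (b := ∫⁻ z, C * (eweight m z * ‖Ψ z‖ₑ)) (lintegral_mono fun z => ?_) ?_
    · simp only [enorm_mul, RCLike.enorm_conj]
      rw [lintegral_mul_const' _ _ enorm_ne_top, ← mul_assoc]
      gcongr
      simpa only [enorm_mul] using hm z
    · rw [lintegral_const_mul' _ _ hC]
      exact (ENNReal.mul_ne_top hC (lintegral_eweight_mul_enorm_ne_top m Ψ)).lt_top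
  have hswap := integral_integral_swap
    (f := fun z u => stft φ f u * wignerS U (tfShift u φ) g z * conj (Ψ z)) hint
  have hK := wigner_conjS_mul_sPair_self U hU f g φ Ψ
  have h1 : ∫ u, stft φ f u * sPair (wignerS U (tfShift u φ) g) Ψ =
      ∫ u, ∫ z, stft φ f u * wignerS U (tfShift u φ) g z * conj (Ψ z) := by
    congr 1; ext u
    rw [sPair, ← integral_const_mul]
    simp only [mul_assoc]
  rw [h1, ← hswap] at hK
  rw [← mul_inv_cancel_right₀ (sPair_self_ne_zero hφ) (wigner U f g (conjS Ψ)), hK,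
    ← integral_mul_const]
  congr 1; ext z
  rw [integral_mul_const, wignerFun]
  ring

theorem isGivenBy_wignerFun (hU : ∀ Φ Ψ, sPair (U Φ) (U Ψ) = sPair Φ Ψ)
    (hE : ∀ (h k : 𝓢(Eu ι, ℂ)) (w z : Eu (ι ⊕ ι)),
      ‖wignerS U (tfShift w h) k z‖ = ‖wignerS U h k (z - E w)‖)
    {φ : 𝓢(Eu ι, ℂ)} (hφ : φ ≠ 0) (g : 𝓢(Eu ι, ℂ)) (f : 𝓢'(Eu ι, ℂ)) :
    IsGivenBy (wigner U f g) (wignerFun U φ g f) := by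
  obtain ⟨C, hC, m, hm, -⟩ := exists_enorm_wignerFun_le_eweight hE φ g f
  exact isGivenBy_of_le_eweight (measurable_wignerFun U φ g f) hC hm
    (wigner_conjS_eq_integral hU hE hφ g f)

/-- The short-time Fourier transform is recovered from `W(f, g)` by averaging. -/
theorem exists_enorm_stft_le_wignerFun (hU : ∀ Φ Ψ, sPair (U Φ) (U Ψ) = sPair Φ Ψ)
    (hE : ∀ (h k : 𝓢(Eu ι, ℂ)) (w z : Eu (ι ⊕ ι)),
      ‖wignerS U (tfShift w h) k z‖ = ‖wignerS U h k (z - E w)‖)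
    {φ g : 𝓢(Eu ι, ℂ)} (hφ : φ ≠ 0) (hg : g ≠ 0) (N : ℝ) :
    ∃ C : ℝ≥0∞, C ≠ ⊤ ∧ ∀ (f : 𝓢'(Eu ι, ℂ)) w, ‖stft φ f w‖ₑ ≤
      C * ∫⁻ z, ‖wignerFun U φ g f z‖ₑ * eweight (-N) (z - E w) := by
  obtain ⟨C, hC, h⟩ := exists_enorm_wignerS_le hE φ g N
  refine ⟨‖(sPair g g)⁻¹‖ₑ * C, ENNReal.mul_ne_top enorm_ne_top hC, fun f w => ?_⟩
  have h1 : stft φ f w = (sPair g g)⁻¹ *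
      ∫ z, wignerFun U φ g f z * conj (wignerS U (tfShift w φ) g z) := by
    rw [← wigner_conjS_eq_integral hU hE hφ, wigner_conjS_wignerS,
      inv_mul_cancel_left₀ (sPair_self_ne_zero hg)]
    rfl
  rw [h1, enorm_mul, mul_assoc, ← lintegral_const_mul' _ _ hC]
  gcongr
  refine (enorm_integral_le_lintegral_enorm _).trans (lintegral_mono fun z => ?_)
  rw [enorm_mul, RCLike.enorm_conj]
  calc ‖wignerFun U φ g f z‖ₑ * ‖wignerS U (tfShift w φ) g z‖ₑ
      ≤ ‖wignerFun U φ g f z‖ₑ * (C * eweight (-N) (z - E w)) := by gcongr; exact h w z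
    _ = _ := by ring

theorem exists_eweight_neg_sub_le_symm {N : ℝ} (hN : 0 ≤ N) (E : Eu (ι ⊕ ι) ≃L[ℝ] Eu (ι ⊕ ι)) :
    ∃ C : ℝ≥0∞, C ≠ ⊤ ∧ ∀ z w, eweight (-N) (z - E w) ≤ C * eweight (-N) (w - E.symm z) := by
  obtain ⟨C, hC, h⟩ := exists_eweight_neg_le_clm hN (E.symm : Eu (ι ⊕ ι) →L[ℝ] Eu (ι ⊕ ι))
  refine ⟨C, hC, fun z w => (h _).trans_eq ?_⟩
  rw [eweight_sub_comm _ w]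
  simp

/-- The form of `exists_enorm_stft_le_wignerFun` in which the kernel is centred at a linear image of the
variable of integration. -/
theorem exists_enorm_stft_le_wignerFun_symm (hU : ∀ Φ Ψ, sPair (U Φ) (U Ψ) = sPair Φ Ψ)
    (hE : ∀ (h k : 𝓢(Eu ι, ℂ)) (w z : Eu (ι ⊕ ι)),
      ‖wignerS U (tfShift w h) k z‖ = ‖wignerS U h k (z - E w)‖)
    {φ g : 𝓢(Eu ι, ℂ)} (hφ : φ ≠ 0) (hg : g ≠ 0) (N : ℝ) :
    ∃ C : ℝ≥0∞, C ≠ ⊤ ∧ ∀ (f : 𝓢'(Eu ι, ℂ)) w, ‖stft φ f w‖ₑ ≤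
      C * ∫⁻ z, ‖wignerFun U φ g f z‖ₑ * eweight (-N) (w - E.symm z) := by
  obtain ⟨C, hC, h⟩ := exists_enorm_stft_le_wignerFun hU hE hφ hg (max N 0)
  obtain ⟨B, hB, hBE⟩ := exists_eweight_neg_sub_le_symm (le_max_right N 0) E
  refine ⟨C * B, ENNReal.mul_ne_top hC hB, fun f w => (h f w).trans ?_⟩
  rw [mul_assoc, ← lintegral_const_mul' _ _ hB]
  refine mul_le_mul_right (lintegral_mono fun z => ?_) C
  calc ‖wignerFun U φ g f z‖ₑ * eweight (-max N 0) (z - E w)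
      ≤ ‖wignerFun U φ g f z‖ₑ * (B * eweight (-N) (w - E.symm z)) := by
        gcongr
        refine (hBE z w).trans ?_
        gcongr
        exact eweight_mono (neg_le_neg (le_max_left _ _)) _
    _ = _ := by ring

/-- The modulation space norm of `f` and the norm of `W(f, g)` are equivalent for `1 ≤ p ≤ ∞`. -/
theorem exists_modulationNorm_equiv (hU : ∀ Φ Ψ, sPair (U Φ) (U Ψ) = sPair Φ Ψ)
    (hE : ∀ (h k : 𝓢(Eu ι, ℂ)) (w z : Eu (ι ⊕ ι)),
      ‖wignerS U (tfShift w h) k z‖ = ‖wignerS U h k (z - E w)‖)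
    {φ g : 𝓢(Eu ι, ℂ)} (hφ : φ ≠ 0) (hg : g ≠ 0) {p : ℝ≥0∞} (hp : 1 ≤ p) (s : ℝ) :
    ∃ C : ℝ≥0, 0 < C ∧ ∀ f : 𝓢'(Eu ι, ℂ),
      modulationNorm φ p s f ≤ C * weightedNorm p s (wignerFun U φ g f) ∧
      weightedNorm p s (wignerFun U φ g f) ≤ C * modulationNorm φ p s f := by
  obtain ⟨N, hN⟩ := exists_weightedNorm_le hp s E
  obtain ⟨D, hD, hDE⟩ := exists_enorm_wignerFun_le hE φ g N
  obtain ⟨C, hC, h⟩ := hN D hD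
  obtain ⟨N', hN'⟩ := exists_weightedNorm_le hp s E.symm
  obtain ⟨D', hD', hDE'⟩ := exists_enorm_stft_le_wignerFun_symm hU hE hφ hg N'
  obtain ⟨C', hC', h'⟩ := hN' D' hD'
  refine ⟨max C C', lt_max_of_lt_left hC, fun f => ⟨?_, ?_⟩⟩
  · refine (h' _ _ (measurable_wignerFun U φ g f) (hDE' f)).trans (mul_le_mul_left ?_ _)
    exact_mod_cast le_max_right C C'
  · refine (h _ _ (continuous_stft φ f).measurable (hDE f)).trans (mul_le_mul_left ?_ _)
    exact_mod_cast le_max_left C C'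

/-- A shift-invertible `W(f, g)` is dominated by its own averages. -/
theorem exists_enorm_wignerFun_le_self (hU : ∀ Φ Ψ, sPair (U Φ) (U Ψ) = sPair Φ Ψ)
    (hE : ∀ (h k : 𝓢(Eu ι, ℂ)) (w z : Eu (ι ⊕ ι)),
      ‖wignerS U (tfShift w h) k z‖ = ‖wignerS U h k (z - E w)‖)
    {φ g : 𝓢(Eu ι, ℂ)} (hφ : φ ≠ 0) (hg : g ≠ 0) (f : 𝓢'(Eu ι, ℂ)) (N : ℝ) :
    ∃ C : ℝ≥0∞, C ≠ ⊤ ∧ ∀ z, ‖wignerFun U φ g f z‖ₑ ≤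
      C * ∫⁻ z', ‖wignerFun U φ g f z'‖ₑ * eweight (-N) (z - z') := by
  set M := max N 0 with hM
  set K : ℝ := Fintype.card (ι ⊕ ι) + 1 with hK
  obtain ⟨C, hC, h⟩ := exists_enorm_wignerFun_le hE φ g (M + K)
  obtain ⟨C', hC', h'⟩ := exists_enorm_stft_le_wignerFun hU hE hφ hg M
  obtain ⟨B, hB, hPe⟩ := exists_eweight_neg_sub_le (ι := ι ⊕ ι) (le_max_right N 0)
  obtain ⟨A, hA, hAE⟩ := lintegral_eweight_sub_ne_top (ι := ι ⊕ ι) (N := K) (by linarith)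
  obtain ⟨A', hA', hAE⟩ := hAE E
  set a : Eu (ι ⊕ ι) → ℝ≥0∞ := fun z => ‖wignerFun U φ g f z‖ₑ with ha
  have ham : Measurable a := (measurable_wignerFun U φ g f).enorm
  refine ⟨C * (C' * (B * (A' * A))), by finiteness, fun z => ?_⟩
  have hmeas : Measurable fun q : Eu (ι ⊕ ι) × Eu (ι ⊕ ι) =>
      a q.2 * eweight (-M) (z - q.2) * eweight (-K) (z - E q.1) :=
    ((ham.comp measurable_snd).mul ((measurable_eweight _).comp
      (measurable_const.sub measurable_snd))).mul ((measurable_eweight_sub _ z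
        (E : Eu (ι ⊕ ι) →L[ℝ] Eu (ι ⊕ ι))).comp measurable_fst)
  calc a z ≤ C * ∫⁻ u, ‖stft φ f u‖ₑ * eweight (-(M + K)) (z - E u) := h f z
    _ ≤ C * ∫⁻ u, C' * (B * ∫⁻ z', a z' * eweight (-M) (z - z') * eweight (-K) (z - E u)) := by
        refine mul_le_mul_right (lintegral_mono fun u => ?_) C
        calc ‖stft φ f u‖ₑ * eweight (-(M + K)) (z - E u)
            ≤ C' * (∫⁻ z', a z' * eweight (-M) (z' - E u)) * eweight (-(M + K)) (z - E u) := by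
              gcongr; exact h' f u
          _ = C' * ∫⁻ z', a z' * eweight (-M) (z' - E u) * eweight (-(M + K)) (z - E u) := by
              rw [lintegral_mul_const' _ _ (eweight_ne_top _ _), mul_assoc]
          _ ≤ C' * ∫⁻ z', B * (a z' * eweight (-M) (z - z') * eweight (-K) (z - E u)) := by
              refine mul_le_mul_right (lintegral_mono fun z' => ?_) C'
              calc a z' * eweight (-M) (z' - E u) * eweight (-(M + K)) (z - E u)
                  ≤ a z' * (B * eweight M (z - E u) * eweight (-M) (z - z')) *
                      (eweight (-M) (z - E u) * eweight (-K) (z - E u)) := by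
                    rw [neg_add, eweight_add, eweight_sub_comm (-M) z' (E u),
                      eweight_sub_comm M z (E u), eweight_sub_comm (-M) z (E u)]
                    gcongr
                    rw [eweight_sub_comm M (E u) z]
                    exact hPe z (E u) z'
                _ = eweight M (z - E u) * eweight (-M) (z - E u) *
                      (B * (a z' * eweight (-M) (z - z') * eweight (-K) (z - E u))) := by ring
                _ = _ := by rw [eweight_mul_neg, one_mul]
          _ = _ := by rw [lintegral_const_mul' _ _ hB]
    _ = C * (C' * (B * ∫⁻ u, ∫⁻ z', a z' * eweight (-M) (z - z') * eweight (-K) (z - E u))) := by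
        rw [lintegral_const_mul' _ _ hC', lintegral_const_mul' _ _ hB]
    _ = C * (C' * (B * ∫⁻ z', ∫⁻ u, a z' * eweight (-M) (z - z') * eweight (-K) (z - E u))) := by
        rw [lintegral_lintegral_swap hmeas.aemeasurable]
    _ ≤ C * (C' * (B * ∫⁻ z', A' * A * (a z' * eweight (-N) (z - z')))) := by
        gcongr with z'
        rw [lintegral_const_mul' _ _ (ENNReal.mul_ne_top enorm_ne_top (eweight_ne_top _ _)),
          mul_comm]
        exact mul_le_mul' (hAE z) (mul_le_mul_right
          (eweight_mono (neg_le_neg (le_max_left _ _)) _) _)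
    _ = _ := by
        rw [lintegral_const_mul' _ _ (ENNReal.mul_ne_top hA' hA)]
        ring

/-- For `0 < p ≤ 1`, integrability of a shift-invertible `W(f, g)` implies that `f` belongs to the
modulation space. -/
theorem memModulation_of_weightedNorm_wignerFun (hU : ∀ Φ Ψ, sPair (U Φ) (U Ψ) = sPair Φ Ψ)
    (hE : ∀ (h k : 𝓢(Eu ι, ℂ)) (w z : Eu (ι ⊕ ι)),
      ‖wignerS U (tfShift w h) k z‖ = ‖wignerS U h k (z - E w)‖)
    {φ g : 𝓢(Eu ι, ℂ)} (hφ : φ ≠ 0) (hg : g ≠ 0) {p : ℝ} (hp : 0 < p) (hp1 : p ≤ 1) (s : ℝ)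
    (f : 𝓢'(Eu ι, ℂ)) (hf : weightedNorm (ENNReal.ofReal p) s (wignerFun U φ g f) < ⊤) :
    MemModulation φ (ENNReal.ofReal p) s f := by
  have hp0 : ENNReal.ofReal p ≠ 0 := (ENNReal.ofReal_pos.2 hp).ne'
  have hpt : ENNReal.ofReal p ≠ ⊤ := ENNReal.ofReal_ne_top
  rw [MemModulation, modulationNorm, weightedNorm_lt_top_iff hp0 hpt, ENNReal.toReal_ofReal hp.le]
  rw [weightedNorm_lt_top_iff hp0 hpt, ENNReal.toReal_ofReal hp.le] at hf
  set a : Eu (ι ⊕ ι) → ℝ≥0∞ := fun z => ‖wignerFun U φ g f z‖ₑ with ha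
  have ham : Measurable a := (measurable_wignerFun U φ g f).enorm
  obtain ⟨D, hD, m, hm, -⟩ := exists_enorm_wignerFun_le_eweight hE φ g f
  have hpow := exists_rpow_le_lintegral ham ⟨D, hD, m, hm⟩
    (exists_enorm_wignerFun_le_self hU hE hφ hg f) hp
  set N : ℝ := |s * p| + Fintype.card (ι ⊕ ι) + 1 with hN
  obtain ⟨C, hC, M, hM⟩ := exists_lintegral_rpow_le ham hp hp1 hpow
    (E.symm : Eu (ι ⊕ ι) →L[ℝ] Eu (ι ⊕ ι)) (N := N) (by positivity)
  obtain ⟨B, hB, hBE⟩ := exists_enorm_stft_le_wignerFun_symm hU hE hφ hg M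
  obtain ⟨T, hT, hTo⟩ := exists_lintegral_eweight_mul_le (σ := s * p) (N := N) (by linarith)
    (E.symm : Eu (ι ⊕ ι) →L[ℝ] Eu (ι ⊕ ι)) (exists_eweight_equiv_le _ E.symm)
  have hbound : ∀ w, ‖stft φ f w‖ₑ ^ p ≤
      (B * C) ^ p * ∫⁻ z, a z ^ p * eweight (-N) (w - E.symm z) := by
    intro w
    have h1 := hM w
    simp only [ENNReal.rpow_one] at h1
    calc ‖stft φ f w‖ₑ ^ p ≤ (B * (C * (∫⁻ z, a z ^ p * eweight (-N) (w - E.symm z)) ^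
          (1 / p))) ^ p := by
          refine ENNReal.rpow_le_rpow ((hBE f w).trans ?_) hp.le
          gcongr
          exact h1
      _ = _ := by
          rw [← mul_assoc, ENNReal.mul_rpow_of_nonneg _ _ hp.le, ← ENNReal.rpow_mul,
            one_div_mul_cancel hp.ne', ENNReal.rpow_one]
  have hBC : (B * C) ^ p ≠ ⊤ := ENNReal.rpow_ne_top_of_nonneg hp.le (ENNReal.mul_ne_top hB hC)
  calc ∫⁻ w, eweight (s * p) w * ‖stft φ f w‖ₑ ^ p
      ≤ ∫⁻ w, (B * C) ^ p * (eweight (s * p) w *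
          ∫⁻ z, a z ^ p * eweight (-N) (w - E.symm z)) := by
        refine lintegral_mono fun w => (mul_le_mul_right (hbound w) _).trans_eq ?_
        ring
    _ ≤ (B * C) ^ p * (T * ∫⁻ z, eweight (s * p) z * a z ^ p) := by
        rw [lintegral_const_mul' _ _ hBC]
        gcongr
        exact hTo _ (ham.pow_const p)
    _ < ⊤ := (ENNReal.mul_ne_top hBC (ENNReal.mul_ne_top hT hf.ne)).lt_top

end WignerFunction

/-! ### Bounded functionals and Plancherel's theorem in `L²` -/

section SquareIntegrable

variable {ι : Type*} [Fintype ι]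

/-- The Cauchy–Schwarz inequality. -/
theorem lintegral_mul_sq_le {α : Type*} [MeasurableSpace α] {μ : Measure α} {a b : α → ℝ≥0∞}
    (ha : AEMeasurable a μ) (hb : AEMeasurable b μ) :
    (∫⁻ x, a x * b x ∂μ) ^ 2 ≤ (∫⁻ x, a x ^ 2 ∂μ) * ∫⁻ x, b x ^ 2 ∂μ := by
  have h := ENNReal.lintegral_mul_le_Lp_mul_Lq μ Real.HolderConjugate.two_two ha hb
  simp only [Pi.mul_apply, ENNReal.rpow_two] at h
  have hs : ∀ x : ℝ≥0∞, (x ^ (1 / 2 : ℝ)) ^ 2 = x := fun x => by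
    rw [← ENNReal.rpow_two, ← ENNReal.rpow_mul]; norm_num
  refine (pow_le_pow_left' h 2).trans_eq ?_
  rw [mul_pow, hs, hs]

theorem enorm_integral_mul_sq_le {α : Type*} [MeasurableSpace α] {μ : Measure α} {a b : α → ℂ}
    (ha : AEStronglyMeasurable a μ) (hb : AEStronglyMeasurable b μ) :
    ‖∫ x, a x * b x ∂μ‖ₑ ^ 2 ≤ (∫⁻ x, ‖a x‖ₑ ^ 2 ∂μ) * ∫⁻ x, ‖b x‖ₑ ^ 2 ∂μ := by
  refine le_trans ?_ (lintegral_mul_sq_le ha.enorm hb.enorm)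
  gcongr
  refine (enorm_integral_le_lintegral_enorm _).trans_eq ?_
  simp only [enorm_mul]

theorem eLpNorm_two_sq {α : Type*} [MeasurableSpace α] {μ : Measure α} (F : α → ℂ) :
    eLpNorm F 2 μ ^ 2 = ∫⁻ x, ‖F x‖ₑ ^ 2 ∂μ := by
  have := eLpNorm_nnreal_pow_eq_lintegral (f := F) (μ := μ) (p := 2) two_ne_zero
  simpa using this

theorem enorm_sPair_self (f : 𝓢(Eu ι, ℂ)) : ‖sPair f f‖ₑ = ∫⁻ t, ‖f t‖ₑ ^ 2 := by
  have h1 : Integrable fun t => ‖f t‖ ^ 2 := by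
    have := (integrable_mul_conj f f).norm
    simpa [sq] using this
  rw [sPair_self, ← ofReal_norm, Complex.norm_real,
    Real.norm_of_nonneg (integral_nonneg fun t => by positivity),
    ofReal_integral_eq_lintegral_ofReal h1 (Eventually.of_forall fun t => by positivity)]
  refine lintegral_congr fun t => ?_
  rw [ENNReal.ofReal_pow (norm_nonneg _), ofReal_norm]

theorem enorm_sPair_sq_le (f g : 𝓢(Eu ι, ℂ)) :
    ‖sPair f g‖ₑ ^ 2 ≤ ‖sPair f f‖ₑ * ‖sPair g g‖ₑ := by
  have h := enorm_integral_mul_sq_le (μ := volume) (a := f) (b := conjS g)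
    f.continuous.aestronglyMeasurable (conjS g).continuous.aestronglyMeasurable
  rw [enorm_sPair_self, enorm_sPair_self]
  simpa only [sPair, conjS_apply, RCLike.enorm_conj] using h

theorem enorm_sPair_conjS_self (f : 𝓢(Eu ι, ℂ)) : ‖sPair (conjS f) (conjS f)‖ₑ = ‖sPair f f‖ₑ := by
  simp only [enorm_sPair_self, conjS_apply, RCLike.enorm_conj]

theorem lintegral_enorm_sPair_sq (Ψ φ : 𝓢(Eu ι, ℂ)) :
    ∫⁻ u : Eu (ι ⊕ ι), ‖sPair Ψ (tfShift u φ)‖ₑ ^ 2 = ‖sPair Ψ Ψ‖ₑ * ‖sPair φ φ‖ₑ := by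
  obtain ⟨C, hC, hb⟩ := exists_norm_sPair_tfShift_le Ψ φ (Fintype.card (ι ⊕ ι) + 1)
  have hcont := continuous_sPair_tfShift Ψ φ
  have h1 : Integrable fun u : Eu (ι ⊕ ι) => ‖sPair Ψ (tfShift u φ)‖ ^ 2 := by
    have h2 := integrable_of_norm_le_weight hcont.aestronglyMeasurable hb
    refine (h2.norm.const_mul C).mono' (hcont.norm.pow 2).aestronglyMeasurable
      (Eventually.of_forall fun u => ?_)
    rw [Real.norm_of_nonneg (by positivity), sq]
    gcongr
    refine (hb u).trans (mul_le_of_le_one_right hC ?_)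
    simpa using weight_mono (s := -(Fintype.card (ι ⊕ ι) + 1 : ℝ)) (t := 0)
      (by linarith [Nat.cast_nonneg (α := ℝ) (Fintype.card (ι ⊕ ι))]) u
  rw [← enorm_mul, ← integral_norm_sq_sPair_tfShift, ← ofReal_norm, Complex.norm_real,
    Real.norm_of_nonneg (integral_nonneg fun t => by positivity),
    ofReal_integral_eq_lintegral_ofReal h1 (Eventually.of_forall fun t => by positivity)]
  refine lintegral_congr fun t => ?_
  rw [ENNReal.ofReal_pow (norm_nonneg _), ofReal_norm]

/-- The Riesz representation theorem: a functional on Schwartz functions which is bounded for the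
`L²` norm is given by a square integrable function. -/
theorem exists_eq_integral_of_sq_le (l : 𝓢(Eu ι, ℂ) →ₗ[ℂ] ℂ) {C : ℝ≥0∞} (hC : C ≠ ⊤)
    (h : ∀ Φ, ‖l Φ‖ₑ ^ 2 ≤ C * ‖sPair Φ Φ‖ₑ) :
    ∃ F : Eu ι → ℂ, Measurable F ∧ ∫⁻ z, ‖F z‖ₑ ^ 2 ≤ C ∧ ∀ Φ, l Φ = ∫ z, F z * Φ z := by
  set e : 𝓢(Eu ι, ℂ) →ₗ[ℂ] Lp ℂ 2 (volume : Measure (Eu ι)) :=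
    (SchwartzMap.toLpCLM ℂ ℂ 2 volume).toLinearMap with he
  have hdense : DenseRange e := SchwartzMap.denseRange_toLpCLM (F := ℂ) (p := 2)
    (μ := (volume : Measure (Eu ι))) ENNReal.ofNat_ne_top
  have hen : ∀ Φ, ‖e Φ‖ₑ ^ 2 = ‖sPair Φ Φ‖ₑ := fun Φ => by
    have h1 : e Φ = Φ.toLp 2 volume := rfl
    rw [h1, Lp.enorm_def, eLpNorm_congr_ae (Φ.coeFn_toLp 2 volume), eLpNorm_two_sq,
      enorm_sPair_self]
  have hb : ∀ Φ, ‖l Φ‖ ≤ √C.toReal * ‖e Φ‖ := by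
    intro Φ
    have h2 := h Φ
    rw [← hen] at h2
    have h3 := ENNReal.toReal_mono (ENNReal.mul_ne_top hC (ENNReal.pow_ne_top enorm_ne_top)) h2
    rw [ENNReal.toReal_mul, ENNReal.toReal_pow, ENNReal.toReal_pow, toReal_enorm,
      toReal_enorm] at h3
    refine abs_le_of_sq_le_sq' ?_ (by positivity) |>.2
    rwa [mul_pow, Real.sq_sqrt ENNReal.toReal_nonneg]
  set L := l.extendOfNorm e with hL
  set G := (InnerProductSpace.toDual ℂ (Lp ℂ 2 (volume : Measure (Eu ι)))).symm L with hG
  have hGn : ‖G‖ ≤ √C.toReal := by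
    rw [hG, LinearIsometryEquiv.norm_map]
    exact LinearMap.opNorm_extendOfNorm_le hdense (Real.sqrt_nonneg _) hb
  have hGm := Lp.stronglyMeasurable G
  refine ⟨fun z => conj (G z), Complex.continuous_conj.measurable.comp hGm.measurable, ?_,
    fun Φ => ?_⟩
  · simp only [RCLike.enorm_conj]
    rw [← eLpNorm_two_sq, ← Lp.enorm_def, ← ofReal_norm, ← ENNReal.ofReal_pow (norm_nonneg _)]
    refine ENNReal.ofReal_le_of_le_toReal ?_
    calc ‖G‖ ^ 2 ≤ √C.toReal ^ 2 := by gcongr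
      _ = _ := Real.sq_sqrt ENNReal.toReal_nonneg
  · have h1 : inner ℂ G (e Φ) = l Φ := by
      rw [hG, InnerProductSpace.toDual_symm_apply, hL,
        LinearMap.extendOfNorm_eq hdense ⟨_, hb⟩]
    rw [← h1, L2.inner_def]
    refine integral_congr_ae ?_
    filter_upwards [Φ.coeFn_toLp 2 volume] with z hz
    have h2 : e Φ z = Φ z := hz
    rw [h2, RCLike.inner_apply, mul_comm]

/-- One half of Plancherel's theorem, for integrable functions. -/
theorem lintegral_enorm_sq_le_fourier {H : Eu ι → ℂ} (hH : Integrable H) :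
    ∫⁻ t, ‖H t‖ₑ ^ 2 ≤ ∫⁻ η, ‖𝓕 H η‖ₑ ^ 2 := by
  by_cases hC : ∫⁻ η, ‖𝓕 H η‖ₑ ^ 2 = ⊤
  · rw [hC]; exact le_top
  have hint : ∀ χ : 𝓢(Eu ι, ℂ), Integrable fun t => H t * χ t := fun χ =>
    hH.mul_bdd (c := SchwartzMap.seminorm ℝ 0 0 χ) χ.continuous.aestronglyMeasurable
      (Eventually.of_forall fun t => SchwartzMap.norm_le_seminorm ℝ χ t)
  let l : 𝓢(Eu ι, ℂ) →ₗ[ℂ] ℂ :=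
    { toFun := fun χ => ∫ t, H t * χ t
      map_add' := fun χ χ' => by
        rw [← integral_add (hint χ) (hint χ')]
        simp only [add_apply, mul_add]
      map_smul' := fun c χ => by
        simp only [smul_apply, smul_eq_mul, RingHom.id_apply]
        rw [← integral_const_mul]
        congr 1; ext t; ring }
  have hl : ∀ χ, l χ = ∫ t, H t * χ t := fun χ => rfl
  obtain ⟨F, hF, hFC, hFl⟩ := exists_eq_integral_of_sq_le l hC (fun χ => by
    have h1 : l χ = ∫ η, 𝓕 H η * (𝓕⁻ χ) η := by
      have h2 := VectorFourier.integral_fourierIntegral_smul_eq_flip (L := innerₗ (Eu ι))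
        (μ := volume) (ν := volume) Real.continuous_fourierChar continuous_inner hH
        (𝓕⁻ χ).integrable
      have h3 : (𝓕 (𝓕⁻ χ : 𝓢(Eu ι, ℂ)) : 𝓢(Eu ι, ℂ)) = χ := FourierTransform.fourier_fourierInv_eq χ
      rw [hl]
      conv_lhs => rw [← h3]
      simp only [SchwartzMap.fourier_coe]
      simpa using! h2.symm
    have h4 : Continuous (𝓕 H) := VectorFourier.fourierIntegral_continuous
      Real.continuous_fourierChar (L := innerₗ (Eu ι)) continuous_inner hH
    have h5 : sPair χ χ = sPair (𝓕⁻ χ) (𝓕⁻ χ) := by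
      rw [← sPair_fourier (𝓕⁻ χ), FourierTransform.fourier_fourierInv_eq]
    rw [h1, h5, enorm_sPair_self]
    exact enorm_integral_mul_sq_le h4.aestronglyMeasurable
      (𝓕⁻ χ).continuous.aestronglyMeasurable)
  have hF2 : MemLp F 2 volume := by
    refine ⟨hF.aestronglyMeasurable, ?_⟩
    have h := hFC.trans_lt (lt_top_iff_ne_top.2 hC)
    rw [← eLpNorm_two_sq] at h
    exact (ENNReal.pow_lt_top_iff.1 h).resolve_right two_ne_zero
  have hHF : H =ᵐ[volume] F := ae_eq_of_integral_mul_schwartz_eq hH.locallyIntegrable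
    (hF2.locallyIntegrable one_le_two) fun χ _ => hFl χ
  refine le_of_eq_of_le (lintegral_congr_ae ?_) hFC
  filter_upwards [hHF] with t ht
  rw [ht]

end SquareIntegrable

/-! ### From the modulation space to the Wigner distribution -/

section ModulationToWigner

variable {ι : Type*} [Fintype ι]

/-- The short-time Fourier transform is dominated by its own averages. -/
theorem exists_enorm_stft_le_self {φ : 𝓢(Eu ι, ℂ)} (hφ : φ ≠ 0) (f : 𝓢'(Eu ι, ℂ)) (N : ℝ) :
    ∃ C : ℝ≥0∞, C ≠ ⊤ ∧ ∀ z, ‖stft φ f z‖ₑ ≤ C * ∫⁻ u, ‖stft φ f u‖ₑ * eweight (-N) (z - u) := by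
  obtain ⟨C, hC, h⟩ := exists_norm_sPair_tfShift_le φ φ N
  refine ⟨‖(sPair φ φ)⁻¹‖ₑ * ENNReal.ofReal C, by finiteness, fun z => ?_⟩
  have h1 : stft φ f z = (sPair φ φ)⁻¹ *
      ∫ u, stft φ f u * sPair (tfShift u φ) (tfShift z φ) := by
    rw [← apply_conjS_mul_sPair_self, mul_comm, mul_inv_cancel_right₀ (sPair_self_ne_zero hφ)]
    rfl
  nth_rw 1 [h1]
  rw [enorm_mul, mul_assoc, ← lintegral_const_mul' _ _ ENNReal.ofReal_ne_top]
  gcongr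
  refine (enorm_integral_le_lintegral_enorm _).trans (lintegral_mono fun u => ?_)
  rw [enorm_mul, ← mul_assoc, mul_comm (ENNReal.ofReal C), mul_assoc]
  gcongr
  rw [← ofReal_norm, norm_sPair_tfShift, eweight, ← ENNReal.ofReal_mul hC]
  exact ENNReal.ofReal_le_ofReal (h _)

variable (U : 𝓢(Eu (ι ⊕ ι), ℂ) ≃L[ℂ] 𝓢(Eu (ι ⊕ ι), ℂ))

/-- If `V_φ f` is square integrable, then `W(f, g)` is bounded for the `L²` norm, by the inversion
formula, Moyal's identity and unitarity. -/
theorem exists_enorm_wigner_sq_le (hU : ∀ Φ Ψ, sPair (U Φ) (U Ψ) = sPair Φ Ψ)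
    {φ : 𝓢(Eu ι, ℂ)} (hφ : φ ≠ 0) (g : 𝓢(Eu ι, ℂ)) (f : 𝓢'(Eu ι, ℂ))
    (hf : ∫⁻ u, ‖stft φ f u‖ₑ ^ 2 ≠ ⊤) :
    ∃ C : ℝ≥0∞, C ≠ ⊤ ∧ ∀ Φ, ‖wigner U f g Φ‖ₑ ^ 2 ≤ C * ‖sPair Φ Φ‖ₑ := by
  refine ⟨‖(sPair φ φ)⁻¹‖ₑ ^ 2 * ((∫⁻ u, ‖stft φ f u‖ₑ ^ 2) * (‖sPair g g‖ₑ * ‖sPair φ φ‖ₑ)),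
    by finiteness, fun Φ => ?_⟩
  have hK := wigner_conjS_mul_sPair_self U hU f g φ (conjS Φ)
  rw [conjS_conjS] at hK
  set h : 𝓢(Eu ι, ℂ) := conjS (partialPair g (conjS (U.symm (conjS Φ)))) with hh
  have hu : ∀ ψ : 𝓢(Eu ι, ℂ), sPair (wignerS U ψ g) (conjS Φ) = conj (sPair h ψ) := fun ψ => by
    rw [conj_sPair, hh, sPair_conjS_partialPair, ← hU (tensorConjS ψ g), ContinuousLinearEquiv.apply_symm_apply,
      wignerS]
  have hhn : ‖sPair h h‖ₑ ≤ ‖sPair g g‖ₑ * ‖sPair Φ Φ‖ₑ := by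
    have h1 := enorm_sPair_sq_le (wignerS U h g) (conjS Φ)
    rw [hu, RCLike.enorm_conj, enorm_sPair_conjS_self Φ, wignerS, hU, sPair_tensorConjS_self,
      enorm_mul, sq] at h1
    rcases eq_or_ne (‖sPair h h‖ₑ) 0 with h0 | h0
    · rw [h0]; exact bot_le
    · rw [← ENNReal.mul_le_mul_iff_right h0 enorm_ne_top]
      refine h1.trans_eq ?_
      ring
  have h2 : wigner U f g Φ = (sPair φ φ)⁻¹ * ∫ u, stft φ f u * conj (sPair h (tfShift u φ)) := by
    simp_rw [← hu]
    rw [← hK, mul_comm, mul_inv_cancel_right₀ (sPair_self_ne_zero hφ)]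
  rw [h2, enorm_mul, mul_pow, mul_assoc]
  gcongr
  refine (enorm_integral_mul_sq_le (continuous_stft φ f).aestronglyMeasurable
    (Complex.continuous_conj.comp (continuous_sPair_tfShift h φ)).aestronglyMeasurable).trans ?_
  rw [mul_assoc]
  gcongr
  simp only [Function.comp_apply, RCLike.enorm_conj]
  rw [lintegral_enorm_sPair_sq]
  calc ‖sPair h h‖ₑ * ‖sPair φ φ‖ₑ ≤ ‖sPair g g‖ₑ * ‖sPair Φ Φ‖ₑ * ‖sPair φ φ‖ₑ := by gcongr
    _ = _ := by ring

variable {U} {L : Eu (ι ⊕ ι) →L[ℝ] Eu ((ι ⊕ ι) ⊕ (ι ⊕ ι))}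

/-- The covariance of `W` under time-frequency shifts bounds the short-time Fourier transform of
`W(f, g)` by that of `f`. -/
theorem exists_enorm_stft_wigner_le (hU : ∀ Φ Ψ, sPair (U Φ) (U Ψ) = sPair Φ Ψ)
    (hL : ∀ (h k : 𝓢(Eu ι, ℂ)) (w : Eu (ι ⊕ ι)), ∃ c : ℂ, ‖c‖ = 1 ∧
      wignerS U (tfShift w h) k = c • tfShift (L w) (wignerS U h k))
    {φ : 𝓢(Eu ι, ℂ)} (hφ : φ ≠ 0) (g : 𝓢(Eu ι, ℂ)) (f : 𝓢'(Eu ι, ℂ))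
    (Ψ : 𝓢(Eu (ι ⊕ ι), ℂ)) (N : ℝ) :
    ∃ C : ℝ≥0∞, C ≠ ⊤ ∧ ∀ ζ, ‖stft Ψ (wigner U f g) ζ‖ₑ ≤
      C * ∫⁻ u, ‖stft φ f u‖ₑ * eweight (-N) (ζ - L u) := by
  obtain ⟨C, hC, h⟩ := exists_norm_sPair_tfShift_le (wignerS U φ g) Ψ N
  refine ⟨‖(sPair φ φ)⁻¹‖ₑ * ENNReal.ofReal C, by finiteness, fun ζ => ?_⟩
  have h1 : stft Ψ (wigner U f g) ζ = (sPair φ φ)⁻¹ *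
      ∫ u, stft φ f u * sPair (wignerS U (tfShift u φ) g) (tfShift ζ Ψ) := by
    rw [← wigner_conjS_mul_sPair_self U hU, mul_comm,
      mul_inv_cancel_right₀ (sPair_self_ne_zero hφ)]
    rfl
  rw [h1, enorm_mul, mul_assoc, ← lintegral_const_mul' _ _ ENNReal.ofReal_ne_top]
  gcongr
  refine (enorm_integral_le_lintegral_enorm _).trans (lintegral_mono fun u => ?_)
  rw [enorm_mul, ← mul_assoc, mul_comm (ENNReal.ofReal C), mul_assoc]
  gcongr
  obtain ⟨c, hc, hcu⟩ := hL φ g u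
  rw [hcu, sPair_smul_left, ← ofReal_norm, norm_mul, hc, one_mul, norm_sPair_tfShift, eweight,
    ← ENNReal.ofReal_mul hC]
  exact ENNReal.ofReal_le_ofReal (h _)

/-- The short-time Fourier transform of a function is the Fourier transform of its localizations. -/
theorem fourier_mul_conj_eq_stft {T : 𝓢'(Eu ι, ℂ)} {F : Eu ι → ℂ}
    (hT : ∀ Φ : 𝓢(Eu ι, ℂ), T Φ = ∫ z, F z * Φ z) (Ψ : 𝓢(Eu ι, ℂ)) (x η : Eu ι) :
    𝓕 (fun y => F y * conj (Ψ (y - x))) η = stft Ψ T (joinPair x η) := by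
  rw [stft, hT, Real.fourier_eq]
  congr 1; ext y
  rw [conjS_apply, tfShift_apply', fstPart_joinPair, sndPart_joinPair, Circle.smul_def,
    smul_eq_mul, map_mul, real_inner_comm, AddChar.map_neg_eq_inv, Circle.coe_inv_eq_conj]
  ring

/-- The `L²` norm of a localization is bounded by the short-time Fourier transform at the fixed
position `x`. -/
theorem lintegral_enorm_sq_mul_le {T : 𝓢'(Eu ι, ℂ)} {F : Eu ι → ℂ} (hF : Measurable F)
    (hF2 : ∫⁻ z, ‖F z‖ₑ ^ 2 ≠ ⊤) (hT : ∀ Φ : 𝓢(Eu ι, ℂ), T Φ = ∫ z, F z * Φ z)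
    (Ψ : 𝓢(Eu ι, ℂ)) (x : Eu ι) :
    ∫⁻ y, ‖F y‖ₑ ^ 2 * ‖Ψ (y - x)‖ₑ ^ 2 ≤ ∫⁻ η, ‖stft Ψ T (joinPair x η)‖ₑ ^ 2 := by
  have hFm : MemLp F 2 volume := by
    refine ⟨hF.aestronglyMeasurable, ?_⟩
    rw [← lt_top_iff_ne_top, ← eLpNorm_two_sq] at hF2
    exact (ENNReal.pow_lt_top_iff.1 hF2).resolve_right two_ne_zero
  have hΨ : MemLp (fun y => conj (Ψ (y - x))) 2 volume := by
    have := (conjS (SchwartzMap.compSubConstCLM ℂ x Ψ)).memLp 2 volume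
    simpa using! this
  have h := lintegral_enorm_sq_le_fourier (hFm.integrable_mul hΨ)
  have h1 : (F * fun y => conj (Ψ (y - x))) = fun y => F y * conj (Ψ (y - x)) := rfl
  rw [h1] at h
  simp_rw [fourier_mul_conj_eq_stft hT] at h
  simpa only [enorm_mul, RCLike.enorm_conj, mul_pow] using h

theorem eweight_neg_le_fstPart {s : ℝ} (hs : 0 ≤ s) (z : Eu (ι ⊕ ι)) :
    eweight (-s) z ≤ eweight (-s) (fstPart z) := by
  refine ENNReal.ofReal_le_ofReal ?_
  rw [weight_neg, weight_neg]
  refine inv_anti₀ (weight_pos _ _) ?_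
  simpa using weight_le_of_le hs zero_le_one (z := fstPart z) (w := z) (by
    nlinarith [norm_fstPart_le z, norm_nonneg (fstPart z)])

theorem eweight_neg_le_sndPart {s : ℝ} (hs : 0 ≤ s) (z : Eu (ι ⊕ ι)) :
    eweight (-s) z ≤ eweight (-s) (sndPart z) := by
  refine ENNReal.ofReal_le_ofReal ?_
  rw [weight_neg, weight_neg]
  refine inv_anti₀ (weight_pos _ _) ?_
  simpa using weight_le_of_le hs zero_le_one (z := sndPart z) (w := z) (by
    nlinarith [norm_sndPart_le z, norm_nonneg (sndPart z)])

variable {κ : Type*} [Fintype κ]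

/-- The square of an average over a linear image of `ℝ^κ`, integrated in the second half of the
variables. -/
theorem exists_lintegral_sq_le {L : Eu κ →L[ℝ] Eu (ι ⊕ ι)} {R : Eu (ι ⊕ ι) →L[ℝ] Eu κ}
    (hR : ∀ u, R (L u) = u) {M : ℝ} (hM : 0 ≤ M) :
    ∃ N : ℝ, ∃ C : ℝ≥0∞, C ≠ ⊤ ∧ ∀ a : Eu κ → ℝ≥0∞, Measurable a → ∀ x,
      ∫⁻ η, (∫⁻ u, a u * eweight (-N) (joinPair x η - L u)) ^ 2 ≤
        C * ∫⁻ u, a u ^ 2 * eweight (-M) (x - fstPart (L u)) := by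
  set K : ℝ := Fintype.card ι + Fintype.card κ + 1 with hK
  have hK0 : 0 ≤ K := by positivity
  have hMK : (Fintype.card κ : ℝ) < M + K := by
    linarith [Nat.cast_nonneg (α := ℝ) (Fintype.card ι)]
  have hKι : (Fintype.card ι : ℝ) < K := by
    linarith [Nat.cast_nonneg (α := ℝ) (Fintype.card κ)]
  obtain ⟨B, hB, hBR⟩ := exists_eweight_neg_le_clm (N := M + K) (by positivity) R
  have hA := lintegral_eweight_ne_top hMK
  have hA' := lintegral_eweight_ne_top hKι
  set A := ∫⁻ u : Eu κ, eweight (-(M + K)) u with hAdef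
  set A' := ∫⁻ η : Eu ι, eweight (-K) η with hAdef'
  refine ⟨M + K, B * A * A', by finiteness, fun a ha x => ?_⟩
  have hk : ∀ ζ, ∫⁻ u, eweight (-(M + K)) (ζ - L u) ≤ B * A := by
    intro ζ
    rw [hAdef, ← lintegral_sub_left_eq_self (eweight (-(M + K))) (R ζ),
      ← lintegral_const_mul' _ _ hB]
    refine lintegral_mono fun u => (hBR _).trans_eq ?_
    rw [map_sub, hR]
  have hmeas : Measurable fun q : Eu ι × Eu κ =>
      a q.2 ^ 2 * eweight (-(M + K)) (joinPair x q.1 - L q.2) :=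
    ((ha.comp measurable_snd).pow_const 2).mul ((measurable_eweight _).comp
      (((continuous_joinPair_right x).measurable.comp measurable_fst).sub
        (L.continuous.measurable.comp measurable_snd)))
  calc ∫⁻ η, (∫⁻ u, a u * eweight (-(M + K)) (joinPair x η - L u)) ^ 2
      ≤ ∫⁻ η, B * A * ∫⁻ u, a u ^ 2 * eweight (-(M + K)) (joinPair x η - L u) := by
        refine lintegral_mono fun η => ?_
        have h1 := lintegral_mul_rpow_le (μ := volume) ha
          (measurable_eweight_sub (-(M + K)) (joinPair x η) L) one_le_two
        simp only [ENNReal.rpow_two, show (2 : ℝ) - 1 = 1 by norm_num, ENNReal.rpow_one] at h1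
        refine h1.trans ?_
        gcongr
        exact hk _
    _ = B * A * ∫⁻ η, ∫⁻ u, a u ^ 2 * eweight (-(M + K)) (joinPair x η - L u) :=
        lintegral_const_mul' _ _ (ENNReal.mul_ne_top hB hA)
    _ = B * A * ∫⁻ u, ∫⁻ η, a u ^ 2 * eweight (-(M + K)) (joinPair x η - L u) := by
        rw [lintegral_lintegral_swap hmeas.aemeasurable]
    _ ≤ B * A * ∫⁻ u, ∫⁻ η, a u ^ 2 * eweight (-M) (x - fstPart (L u)) *
          eweight (-K) (η - sndPart (L u)) := by
        refine mul_le_mul_right (lintegral_mono fun u => lintegral_mono fun η => ?_) _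
        rw [neg_add, eweight_add, mul_assoc]
        have h1 := eweight_neg_le_fstPart hM (joinPair x η - L u)
        have h2 := eweight_neg_le_sndPart hK0 (joinPair x η - L u)
        rw [map_sub, fstPart_joinPair] at h1
        rw [map_sub, sndPart_joinPair] at h2
        gcongr
    _ = B * A * ∫⁻ u, A' * (a u ^ 2 * eweight (-M) (x - fstPart (L u))) := by
        congr 1
        refine lintegral_congr fun u => ?_
        rw [lintegral_const_mul _ (measurable_eweight_sub_const _ _),
          lintegral_sub_right_eq_self (eweight (-K)), mul_comm]
    _ = _ := by rw [lintegral_const_mul' _ _ hA']; ring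

/-- Averages of a weight of either sign over translates of a fixed function bound the weight. -/
theorem exists_eweight_le_lintegral (σ : ℝ) {Ψ : 𝓢(Eu κ, ℂ)} (hΨ : Ψ ≠ 0) :
    ∃ C : ℝ≥0∞, C ≠ ⊤ ∧ ∀ y, eweight σ y ≤ C * ∫⁻ x, eweight σ x * ‖Ψ (y - x)‖ₑ ^ 2 := by
  obtain ⟨B, hB, hPe⟩ := exists_eweight_le_mul (ι := κ) σ
  set k : Eu κ → ℝ≥0∞ := fun x => eweight (-|σ|) x * ‖Ψ x‖ₑ ^ 2 with hk
  have hkm : Measurable k := (measurable_eweight _).mul (Ψ.continuous.measurable.enorm.pow_const 2)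
  have hk0 : ∫⁻ x, k x ≠ 0 := by
    intro h0
    rw [lintegral_eq_zero_iff hkm] at h0
    have h1 : (Ψ : Eu κ → ℂ) =ᵐ[volume] fun _ => 0 := by
      filter_upwards [h0] with x hx
      have h2 := (mul_eq_zero.1 hx).resolve_left (eweight_ne_zero _ _)
      simpa using h2
    have h2 := Ψ.continuous.ae_eq_iff_eq volume continuous_const |>.1 h1
    exact hΨ (by ext x; exact congrFun h2 x)
  refine ⟨B * (∫⁻ x, k x)⁻¹, ENNReal.mul_ne_top hB (ENNReal.inv_ne_top.2 hk0), fun y => ?_⟩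
  by_cases hkt : ∫⁻ x, k x = ⊤
  · exfalso
    refine absurd hkt (ne_top_of_le_ne_top (b := ‖sPair Ψ Ψ‖ₑ) enorm_ne_top ?_)
    rw [enorm_sPair_self]
    refine lintegral_mono fun x => mul_le_of_le_one_left' ?_
    refine (eweight_mono (neg_nonpos.2 (abs_nonneg σ)) x).trans_eq (eweight_zero x)
  have h1 : (∫⁻ x, k x) * eweight σ y ≤ B * ∫⁻ x, eweight σ x * ‖Ψ (y - x)‖ₑ ^ 2 := by
    rw [← lintegral_sub_left_eq_self k y, ← lintegral_mul_const' _ _ (eweight_ne_top _ _),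
      ← lintegral_const_mul' _ _ hB]
    refine lintegral_mono fun x => ?_
    calc k (y - x) * eweight σ y
        ≤ k (y - x) * (B * eweight |σ| (y - x) * eweight σ x) := by gcongr; exact hPe y x
      _ = B * (eweight σ x * ‖Ψ (y - x)‖ₑ ^ 2) *
            (eweight |σ| (y - x) * eweight (-|σ|) (y - x)) := by rw [hk]; ring
      _ = _ := by rw [eweight_mul_neg, mul_one]
  calc eweight σ y = (∫⁻ x, k x)⁻¹ * ((∫⁻ x, k x) * eweight σ y) := by
        rw [← mul_assoc, ENNReal.inv_mul_cancel hk0 hkt, one_mul]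
    _ ≤ (∫⁻ x, k x)⁻¹ * (B * ∫⁻ x, eweight σ x * ‖Ψ (y - x)‖ₑ ^ 2) := by gcongr
    _ = _ := by ring

/-- For `0 < p ≤ 2` and `s ≥ 0`, the distribution `W(f, g)` of an `f` in the modulation space is
a function in the weighted `L^p` space. -/
theorem memWeightedLp_wigner (hU : ∀ Φ Ψ, sPair (U Φ) (U Ψ) = sPair Φ Ψ)
    (hL : ∀ (h k : 𝓢(Eu ι, ℂ)) (w : Eu (ι ⊕ ι)), ∃ c : ℂ, ‖c‖ = 1 ∧
      wignerS U (tfShift w h) k = c • tfShift (L w) (wignerS U h k))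
    {R : Eu ((ι ⊕ ι) ⊕ (ι ⊕ ι)) →L[ℝ] Eu (ι ⊕ ι)} (hR : ∀ u, R (L u) = u)
    {φ : 𝓢(Eu ι, ℂ)} (hφ : φ ≠ 0) (g : 𝓢(Eu ι, ℂ)) {p : ℝ≥0∞} (hp0 : 0 < p) (hp2 : p ≤ 2)
    {s : ℝ} (hs : 0 ≤ s) (f : 𝓢'(Eu ι, ℂ)) (hf : MemModulation φ p s f) :
    MemWeightedLp p s (wigner U f g) := by
  have hpt : p ≠ ⊤ := ne_top_of_le_ne_top ENNReal.ofNat_ne_top hp2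
  rw [MemModulation, modulationNorm, weightedNorm_lt_top_iff hp0.ne' hpt] at hf
  set r := p.toReal with hr
  have hr0 : 0 < r := ENNReal.toReal_pos hp0.ne' hpt
  have hr2 : r ≤ 2 := by
    have := ENNReal.toReal_mono ENNReal.ofNat_ne_top hp2
    simpa using this
  have hσ : 0 ≤ s * r := mul_nonneg hs hr0.le
  set a : Eu (ι ⊕ ι) → ℝ≥0∞ := fun u => ‖stft φ f u‖ₑ with ha
  have ham : Measurable a := (continuous_stft φ f).measurable.enorm
  have hpow := exists_rpow_le_lintegral ham (exists_enorm_stft_le φ f)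
    (exists_enorm_stft_le_self hφ f) hr0
  -- the short-time Fourier transform is square integrable
  have ha2 : ∫⁻ u, a u ^ 2 ≠ ⊤ := by
    obtain ⟨C, hC, M, h⟩ := exists_lintegral_rpow_le (κ := ι) ham hr0 hr2 hpow
      (0 : Eu (ι ⊕ ι) →L[ℝ] Eu ι) le_rfl
    have h0 := h 0
    have hw : ∀ t : ℝ, eweight t (0 : Eu ι) = 1 := fun t => by simp [eweight, weight]
    simp only [zero_apply, sub_zero, hw, mul_one, ENNReal.rpow_two] at h0
    refine ne_top_of_le_ne_top (ENNReal.mul_ne_top hC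
      (ENNReal.rpow_ne_top_of_nonneg (by positivity) ?_)) h0
    refine ne_top_of_le_ne_top hf.ne (lintegral_mono fun u => le_mul_of_one_le_left' ?_)
    exact (eweight_zero u).symm.le.trans (eweight_mono hσ u)
  obtain ⟨C, hC, hW⟩ := exists_enorm_wigner_sq_le U hU hφ g f ha2
  obtain ⟨F, hF, hFC, hT⟩ := exists_eq_integral_of_sq_le
    (wigner U f g : 𝓢(Eu (ι ⊕ ι), ℂ) →L[ℂ] ℂ).toLinearMap hC hW
  replace hT : ∀ Φ : 𝓢(Eu (ι ⊕ ι), ℂ), wigner U f g Φ = ∫ z, F z * Φ z := hT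
  have hF2 : ∫⁻ z, ‖F z‖ₑ ^ 2 ≠ ⊤ := ne_top_of_le_ne_top hC hFC
  have hFm : MemLp F 2 volume := by
    refine ⟨hF.aestronglyMeasurable, ?_⟩
    rw [← lt_top_iff_ne_top, ← eLpNorm_two_sq] at hF2
    exact (ENNReal.pow_lt_top_iff.1 hF2).resolve_right two_ne_zero
  refine ⟨F, ⟨hFm.locallyIntegrable one_le_two, fun Φ _ => hT Φ⟩, ?_⟩
  rw [weightedNorm_lt_top_iff hp0.ne' hpt, ← hr]
  -- a non-zero window on `ℝ^{2d}`
  set Ψ : 𝓢(Eu (ι ⊕ ι), ℂ) := tensorConjS φ φ with hΨdef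
  have hΨ : Ψ ≠ 0 := by
    intro h0
    have h1 := sPair_tensorConjS_self φ φ
    rw [← hΨdef, h0] at h1
    have h2 : sPair (0 : 𝓢(Eu (ι ⊕ ι), ℂ)) 0 = 0 := by simp [sPair]
    rw [h2] at h1
    exact mul_ne_zero (sPair_self_ne_zero hφ) (sPair_self_ne_zero hφ) h1.symm
  set N : ℝ := |s * r| + Fintype.card (ι ⊕ ι) + 1 with hN
  obtain ⟨C₁, hC₁, M, h₁⟩ := exists_lintegral_rpow_le ham hr0 hr2 hpow (fstPart ∘L L) (N := N)
    (by positivity)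
  obtain ⟨N', C₂, hC₂, h₂⟩ := exists_lintegral_sq_le hR (le_max_right M 0)
  obtain ⟨C₃, hC₃, h₃⟩ := exists_enorm_stft_wigner_le hU hL hφ g f Ψ N'
  set I : Eu (ι ⊕ ι) → ℝ≥0∞ := fun x => ∫⁻ u, a u ^ r * eweight (-N) (x - fstPart (L u)) with hI
  have hsq : ∀ x, ∫⁻ y, ‖F y‖ₑ ^ 2 * ‖Ψ (y - x)‖ₑ ^ 2 ≤ C₃ ^ 2 * C₂ * C₁ * I x ^ (2 / r) := by
    intro x
    calc ∫⁻ y, ‖F y‖ₑ ^ 2 * ‖Ψ (y - x)‖ₑ ^ 2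
        ≤ ∫⁻ η, ‖stft Ψ (wigner U f g) (joinPair x η)‖ₑ ^ 2 :=
          lintegral_enorm_sq_mul_le hF hF2 hT Ψ x
      _ ≤ ∫⁻ η, C₃ ^ 2 * (∫⁻ u, a u * eweight (-N') (joinPair x η - L u)) ^ 2 := by
          refine lintegral_mono fun η => ?_
          rw [← mul_pow]
          gcongr
          exact h₃ _
      _ ≤ C₃ ^ 2 * (C₂ * ∫⁻ u, a u ^ 2 * eweight (-max M 0) (x - fstPart (L u))) := by
          rw [lintegral_const_mul' _ _ (ENNReal.pow_ne_top hC₃)]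
          gcongr
          exact h₂ a ham x
      _ ≤ C₃ ^ 2 * (C₂ * ∫⁻ u, a u ^ (2 : ℝ) * eweight (-M) (x - fstPart (L u))) := by
          refine mul_le_mul_right (mul_le_mul_right (lintegral_mono fun u => ?_) _) _
          rw [ENNReal.rpow_two]
          gcongr
          exact eweight_mono (neg_le_neg (le_max_left _ _)) _
      _ ≤ C₃ ^ 2 * (C₂ * (C₁ * I x ^ (2 / r))) := by
          gcongr
          exact h₁ x
      _ = _ := by ring
  set S := ∫⁻ y, ‖Ψ y‖ₑ ^ 2 with hSdef
  have hS : S ≠ ⊤ := by rw [hSdef, ← enorm_sPair_self]; exact enorm_ne_top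
  have hr1 : 1 ≤ 2 / r := by rw [le_div_iff₀ hr0]; linarith
  set D := S ^ (2 / r - 1) * (C₃ ^ 2 * C₂ * C₁) with hDdef
  have hD : D ^ (r / 2) ≠ ⊤ := ENNReal.rpow_ne_top_of_nonneg (by positivity)
    (ENNReal.mul_ne_top (ENNReal.rpow_ne_top_of_nonneg (by linarith) hS) (by finiteness))
  have hΨm : ∀ x, Measurable fun y => ‖Ψ (y - x)‖ₑ ^ 2 := fun x =>
    ((Ψ.continuous.comp (continuous_id.sub continuous_const)).measurable.enorm).pow_const 2
  have hFr : Measurable fun y => ‖F y‖ₑ ^ r := hF.enorm.pow_const r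
  -- Hölder's inequality lowers the exponent from `2` to `r`, locally
  have hlocal : ∀ x, ∫⁻ y, ‖F y‖ₑ ^ r * ‖Ψ (y - x)‖ₑ ^ 2 ≤ D ^ (r / 2) * I x := by
    intro x
    have h1 := lintegral_mul_rpow_le (μ := volume) hFr (hΨm x) hr1
    rw [lintegral_sub_right_eq_self (fun y => ‖Ψ y‖ₑ ^ 2)] at h1
    have h2 : ∀ y, (‖F y‖ₑ ^ r) ^ (2 / r) = ‖F y‖ₑ ^ 2 := fun y => by
      rw [← ENNReal.rpow_mul, mul_div_cancel₀ _ hr0.ne', ENNReal.rpow_two]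
    simp only [h2] at h1
    have h3 : (∫⁻ y, ‖F y‖ₑ ^ r * ‖Ψ (y - x)‖ₑ ^ 2) ^ (2 / r) ≤ D * I x ^ (2 / r) :=
      h1.trans ((mul_le_mul_right (hsq x) _).trans_eq (by rw [hDdef]; ring))
    have h4 := ENNReal.rpow_le_rpow h3 (show 0 ≤ r / 2 by positivity)
    have h5 : 2 / r * (r / 2) = 1 := by field_simp
    rwa [ENNReal.mul_rpow_of_nonneg _ _ (show 0 ≤ r / 2 by positivity), ← ENNReal.rpow_mul,
      ← ENNReal.rpow_mul, h5, ENNReal.rpow_one, ENNReal.rpow_one] at h4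
  obtain ⟨B, hB, hBy⟩ := exists_eweight_le_lintegral (s * r) hΨ
  obtain ⟨T, hTt, hTo⟩ := exists_lintegral_eweight_mul_le (σ := s * r) (N := N) (by linarith)
    (fstPart ∘L L) (exists_eweight_clm_le hσ _)
  have hmeas : Measurable fun q : Eu (ι ⊕ ι) × Eu (ι ⊕ ι) =>
      ‖F q.1‖ₑ ^ r * (eweight (s * r) q.2 * ‖Ψ (q.1 - q.2)‖ₑ ^ 2) :=
    (hFr.comp measurable_fst).mul (((measurable_eweight _).comp measurable_snd).mul
      ((Ψ.continuous.measurable.enorm.comp (measurable_fst.sub measurable_snd)).pow_const 2))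
  calc ∫⁻ y, eweight (s * r) y * ‖F y‖ₑ ^ r
      ≤ ∫⁻ y, B * ∫⁻ x, ‖F y‖ₑ ^ r * (eweight (s * r) x * ‖Ψ (y - x)‖ₑ ^ 2) := by
        refine lintegral_mono fun y => ?_
        rw [lintegral_const_mul' _ _ (ENNReal.rpow_ne_top_of_nonneg hr0.le enorm_ne_top)]
        refine (mul_le_mul_left (hBy y) _).trans_eq ?_
        ring
    _ = B * ∫⁻ x, ∫⁻ y, ‖F y‖ₑ ^ r * (eweight (s * r) x * ‖Ψ (y - x)‖ₑ ^ 2) := by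
        rw [lintegral_const_mul' _ _ hB, lintegral_lintegral_swap hmeas.aemeasurable]
    _ = B * ∫⁻ x, eweight (s * r) x * ∫⁻ y, ‖F y‖ₑ ^ r * ‖Ψ (y - x)‖ₑ ^ 2 := by
        congr 1
        refine lintegral_congr fun x => ?_
        rw [← lintegral_const_mul' _ _ (eweight_ne_top _ _)]
        refine lintegral_congr fun y => ?_
        ring
    _ ≤ B * ∫⁻ x, D ^ (r / 2) * (eweight (s * r) x * I x) := by
        refine mul_le_mul_right (lintegral_mono fun x => ?_) _
        refine (mul_le_mul_right (hlocal x) _).trans_eq ?_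
        ring
    _ = B * (D ^ (r / 2) * ∫⁻ x, eweight (s * r) x * I x) := by
        rw [lintegral_const_mul' _ _ hD]
    _ ≤ B * (D ^ (r / 2) * (T * ∫⁻ u, eweight (s * r) u * a u ^ r)) := by
        gcongr
        exact hTo _ (ham.pow_const r)
    _ < ⊤ := (ENNReal.mul_ne_top hB (ENNReal.mul_ne_top hD
        (ENNReal.mul_ne_top hTt hf.ne))).lt_top

end ModulationToWigner

/-! ### Covariance of the Wigner distribution -/

section Covariance

variable {ι : Type*} [Fintype ι]

/-- A left inverse of `liftShift`. -/
noncomputable def dropShift : Eu ((ι ⊕ ι) ⊕ (ι ⊕ ι)) →L[ℝ] Eu (ι ⊕ ι) :=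
  (EuclideanSpace.sumEquivProd (𝕜 := ℝ) (ι := ι) (κ := ι)).symm.toContinuousLinearMap ∘L
    (fstPart ∘L fstPart).prod (fstPart ∘L sndPart)

theorem dropShift_liftShift (u : Eu (ι ⊕ ι)) : dropShift (liftShift u) = u := by
  have h : ∀ z : Eu ((ι ⊕ ι) ⊕ (ι ⊕ ι)), dropShift z =
      joinPair (fstPart (fstPart z)) (fstPart (sndPart z)) := fun z => rfl
  rw [h, liftShift_apply]
  simp only [fstPart_joinPair, sndPart_joinPair, fstPart_sndPart_eq]

variable [DecidableEq ι]

theorem exists_wignerS_tfShift {A : Matrix ((ι ⊕ ι) ⊕ (ι ⊕ ι)) ((ι ⊕ ι) ⊕ (ι ⊕ ι)) ℝ}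
    {U : 𝓢(Eu (ι ⊕ ι), ℂ) ≃L[ℂ] 𝓢(Eu (ι ⊕ ι), ℂ)} (hU : IsMetaplectic A U)
    (h k : 𝓢(Eu ι, ℂ)) (w : Eu (ι ⊕ ι)) : ∃ c : ℂ, ‖c‖ = 1 ∧
      wignerS U (tfShift w h) k =
        c • tfShift ((Matrix.toEuclideanCLM (𝕜 := ℝ) A ∘L liftShift) w) (wignerS U h k) := by
  obtain ⟨c, hc, hcU⟩ := hU.exists_tfShift (liftShift w)
  exact ⟨c, hc, by rw [wignerS, tensorConjS_tfShift, hcU]; rfl⟩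

theorem dropShift_inv_toEuclideanCLM {A : Matrix ((ι ⊕ ι) ⊕ (ι ⊕ ι)) ((ι ⊕ ι) ⊕ (ι ⊕ ι)) ℝ}
    (hA : A ∈ Matrix.symplecticGroup (ι ⊕ ι) ℝ) (u : Eu (ι ⊕ ι)) :
    (dropShift ∘L Matrix.toEuclideanCLM (𝕜 := ℝ) A⁻¹)
      ((Matrix.toEuclideanCLM (𝕜 := ℝ) A ∘L liftShift) u) = u := by
  simp only [ContinuousLinearMap.comp_apply]
  rw [← toEuclideanCLM_mul_apply, Matrix.nonsing_inv_mul A (SymplecticGroup.symplectic_det hA),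
    toEuclideanCLM_one_apply, dropShift_liftShift]

end Covariance

end AWigner

theorem theorem2p13 (d : ℕ)
    (A : Matrix ((Fin d ⊕ Fin d) ⊕ (Fin d ⊕ Fin d)) ((Fin d ⊕ Fin d) ⊕ (Fin d ⊕ Fin d)) ℝ)
    (_hA : A ∈ Matrix.symplecticGroup (Fin d ⊕ Fin d) ℝ)
    -- a choice of the metaplectic operator `μ(A)` (unique up to a phase factor)
    (U : 𝓢(AWigner.Eu (Fin d ⊕ Fin d), ℂ) ≃L[ℂ] 𝓢(AWigner.Eu (Fin d ⊕ Fin d), ℂ))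
    (_hU : AWigner.IsMetaplectic A U)
    -- the window `φ` defining the modulation spaces, the window `g` of the `A`-Wigner distribution
    (φ : 𝓢(AWigner.Eu (Fin d), ℂ)) (_hφ : φ ≠ 0) (g : 𝓢(AWigner.Eu (Fin d), ℂ)) :
    -- (i)
    (∀ p : ℝ≥0∞, 0 < p → p < 2 → ∀ s : ℝ, 0 ≤ s → ∀ f : 𝓢'(AWigner.Eu (Fin d), ℂ),
      AWigner.MemModulation φ p s f → AWigner.MemWeightedLp p s (AWigner.wigner U f g)) ∧
    -- (ii)
    (g ≠ 0 → AWigner.IsShiftInvertible U →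
      -- (iia)
      (∀ p : ℝ≥0∞, 1 ≤ p → p ≤ 2 → ∀ s : ℝ, 0 ≤ s →
        (∀ f : 𝓢'(AWigner.Eu (Fin d), ℂ),
          AWigner.MemModulation φ p s f ↔ AWigner.MemWeightedLp p s (AWigner.wigner U f g)) ∧
        ∃ C : ℝ≥0, 0 < C ∧ ∀ f : 𝓢'(AWigner.Eu (Fin d), ℂ),
          AWigner.modulationNorm φ p s f ≤ C * AWigner.distNorm p s (AWigner.wigner U f g) ∧
          AWigner.distNorm p s (AWigner.wigner U f g) ≤ C * AWigner.modulationNorm φ p s f) ∧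
      -- (iib)
      (∀ p : ℝ≥0∞, 1 ≤ p → ∀ s : ℝ, ∀ f : 𝓢'(AWigner.Eu (Fin d), ℂ),
        AWigner.MemWeightedLp p s (AWigner.wigner U f g) → AWigner.MemModulation φ p s f) ∧
      -- (iic)
      (∀ p : ℝ, 0 < p → p < 1 → ∀ s : ℝ, ∀ f : 𝓢'(AWigner.Eu (Fin d), ℂ),
        AWigner.MemWeightedLp (ENNReal.ofReal p) s (AWigner.wigner U f g) →
        (∃ (γ : 𝓢(AWigner.Eu (Fin d), ℂ)) (Λ : Set (AWigner.Eu (Fin d ⊕ Fin d))),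
          AWigner.IsGaborFrame γ Λ ∧
          AWigner.SamplesMemWeightedLp p s Λ (AWigner.wigner U f γ)) →
        AWigner.MemModulation φ (ENNReal.ofReal p) s f)) := by
  have hsp := fun Φ Ψ => _hU.sPair_eq Φ Ψ
  refine ⟨fun p hp0 hp2 s hs f hf => ?_, fun hg hshift => ?_⟩
  · exact AWigner.memWeightedLp_wigner hsp (AWigner.exists_wignerS_tfShift _hU)
      (AWigner.dropShift_inv_toEuclideanCLM _hA) _hφ g hp0 hp2.le hs f hf
  · obtain ⟨M, hM, hshift⟩ := hshift
    have hE : ∀ (h k : 𝓢(AWigner.Eu (Fin d), ℂ)) (w z : AWigner.Eu (Fin d ⊕ Fin d)),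
        ‖AWigner.wignerS U (AWigner.tfShift w h) k z‖ =
          ‖AWigner.wignerS U h k (z - AWigner.matrixEquiv M hM w)‖ := hshift
    have hgiven := AWigner.isGivenBy_wignerFun hsp hE _hφ g
    refine ⟨fun p hp1 _ s _ => ?_, fun p hp1 s f hf => ?_, fun p hp0 hp1 s f hf _ => ?_⟩
    · obtain ⟨C, hC, h⟩ := AWigner.exists_modulationNorm_equiv hsp hE _hφ hg hp1 s
      refine ⟨fun f => ?_, C, hC, fun f => ?_⟩
      · rw [(hgiven f).memWeightedLp_iff]
        exact ⟨fun hf => (h f).2.trans_lt (ENNReal.mul_lt_top ENNReal.coe_lt_top hf),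
          fun hf => (h f).1.trans_lt (ENNReal.mul_lt_top ENNReal.coe_lt_top hf)⟩
      · rw [(hgiven f).distNorm_eq]
        exact h f
    · obtain ⟨C, -, h⟩ := AWigner.exists_modulationNorm_equiv hsp hE _hφ hg hp1 s
      rw [(hgiven f).memWeightedLp_iff] at hf
      exact (h f).1.trans_lt (ENNReal.mul_lt_top ENNReal.coe_lt_top hf)
    -- below `p = 1` the domination of `W(f, g)` by its own averages replaces Young's inequality
    · rw [(hgiven f).memWeightedLp_iff] at hf
      exact AWigner.memModulation_of_weightedNorm_wignerFun hsp hE _hφ hg hp0 hp1.le s f hf
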